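/- Let $W^1,\dots,W^n,B$ be independent standard Brownian motions on a probability space $(\Omega,\mathcal F,\mathbb P)$ and let $\mathbb F=(\mathcal F_t)$ be the filtration they generate, augmented by the null events. For $i=1,\dots,n$ let $\mu_i>0$, $\sigma_i,\nu_i\ge 0$ with $\sigma_i+\nu_i>0$, $\delta_i>0$ and $\theta_i\in[0,1]$ be constants, and put $$U_i(x,y)=-\exp\Big\{-\tfrac1{\delta_i}\big(1-\tfrac{\theta_i}{n}\big)x+\tfrac{\theta_i}{\delta_i}y\Big\},\qquad \overline z^{(i)}=\tfrac1n\sum_{k\ne i}z^k\quad(z\in\mathbb R^n).$$ Let $(\Pi^i,C^i)_{i=1}^n$ be a DF (deterministic-feedback) strategy on $[0,T]$: each $\Pi^i:[0,T]\to\mathbb R$ is continuous and $C^i(t,x)=\sum_{k=1}^n p^{i,k}(t)x^k+q^i(t)$ with continuous $p^{i,k},q^i:[0,T]\to\mathbb R$. Let $0\le t_0<T$ and $x_0\in\mathbb R^n$, and consider the closed-loop system on $[t_0,T]$ $$dX^i_t=\big(\Pi^i(t)\mu_i-C^i(t,X_t)\big)dt+\Pi^i(t)\nu_i\,dW^i_t+\Pi^i(t)\sigma_i\,dB_t,\qquad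 X^i_{t_0}=x^i_0,\qquad i=1,\dots,n. \quad(*)$$ Then: 1. $(*)$ is a linear SDE $dX_t=(A(t)X_t+b(t))\,dt+D(t)\,d(W^1,\dots,W^n,B)^\top_t$, $X_{t_0}=x_0$, with continuous deterministic $A:[0,T]\to\mathbb R^{n\times n}$, $b:[0,T]\to\mathbb R^n$, $D:[0,T]\to\mathbb R^{n\times(n+1)}$. 2. $(*)$ has a continuous $\mathbb F$-adapted solution $X$, unique up to indistinguishability, and $\mathbb E\big[\sup_{t\in[t_0,T]}|X_t|^2\big]<\infty$. 3. The outcome $\pi^i_t=\Pi^i(t)$, $c^i_t=C^i(t,X_t)$ is admissible: $\pi^i$ and $c^i$ are $\mathbb F$-progressively measurable on $[t_0,T]$ with $\mathbb E\int_{t_0}^T(|\pi^i_t|^2+|c^i_t|^2)\,dt<\infty$ for every $i$; and $X$ is the wealth process of these controls, i.e. $dX^i_t=\pi^i_t(\mu_i\,dt+\nu_i\,dW^i_t+\sigma_i\,dB_t)-c^i_t\,dt$, $X^i_{t_0}=x_0^i$. 4. For every continuous $\beta:[t_0,T]\to\mathbb R^n$ the family $\{\exp(\beta(t)^\top X_t):t\in[t_0,T]\}$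 is uniformly integrable. 5. For every $i$, $U_i(X^i_T,\overline X^{(i)}_T)$ is $\mathcal F_T$-measurable and square integrable, and $$\mathbb E\Big[\int_{t_0}^T\big|U_i(c^i_t,\overline c^{(i)}_t)\big|^2dt+\big|U_i(X^i_T,\overline X^{(i)}_T)\big|^2\Big]<\infty .$$ -/

import Mathlib

open MeasureTheory ProbabilityTheory Filter Topology
open scoped NNReal ENNReal

namespace CARAGame

/-! ### Brownian noise and its filtration -/

/-- The `n + 1` driving processes: the idiosyncratic noises `W k` (index `some k`) and the common
noise `B` (index `none`). -/
def noise {Ω : Type*} {n : ℕ} (W : Fin n → ℝ≥0 → Ω → ℝ) (B : ℝ≥0 → Ω → ℝ) :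
    Option (Fin n) → ℝ≥0 → Ω → ℝ
  | some k => W k
  | none => B

/-- The processes `Z j` are independent standard Brownian motions. -/
structure IsBrownianFamily {Ω ι : Type*} [MeasurableSpace Ω] (P : Measure Ω)
    (Z : ι → ℝ≥0 → Ω → ℝ) : Prop where
  measurable : ∀ j t, Measurable (Z j t)
  brownian : ∀ j, IsBrownianReal (Z j) P
  indep : iIndepFun (fun j ω (t : ℝ≥0) => Z j t ω) P

/-- The filtration generated by the processes `Z j`, augmented by the null events. -/
def generatedFiltration {Ω ι : Type*} [mΩ : MeasurableSpace Ω] (P : Measure Ω)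
    (Z : ι → ℝ≥0 → Ω → ℝ) (hZ : ∀ j t, Measurable (Z j t)) : Filtration ℝ≥0 mΩ where
  seq t := (⨆ j, ⨆ s, ⨆ _ : s ≤ t, MeasurableSpace.comap (Z j s) inferInstance) ⊔
    MeasurableSpace.generateFrom {N : Set Ω | MeasurableSet N ∧ P N = 0}
  mono' := by
    intro s t hst
    refine sup_le_sup_right (iSup_le fun j => iSup_le fun r => iSup_le fun hr => ?_) _
    exact le_iSup_of_le j (le_iSup_of_le r (le_iSup_of_le (hr.trans hst) le_rfl))
  le' := fun _ => sup_le
    (iSup_le fun j => iSup_le fun s => iSup_le fun _ => (hZ j s).comap_le)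
    (MeasurableSpace.generateFrom_le fun _ hN => hN.1)

/-! ### Spaces of processes on `[t₀, T]`

Processes are indexed by real times; only their values on `[t₀, T]` (with `0 ≤ t₀`) matter. -/

/-- Adapted processes on `[t₀, T]` with continuous paths. -/
def IsContinuousAdapted {Ω E : Type*} {mΩ : MeasurableSpace Ω} [TopologicalSpace E]
    [MeasurableSpace E] (𝔽 : Filtration ℝ≥0 mΩ) (t₀ T : ℝ) (Y : ℝ → Ω → E) : Prop :=
  (∀ t ∈ Set.Icc t₀ T, Measurable[𝔽 t.toNNReal] (Y t)) ∧
    ∀ ω, ContinuousOn (fun t => Y t ω) (Set.Icc t₀ T)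

/-- Progressively measurable processes on `[t₀, T]`. -/
def IsProgressiveOn {Ω E : Type*} {mΩ : MeasurableSpace Ω} [MeasurableSpace E]
    (𝔽 : Filtration ℝ≥0 mΩ) (t₀ T : ℝ) (Z : ℝ → Ω → E) : Prop :=
  ∀ s ∈ Set.Icc t₀ T, Measurable[Subtype.instMeasurableSpace.prod (𝔽 s.toNNReal)]
    fun p : Set.Icc t₀ s × Ω => Z p.1 p.2

/-- The space `𝕊²` : continuous adapted processes with `E[sup |Y|²] < ∞`. -/
def MemS2 {Ω E : Type*} {mΩ : MeasurableSpace Ω} [NormedAddCommGroup E] [MeasurableSpace E]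
    (P : Measure Ω) (𝔽 : Filtration ℝ≥0 mΩ) (t₀ T : ℝ) (Y : ℝ → Ω → E) : Prop :=
  IsContinuousAdapted 𝔽 t₀ T Y ∧ ∫⁻ ω, (⨆ t ∈ Set.Icc t₀ T, ‖Y t ω‖ₑ ^ 2) ∂P < ∞

/-- The space `ℍ²` : progressively measurable processes with `E[∫ |Z|² ds] < ∞`. -/
def MemH2 {Ω E : Type*} {mΩ : MeasurableSpace Ω} [NormedAddCommGroup E] [MeasurableSpace E]
    (P : Measure Ω) (𝔽 : Filtration ℝ≥0 mΩ) (t₀ T : ℝ) (Z : ℝ → Ω → E) : Prop :=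
  IsProgressiveOn 𝔽 t₀ T Z ∧ ∫⁻ ω, (∫⁻ s in Set.Icc t₀ T, ‖Z s ω‖ₑ ^ 2) ∂P < ∞

/-- The space `L²` of `m`-measurable square integrable real random variables. -/
def MemL2 {Ω : Type*} {mΩ : MeasurableSpace Ω} (P : Measure Ω) (m : MeasurableSpace Ω)
    (ξ : Ω → ℝ) : Prop :=
  Measurable[m] ξ ∧ MemLp ξ 2 P

/-! ### The Itô integral -/

/-- A simple process `∑ k < N, ξ k · 1_{(grid k, grid (k + 1)]}` on `[t₀, T]`, where `ξ k` is
bounded and measurable with respect to the information at time `grid k`. -/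
structure SimpleProcess {Ω : Type*} {mΩ : MeasurableSpace Ω} (𝔽 : Filtration ℝ≥0 mΩ)
    (t₀ T : ℝ) where
  N : ℕ
  grid : ℕ → ℝ
  grid_mono : Monotone grid
  grid_mem : ∀ k, grid k ∈ Set.Icc t₀ T
  ξ : ℕ → Ω → ℝ
  ξ_meas : ∀ k, Measurable[𝔽 (grid k).toNNReal] (ξ k)
  ξ_bdd : ∀ k, ∃ C : ℝ, ∀ ω, |ξ k ω| ≤ C

namespace SimpleProcess

variable {Ω : Type*} {mΩ : MeasurableSpace Ω} {𝔽 : Filtration ℝ≥0 mΩ} {t₀ T : ℝ}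

/-- The value of the simple process at time `s`. -/
noncomputable def value (H : SimpleProcess 𝔽 t₀ T) (s : ℝ) (ω : Ω) : ℝ :=
  ∑ k ∈ Finset.range H.N,
    (Set.Ioc (H.grid k) (H.grid (k + 1))).indicator (fun _ => H.ξ k ω) s

/-- The stochastic integral from `t₀` to `t` of the simple process against `Z`. -/
noncomputable def integral (H : SimpleProcess 𝔽 t₀ T) (Z : ℝ≥0 → Ω → ℝ) (t : ℝ) (ω : Ω) : ℝ :=
  ∑ k ∈ Finset.range H.N, H.ξ k ω *
    (Z (min (H.grid (k + 1)) t).toNNReal ω - Z (min (H.grid k) t).toNNReal ω)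

end SimpleProcess

/-- `I` is a continuous version of the Itô integral `I t = ∫_{t₀}^t H dZ`, `t ∈ [t₀, T]`, of the
integrand `H ∈ ℍ²` against the Brownian motion `Z`: the `L²` limit of the integrals of simple
processes that converge to `H` in `ℍ²`. -/
def IsItoIntegral {Ω : Type*} {mΩ : MeasurableSpace Ω} (P : Measure Ω) (𝔽 : Filtration ℝ≥0 mΩ)
    (t₀ T : ℝ) (Z : ℝ≥0 → Ω → ℝ) (H I : ℝ → Ω → ℝ) : Prop :=
  MemH2 P 𝔽 t₀ T H ∧ IsContinuousAdapted 𝔽 t₀ T I ∧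
    ∃ S : ℕ → SimpleProcess 𝔽 t₀ T,
      Tendsto (fun m => ∫⁻ ω, (∫⁻ s in Set.Icc t₀ T, ‖(S m).value s ω - H s ω‖ₑ ^ 2) ∂P)
        atTop (𝓝 0) ∧
      ∀ t ∈ Set.Icc t₀ T,
        Tendsto (fun m => ∫⁻ ω, ‖(S m).integral Z t ω - I t ω‖ₑ ^ 2 ∂P) atTop (𝓝 0)

/-! ### Itô processes and stochastic differential equations in `ℝⁿ` -/

/-- `X` is a continuous adapted `ℝⁿ`-valued process on `[t₀, T]` with
`dX^i = drift i dt + ∑ j, diff i j dZ^j` and `X_{t₀} = x₀`. -/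
def IsItoProcess {Ω ι : Type*} {mΩ : MeasurableSpace Ω} [Fintype ι] {n : ℕ} (P : Measure Ω)
    (𝔽 : Filtration ℝ≥0 mΩ) (Z : ι → ℝ≥0 → Ω → ℝ) (t₀ T : ℝ) (x₀ : EuclideanSpace ℝ (Fin n))
    (drift : Fin n → ℝ → Ω → ℝ) (diff : Fin n → ι → ℝ → Ω → ℝ)
    (X : ℝ → Ω → EuclideanSpace ℝ (Fin n)) : Prop :=
  IsContinuousAdapted 𝔽 t₀ T X ∧
    (∀ i, ∀ᵐ ω ∂P, IntegrableOn (fun s => drift i s ω) (Set.Icc t₀ T)) ∧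
    ∃ I : Fin n → ι → ℝ → Ω → ℝ,
      (∀ i j, IsItoIntegral P 𝔽 t₀ T (Z j) (diff i j) (I i j)) ∧
      ∀ᵐ ω ∂P, ∀ t ∈ Set.Icc t₀ T, ∀ i,
        X t ω i = x₀ i + (∫ s in t₀..t, drift i s ω) + ∑ j, I i j t ω

/-- `X` is a (strong) solution on `[t₀, T]` of the stochastic differential equation
`dX^i = b i (t, X) dt + ∑ j, a i j (t, X) dZ^j`, `X_{t₀} = x₀`. -/
def IsSDESolution {Ω ι : Type*} {mΩ : MeasurableSpace Ω} [Fintype ι] {n : ℕ} (P : Measure Ω)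
    (𝔽 : Filtration ℝ≥0 mΩ) (Z : ι → ℝ≥0 → Ω → ℝ) (t₀ T : ℝ) (x₀ : EuclideanSpace ℝ (Fin n))
    (b : Fin n → ℝ → EuclideanSpace ℝ (Fin n) → ℝ)
    (a : Fin n → ι → ℝ → EuclideanSpace ℝ (Fin n) → ℝ)
    (X : ℝ → Ω → EuclideanSpace ℝ (Fin n)) : Prop :=
  IsItoProcess P 𝔽 Z t₀ T x₀ (fun i t ω => b i t (X t ω)) (fun i j t ω => a i j t (X t ω)) X

/-! ### The game -/

/-- Market and preference parameters of the `n` agents. -/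
structure Params (n : ℕ) where
  μ : Fin n → ℝ
  ν : Fin n → ℝ
  σ : Fin n → ℝ
  δ : Fin n → ℝ
  θ : Fin n → ℝ
  μ_pos : ∀ i, 0 < μ i
  ν_nonneg : ∀ i, 0 ≤ ν i
  σ_nonneg : ∀ i, 0 ≤ σ i
  vol_pos : ∀ i, 0 < σ i + ν i
  δ_pos : ∀ i, 0 < δ i
  θ_mem : ∀ i, θ i ∈ Set.Icc (0 : ℝ) 1

/-- The average `(1/n) ∑_{k ≠ i} x^k` over the other agents. -/
noncomputable def othersMean {n : ℕ} (i : Fin n) (x : Fin n → ℝ) : ℝ :=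
  (1 / (n : ℝ)) * ∑ k ∈ Finset.univ.erase i, x k

/-- The utility of agent `i` as a function of `x^i` and the average over the other agents. -/
noncomputable def Params.utility {n : ℕ} (κ : Params n) (i : Fin n) (x y : ℝ) : ℝ :=
  -Real.exp (-(1 / κ.δ i) * (1 - κ.θ i / n) * x + κ.θ i / κ.δ i * y)

/-- The volatility loading of the wealth of agent `i`, who holds the amount `p` of stock `i`, on
the noise with index `j`. -/
def Params.loading {n : ℕ} (κ : Params n) (i : Fin n) (p : ℝ) : Option (Fin n) → ℝ
  | some k => if k = i then p * κ.ν i else 0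
  | none => p * κ.σ i

/-- `X` is the wealth process of the agents under the controls `(π, c)`:
`dX^i = π^i (μ_i dt + ν_i dW^i + σ_i dB) - c^i dt`, `X_{t₀} = x₀`. -/
def IsWealth {Ω : Type*} {mΩ : MeasurableSpace Ω} {n : ℕ} (κ : Params n) (P : Measure Ω)
    (𝔽 : Filtration ℝ≥0 mΩ) (W : Fin n → ℝ≥0 → Ω → ℝ) (B : ℝ≥0 → Ω → ℝ) (t₀ T : ℝ)
    (x₀ : EuclideanSpace ℝ (Fin n)) (π c : Fin n → ℝ → Ω → ℝ)
    (X : ℝ → Ω → EuclideanSpace ℝ (Fin n)) : Prop :=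
  IsItoProcess P 𝔽 (noise W B) t₀ T x₀ (fun i t ω => π i t ω * κ.μ i - c i t ω)
    (fun i j t ω => κ.loading i (π i t ω) j) X

/-- The `n`-tuple of controls `(π, c)` is admissible over `[t₀, T]`. -/
def IsAdmissible {Ω : Type*} {mΩ : MeasurableSpace Ω} {n : ℕ} (P : Measure Ω)
    (𝔽 : Filtration ℝ≥0 mΩ) (t₀ T : ℝ) (π c : Fin n → ℝ → Ω → ℝ) : Prop :=
  ∀ i, MemH2 P 𝔽 t₀ T (π i) ∧ MemH2 P 𝔽 t₀ T (c i)

/-- The integrability condition over `[t₀, T]` for the controls `(π, c)`: they are admissible, their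
wealth process exists, and the utilities of consumption and terminal wealth are square
integrable. -/
def IntegrabilityCondition {Ω : Type*} {mΩ : MeasurableSpace Ω} {n : ℕ} (κ : Params n)
    (P : Measure Ω) (𝔽 : Filtration ℝ≥0 mΩ) (W : Fin n → ℝ≥0 → Ω → ℝ) (B : ℝ≥0 → Ω → ℝ)
    (t₀ T : ℝ) (x₀ : EuclideanSpace ℝ (Fin n)) (π c : Fin n → ℝ → Ω → ℝ) : Prop :=
  IsAdmissible P 𝔽 t₀ T π c ∧ (∃ X, IsWealth κ P 𝔽 W B t₀ T x₀ π c X) ∧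
    ∀ X, IsWealth κ P 𝔽 W B t₀ T x₀ π c X → ∀ i,
      ∫⁻ ω, ((∫⁻ t in Set.Icc t₀ T,
          ‖κ.utility i (c i t ω) (othersMean i fun k => c k t ω)‖ₑ ^ 2) +
        ‖κ.utility i (X T ω i) (othersMean i fun k => X T ω k)‖ₑ ^ 2) ∂P < ∞

/-- `(Pol, Con)` is a deterministic-feedback strategy: the amounts `Pol i` invested are continuous
functions of time, and the consumption rates `Con i` are affine in the state with continuous
coefficients. -/
def IsDFStrategy {n : ℕ} (T : ℝ) (Pol : Fin n → ℝ → ℝ)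
    (Con : Fin n → ℝ → EuclideanSpace ℝ (Fin n) → ℝ) : Prop :=
  ∀ i, ContinuousOn (Pol i) (Set.Icc 0 T) ∧
    ∃ (p : Fin n → ℝ → ℝ) (q : ℝ → ℝ),
      (∀ k, ContinuousOn (p k) (Set.Icc 0 T)) ∧ ContinuousOn q (Set.Icc 0 T) ∧
      ∀ t ∈ Set.Icc 0 T, ∀ x, Con i t x = ∑ k, p k t * x k + q t

/-- Drift coefficients of the closed-loop system. -/
def closedLoopDrift {n : ℕ} (κ : Params n) (Pol : Fin n → ℝ → ℝ)
    (Con : Fin n → ℝ → EuclideanSpace ℝ (Fin n) → ℝ) (i : Fin n) (t : ℝ)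
    (x : EuclideanSpace ℝ (Fin n)) : ℝ :=
  Pol i t * κ.μ i - Con i t x

/-- Diffusion coefficients of the closed-loop system. -/
def closedLoopDiff {n : ℕ} (κ : Params n) (Pol : Fin n → ℝ → ℝ) (i : Fin n)
    (j : Option (Fin n)) (t : ℝ) (_x : EuclideanSpace ℝ (Fin n)) : ℝ :=
  κ.loading i (Pol i t) j

/-- `X` solves the closed-loop system on `[t₀, T]` from `x₀` when the agents use `(Pol, Con)`:
`dX^i = (Pol^i μ_i - Con^i(t, X)) dt + Pol^i ν_i dW^i + Pol^i σ_i dB`, `X_{t₀} = x₀`. -/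
def IsClosedLoopSolution {Ω : Type*} {mΩ : MeasurableSpace Ω} {n : ℕ} (κ : Params n)
    (P : Measure Ω) (𝔽 : Filtration ℝ≥0 mΩ) (W : Fin n → ℝ≥0 → Ω → ℝ) (B : ℝ≥0 → Ω → ℝ)
    (t₀ T : ℝ) (x₀ : EuclideanSpace ℝ (Fin n)) (Pol : Fin n → ℝ → ℝ)
    (Con : Fin n → ℝ → EuclideanSpace ℝ (Fin n) → ℝ)
    (X : ℝ → Ω → EuclideanSpace ℝ (Fin n)) : Prop :=
  IsSDESolution P 𝔽 (noise W B) t₀ T x₀ (closedLoopDrift κ Pol Con) (closedLoopDiff κ Pol) X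

/-- `X` solves the linear equation `dX = (A(t) X + b(t)) dt + D(t) d(W, B)`, `X_{t₀} = x₀`. -/
def IsLinearSDESolution {Ω : Type*} {mΩ : MeasurableSpace Ω} {n : ℕ}
    (P : Measure Ω) (𝔽 : Filtration ℝ≥0 mΩ) (W : Fin n → ℝ≥0 → Ω → ℝ) (B : ℝ≥0 → Ω → ℝ)
    (t₀ T : ℝ) (x₀ : EuclideanSpace ℝ (Fin n)) (A : ℝ → Matrix (Fin n) (Fin n) ℝ)
    (b : ℝ → Fin n → ℝ) (D : ℝ → Matrix (Fin n) (Option (Fin n)) ℝ)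
    (X : ℝ → Ω → EuclideanSpace ℝ (Fin n)) : Prop :=
  IsSDESolution P 𝔽 (noise W B) t₀ T x₀ (fun i t x => ∑ k, A t i k * x k + b t i)
    (fun i j t _ => D t i j) X

end CARAGame

/-!
The diffusion coefficients of the closed-loop system do not depend on the state, so the stochastic
integrals `∫ D dZ` enter the equation only as an additive term. Along each path the system is an
ordinary integral equation `x t = y t + ∫ s in t₀..t, F s (x s)` with a Lipschitz vector field `F`:
Picard iteration solves it, adaptedly, and Grönwall's inequality gives uniqueness together with the
bound `sup ‖x‖ ≤ C * (1 + sup ‖y‖)`.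

For integrability it therefore suffices to control `sup ‖y‖`, that is, the Wiener integrals `I` of
the continuous deterministic entries of `D`. As a limit of Riemann sums with Gaussian increments,
`I` satisfies `E[exp (l * I t)] ≤ exp (K * l²)`, and Doob's maximal inequality for the submartingale
`exp (l * |I|)` gives `sup |I|` Gaussian tails. Hence `sup ‖X‖` has exponential moments of all
orders, and each integrand in the theorem is dominated by `exp (c * sup ‖X‖)`.
-/

namespace CARAGame

/-! ### Brownian motions relative to a filtration -/

/-- `Z` is a standard Brownian motion up to its value at time `0`, relative to the filtration `𝔽`:
it is adapted and its increments are independent of the past. All null events are required to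
belong to `𝔽 0`, so that adapted processes may be modified on them. -/
structure IsBrownianFor {Ω : Type*} {mΩ : MeasurableSpace Ω} (P : Measure Ω)
    (𝔽 : Filtration ℝ≥0 mΩ) (Z : ℝ≥0 → Ω → ℝ) : Prop where
  adapted : ∀ t, Measurable[𝔽 t] (Z t)
  cont : ∀ᵐ ω ∂P, Continuous (Z · ω)
  law : ∀ s t, s ≤ t → HasLaw (fun ω => Z t ω - Z s ω) (gaussianReal 0 (t - s)) P
  indep : ∀ s t, s ≤ t →
    Indep (MeasurableSpace.comap (fun ω => Z t ω - Z s ω) inferInstance) (𝔽 s) P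
  null_mem : ∀ N, MeasurableSet N → P N = 0 → MeasurableSet[𝔽 0] N

section Independence

variable {Ω : Type*} {mΩ : MeasurableSpace Ω} {P : Measure Ω}

lemma sup_eq_generateFrom_image2_inter (m₁ m₂ : MeasurableSpace Ω) :
    m₁ ⊔ m₂ = MeasurableSpace.generateFrom
      (Set.image2 (· ∩ ·) {s | MeasurableSet[m₁] s} {s | MeasurableSet[m₂] s}) := by
  refine le_antisymm (sup_le (fun s hs => ?_) (fun s hs => ?_))
    (MeasurableSpace.generateFrom_le ?_)
  · exact MeasurableSpace.measurableSet_generateFrom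
      ⟨s, hs, Set.univ, MeasurableSet.univ, Set.inter_univ s⟩
  · exact MeasurableSpace.measurableSet_generateFrom
      ⟨Set.univ, MeasurableSet.univ, s, hs, Set.univ_inter s⟩
  · rintro _ ⟨s, hs, t, ht, rfl⟩
    exact MeasurableSet.inter ((le_sup_left : m₁ ≤ m₁ ⊔ m₂) _ hs)
      ((le_sup_right : m₂ ≤ m₁ ⊔ m₂) _ ht)

lemma isPiSystem_image2_inter (m₁ m₂ : MeasurableSpace Ω) :
    IsPiSystem (Set.image2 (· ∩ ·) {s | MeasurableSet[m₁] s} {s | MeasurableSet[m₂] s}) := by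
  rintro _ ⟨s, hs, t, ht, rfl⟩ _ ⟨s', hs', t', ht', rfl⟩ -
  exact ⟨s ∩ s', MeasurableSet.inter hs hs', t ∩ t', MeasurableSet.inter ht ht',
    Set.inter_inter_inter_comm s s' t t'⟩

lemma indep_sup_right [IsZeroOrProbabilityMeasure P] {m₁ m₂ m₃ : MeasurableSpace Ω}
    (h₁ : m₁ ≤ mΩ) (h₂ : m₂ ≤ mΩ) (h₃ : m₃ ≤ mΩ) (h₁₂ : Indep m₁ m₂ P)
    (h₁₂₃ : Indep (m₁ ⊔ m₂) m₃ P) : Indep m₁ (m₂ ⊔ m₃) P := by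
  refine IndepSets.indep h₁ (sup_le h₂ h₃) (@MeasurableSpace.isPiSystem_measurableSet _ m₁)
    (isPiSystem_image2_inter m₂ m₃) (@MeasurableSpace.generateFrom_measurableSet _ m₁).symm
    (sup_eq_generateFrom_image2_inter m₂ m₃) ((IndepSets_iff _ _ _).2 ?_)
  rintro s _ hs ⟨t, ht, u, hu, rfl⟩
  have hs' : MeasurableSet[m₁ ⊔ m₂] s := (le_sup_left : m₁ ≤ m₁ ⊔ m₂) _ hs
  have ht' : MeasurableSet[m₁ ⊔ m₂] t := (le_sup_right : m₂ ≤ m₁ ⊔ m₂) _ ht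
  rw [Indep_iff] at h₁₂ h₁₂₃
  calc P (s ∩ (t ∩ u)) = P (s ∩ t) * P u := by
        rw [← Set.inter_assoc, h₁₂₃ _ u (hs'.inter ht') hu]
    _ = P s * (P t * P u) := by rw [h₁₂ s t hs ht, mul_assoc]
    _ = P s * P (t ∩ u) := by rw [h₁₂₃ t u ht' hu]

lemma indep_sup_null {m₁ m₂ : MeasurableSpace Ω} (h : Indep m₁ m₂ P) :
    Indep m₁ (m₂ ⊔ MeasurableSpace.generateFrom {N : Set Ω | MeasurableSet[mΩ] N ∧ P N = 0}) P := by
  have hle : m₂ ⊔ MeasurableSpace.generateFrom {N : Set Ω | MeasurableSet[mΩ] N ∧ P N = 0} ≤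
      eventuallyMeasurableSpace m₂ (ae P) := by
    refine sup_le le_eventuallyMeasurableSpace (MeasurableSpace.generateFrom_le ?_)
    rintro N ⟨-, hN⟩
    exact ⟨∅, MeasurableSet.empty, ae_eq_empty.2 hN⟩
  rw [Indep_iff] at h ⊢
  intro s t hs ht
  obtain ⟨t', ht', htt'⟩ := hle _ ht
  rw [measure_congr htt', measure_congr ((ae_eq_refl s).inter htt')]
  exact h s t' hs ht'

end Independence

section Family

variable {Ω ι : Type*} {mΩ : MeasurableSpace Ω} {P : Measure Ω} {Z : ι → ℝ≥0 → Ω → ℝ}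

lemma IsBrownianFamily.indep_increment_past (hZ : IsBrownianFamily P Z) (j : ι) {s t : ℝ≥0}
    (hst : s ≤ t) :
    Indep (MeasurableSpace.comap (fun ω => Z j t ω - Z j s ω) inferInstance)
      (MeasurableSpace.comap (fun ω (r : Set.Iic s) => Z j r ω) inferInstance) P := by
  have hshift := ((hZ.brownian j).toIsPreBrownianReal.indepFun_shift s).comp
    (measurable_pi_apply (t - s)) measurable_id
  have hincr : (fun f : ℝ≥0 → ℝ => f (t - s)) ∘ (fun ω r => Z j (s + r) ω - Z j s ω) =
      fun ω => Z j t ω - Z j s ω := by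
    ext ω; simp [add_tsub_cancel_of_le hst]
  rw [← hincr]
  exact hshift

lemma IsBrownianFamily.indep_increment [IsZeroOrProbabilityMeasure P]
    (hZ : IsBrownianFamily P Z) (j : ι) {s t : ℝ≥0} (hst : s ≤ t) :
    Indep (MeasurableSpace.comap (fun ω => Z j t ω - Z j s ω) inferInstance)
      (⨆ k, ⨆ r, ⨆ _ : r ≤ s, MeasurableSpace.comap (Z k r) inferInstance) P := by
  set whole : ι → MeasurableSpace Ω :=
    fun k => MeasurableSpace.comap (fun ω (t : ℝ≥0) => Z k t ω) inferInstance
  have whole_le : ∀ k, whole k ≤ mΩ := fun k =>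
    (measurable_pi_lambda _ fun t => hZ.measurable k t).comap_le
  have measurable_whole : ∀ k r, Measurable[whole k] (Z k r) := fun k r =>
    (measurable_pi_apply r).comp (comap_measurable (fun ω (t : ℝ≥0) => Z k t ω))
  have incr_le : MeasurableSpace.comap (fun ω => Z j t ω - Z j s ω) inferInstance ≤ whole j :=
    ((measurable_whole j t).sub (measurable_whole j s)).comap_le
  have past_le :
      MeasurableSpace.comap (fun ω (r : Set.Iic s) => Z j r ω) inferInstance ≤ whole j :=
    (@measurable_pi_lambda _ _ _ (whole j) _ _ fun r : Set.Iic s =>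
      measurable_whole j r).comap_le
  have indep_others : Indep (whole j) (⨆ k ∈ ({j}ᶜ : Set ι), whole k) P := by
    simpa using indep_iSup_of_disjoint whole_le hZ.indep (S := {j}) (T := {j}ᶜ)
      disjoint_compl_right
  have indep_past_others := indep_sup_right (incr_le.trans (whole_le j))
    (past_le.trans (whole_le j)) (iSup₂_le fun k _ => whole_le k)
    (hZ.indep_increment_past j hst)
    (indep_of_indep_of_le_left indep_others (sup_le incr_le past_le))
  refine indep_of_indep_of_le_right indep_past_others
    (iSup_le fun k => iSup₂_le fun r hr => ?_)
  by_cases hk : k = j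
  · subst hk
    exact le_sup_of_le_left ((measurable_pi_apply (⟨r, hr⟩ : Set.Iic s)).comp
      (comap_measurable (fun ω (r : Set.Iic s) => Z k r ω))).comap_le
  · exact le_sup_of_le_right (le_iSup₂_of_le k hk (measurable_whole k r).comap_le)

lemma IsBrownianFamily.isBrownianFor [IsZeroOrProbabilityMeasure P] (hZ : IsBrownianFamily P Z)
    (j : ι) : IsBrownianFor P (generatedFiltration P Z hZ.measurable) (Z j) where
  adapted t := (comap_measurable (Z j t)).mono
    (le_sup_of_le_left (le_iSup_of_le j (le_iSup₂_of_le t le_rfl le_rfl))) le_rfl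
  cont := (hZ.brownian j).cont
  law s t hst := by
    have hdist : nndist t.1 s.1 = t - s := by
      apply NNReal.eq
      rw [coe_nndist, Real.dist_eq, NNReal.coe_sub hst]
      exact abs_of_nonneg (sub_nonneg.2 (NNReal.coe_le_coe.2 hst))
    have hlaw := (hZ.brownian j).toIsPreBrownianReal.hasLaw_sub t s
    rw [hdist] at hlaw
    exact hlaw
  indep s t hst := indep_sup_null (hZ.indep_increment j hst)
  null_mem N hN hN0 := (le_sup_right : MeasurableSpace.generateFrom _ ≤ _) N
    (MeasurableSpace.measurableSet_generateFrom ⟨hN, hN0⟩)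

end Family

namespace IsBrownianFor

variable {Ω : Type*} {mΩ : MeasurableSpace Ω} {P : Measure Ω} {𝔽 : Filtration ℝ≥0 mΩ}
  {Z : ℝ≥0 → Ω → ℝ}

lemma measurable (hZ : IsBrownianFor P 𝔽 Z) (t : ℝ≥0) : Measurable (Z t) :=
  (hZ.adapted t).mono (𝔽.le t) le_rfl

lemma measurable_of_le (hZ : IsBrownianFor P 𝔽 Z) {s t : ℝ≥0} (hst : s ≤ t) :
    Measurable[𝔽 t] (Z s) :=
  (hZ.adapted s).mono (𝔽.mono hst) le_rfl

lemma exists_null_of_ae (hZ : IsBrownianFor P 𝔽 Z) {p : Ω → Prop} (hp : ∀ᵐ ω ∂P, p ω) :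
    ∃ N : Set Ω, P N = 0 ∧ (∀ t, MeasurableSet[𝔽 t] N) ∧ ∀ ω, ω ∉ N → p ω := by
  have hnull : P (toMeasurable P {ω | ¬ p ω}) = 0 := (measure_toMeasurable _).trans hp
  refine ⟨toMeasurable P {ω | ¬ p ω}, hnull, fun t => ?_, fun ω hω => ?_⟩
  · exact 𝔽.mono zero_le _ (hZ.null_mem _ (measurableSet_toMeasurable _ _) hnull)
  · by_contra h
    exact hω (subset_toMeasurable _ _ h)

lemma indepFun (hZ : IsBrownianFor P 𝔽 Z) {s t : ℝ≥0} (hst : s ≤ t) {Y : Ω → ℝ}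
    (hY : Measurable[𝔽 s] Y) : IndepFun Y (fun ω => Z t ω - Z s ω) P :=
  (indep_of_indep_of_le_right (hZ.indep s t hst) hY.comap_le).symm

lemma memLp_sub (hZ : IsBrownianFor P 𝔽 Z) {s t : ℝ≥0} (hst : s ≤ t) :
    MemLp (fun ω => Z t ω - Z s ω) 2 P :=
  (hZ.law s t hst).hasGaussianLaw.memLp_two

lemma integral_sub (hZ : IsBrownianFor P 𝔽 Z) {s t : ℝ≥0} (hst : s ≤ t) :
    ∫ ω, (Z t ω - Z s ω) ∂P = 0 := by
  rw [(hZ.law s t hst).integral_eq, integral_id_gaussianReal]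

lemma integral_sub_sq (hZ : IsBrownianFor P 𝔽 Z) {s t : ℝ≥0} (hst : s ≤ t) :
    ∫ ω, (Z t ω - Z s ω) ^ 2 ∂P = t - s := by
  rw [← variance_of_integral_eq_zero (hZ.law s t hst).aemeasurable (hZ.integral_sub hst),
    (hZ.law s t hst).variance_eq, variance_id_gaussianReal, NNReal.coe_sub hst]

lemma integral_exp_mul_sub (hZ : IsBrownianFor P 𝔽 Z) {s t : ℝ≥0} (hst : s ≤ t) (l : ℝ) :
    ∫ ω, Real.exp (l * (Z t ω - Z s ω)) ∂P = Real.exp ((t - s) * l ^ 2 / 2) := by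
  have hmgf := mgf_gaussianReal (hZ.law s t hst).map_eq l
  rw [mgf] at hmgf
  simp [hmgf, NNReal.coe_sub hst]

lemma integrable_exp_mul_sub (hZ : IsBrownianFor P 𝔽 Z) {s t : ℝ≥0} (hst : s ≤ t) (l : ℝ) :
    Integrable (fun ω => Real.exp (l * (Z t ω - Z s ω))) P := by
  have hint := integrable_exp_mul_gaussianReal (μ := 0) (v := t - s) l
  rw [← (hZ.law s t hst).map_eq] at hint
  exact hint.comp_aemeasurable (hZ.law s t hst).aemeasurable

/-! ### The Itô isometry for simple integrands -/

lemma integral_mul_sub (hZ : IsBrownianFor P 𝔽 Z) {s t : ℝ≥0} (hst : s ≤ t) {Y : Ω → ℝ}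
    (hY : Measurable[𝔽 s] Y) : ∫ ω, Y ω * (Z t ω - Z s ω) ∂P = 0 := by
  rw [(hZ.indepFun hst hY).integral_fun_mul_eq_mul_integral
    (hY.mono (𝔽.le s) le_rfl).aestronglyMeasurable
    ((hZ.measurable t).sub (hZ.measurable s)).aestronglyMeasurable, hZ.integral_sub hst, mul_zero]

lemma integral_mul_sub_sq (hZ : IsBrownianFor P 𝔽 Z) {s t : ℝ≥0} (hst : s ≤ t) {Y : Ω → ℝ}
    (hY : Measurable[𝔽 s] Y) :
    ∫ ω, Y ω * (Z t ω - Z s ω) ^ 2 ∂P = (∫ ω, Y ω ∂P) * (t - s) := by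
  have hindep := (hZ.indepFun hst hY).comp measurable_id (measurable_id.pow_const 2)
  rw [← hZ.integral_sub_sq hst]
  exact hindep.integral_mul_eq_mul_integral (hY.mono (𝔽.le s) le_rfl).aestronglyMeasurable
    (((hZ.measurable t).sub (hZ.measurable s)).pow_const 2).aestronglyMeasurable

lemma integrable_mul_sub_mul_sub (hZ : IsBrownianFor P 𝔽 Z) {a b c d : ℝ≥0} (hab : a ≤ b)
    (hcd : c ≤ d) {Y : Ω → ℝ} (hY : Measurable Y) (hYb : ∃ C : ℝ, ∀ ω, |Y ω| ≤ C) :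
    Integrable (fun ω => Y ω * ((Z b ω - Z a ω) * (Z d ω - Z c ω))) P := by
  obtain ⟨C, hC⟩ := hYb
  exact Integrable.bdd_mul (c := C) ((hZ.memLp_sub hab).integrable_mul (hZ.memLp_sub hcd))
    hY.aestronglyMeasurable (ae_of_all _ hC)

lemma integral_mul_sub_mul_sub_of_le (hZ : IsBrownianFor P 𝔽 Z) {a b c d : ℝ≥0} (hab : a ≤ b)
    (hbc : b ≤ c) (hcd : c ≤ d) {Y : Ω → ℝ} (hY : Measurable[𝔽 c] Y) :
    ∫ ω, Y ω * ((Z b ω - Z a ω) * (Z d ω - Z c ω)) ∂P = 0 := by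
  have := hZ.integral_mul_sub hcd (Y := fun ω => Y ω * (Z b ω - Z a ω))
    (hY.mul ((hZ.measurable_of_le hbc).sub (hZ.measurable_of_le (hab.trans hbc))))
  simpa only [mul_assoc] using this

lemma integral_mul_sub_mul_sub_same_left (hZ : IsBrownianFor P 𝔽 Z) {b c d : ℝ≥0}
    (hcb : c ≤ b) (hcd : c ≤ d) {Y : Ω → ℝ} (hY : Measurable[𝔽 c] Y)
    (hYb : ∃ C : ℝ, ∀ ω, |Y ω| ≤ C) :
    ∫ ω, Y ω * ((Z b ω - Z c ω) * (Z d ω - Z c ω)) ∂P =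
      (∫ ω, Y ω ∂P) * (min (b : ℝ) d - c) := by
  wlog hbd : b ≤ d generalizing b d
  · rw [min_comm, ← this hcd hcb (le_of_not_ge hbd)]
    simp only [mul_comm]
  have hYm : Measurable Y := hY.mono (𝔽.le c) le_rfl
  have hsq : Integrable (fun ω => Y ω * (Z b ω - Z c ω) ^ 2) P := by
    simpa only [pow_two] using hZ.integrable_mul_sub_mul_sub hcb hcb hYm hYb
  calc ∫ ω, Y ω * ((Z b ω - Z c ω) * (Z d ω - Z c ω)) ∂P
      = ∫ ω, Y ω * (Z b ω - Z c ω) ^ 2 + Y ω * ((Z b ω - Z c ω) * (Z d ω - Z b ω)) ∂P := by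
        congr 1; ext ω; ring
    _ = (∫ ω, Y ω ∂P) * (b - c) + 0 := by
        rw [integral_add hsq (hZ.integrable_mul_sub_mul_sub hcb hbd hYm hYb),
          hZ.integral_mul_sub_sq hcb hY,
          hZ.integral_mul_sub_mul_sub_of_le hcb le_rfl hbd (hY.mono (𝔽.mono hcb) le_rfl)]
    _ = (∫ ω, Y ω ∂P) * (min (b : ℝ) d - c) := by
        rw [add_zero, min_eq_left (NNReal.coe_le_coe.2 hbd)]

lemma integral_mul_sub_mul_sub (hZ : IsBrownianFor P 𝔽 Z)
    {a b c d : ℝ≥0} (hab : a ≤ b) (hcd : c ≤ d) (hac : a ≤ c) {Y : Ω → ℝ}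
    (hY : Measurable[𝔽 c] Y) (hYb : ∃ C : ℝ, ∀ ω, |Y ω| ≤ C) :
    ∫ ω, Y ω * ((Z b ω - Z a ω) * (Z d ω - Z c ω)) ∂P =
      (∫ ω, Y ω ∂P) * max (min (b : ℝ) d - max (a : ℝ) c) 0 := by
  rw [max_eq_right (NNReal.coe_le_coe.2 hac)]
  rcases le_total b c with hbc | hcb
  · rw [hZ.integral_mul_sub_mul_sub_of_le hab hbc hcd hY, max_eq_right, mul_zero]
    exact sub_nonpos.2 ((min_le_left _ _).trans (NNReal.coe_le_coe.2 hbc))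
  · have hYm : Measurable Y := hY.mono (𝔽.le c) le_rfl
    rw [max_eq_left (sub_nonneg.2 (le_min (NNReal.coe_le_coe.2 hcb) (NNReal.coe_le_coe.2 hcd))),
      ← hZ.integral_mul_sub_mul_sub_same_left hcb hcd hY hYb,
      ← zero_add (∫ ω, Y ω * ((Z b ω - Z c ω) * (Z d ω - Z c ω)) ∂P),
      ← hZ.integral_mul_sub_mul_sub_of_le hac le_rfl hcd hY,
      ← integral_add (hZ.integrable_mul_sub_mul_sub hac hcd hYm hYb)
        (hZ.integrable_mul_sub_mul_sub hcb hcd hYm hYb)]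
    congr 1; ext ω; ring

end IsBrownianFor

lemma exists_forall_abs_mul_le {Ω : Type*} {ξ η : Ω → ℝ} (hξ : ∃ C : ℝ, ∀ ω, |ξ ω| ≤ C)
    (hη : ∃ C : ℝ, ∀ ω, |η ω| ≤ C) : ∃ C : ℝ, ∀ ω, |ξ ω * η ω| ≤ C := by
  obtain ⟨C, hC⟩ := hξ
  obtain ⟨C', hC'⟩ := hη
  refine ⟨C * C', fun ω => ?_⟩
  rw [abs_mul]
  exact mul_le_mul (hC ω) (hC' ω) (abs_nonneg _) ((abs_nonneg _).trans (hC ω))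

lemma lintegral_enorm_sum_sq {α ι : Type*} {mα : MeasurableSpace α} {μ : Measure α}
    (K : Finset ι) {f : ι → α → ℝ} (hf : ∀ k, MemLp (f k) 2 μ) :
    ∫⁻ x, ‖∑ k ∈ K, f k x‖ₑ ^ 2 ∂μ =
      ENNReal.ofReal (∑ k ∈ K, ∑ l ∈ K, ∫ x, f k x * f l x ∂μ) := by
  have hmul : ∀ k l, Integrable (fun x => f k x * f l x) μ := fun k l =>
    (hf k).integrable_mul (hf l)
  have hsq : Integrable (fun x => (∑ k ∈ K, f k x) ^ 2) μ :=
    (memLp_finsetSum K fun k _ => hf k).integrable_sq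
  calc ∫⁻ x, ‖∑ k ∈ K, f k x‖ₑ ^ 2 ∂μ
      = ∫⁻ x, ENNReal.ofReal ((∑ k ∈ K, f k x) ^ 2) ∂μ := by
        simp only [Real.enorm_eq_ofReal_abs, ← ENNReal.ofReal_pow (abs_nonneg _), sq_abs]
    _ = ENNReal.ofReal (∫ x, (∑ k ∈ K, f k x) ^ 2 ∂μ) :=
        (ofReal_integral_eq_lintegral_ofReal hsq (ae_of_all _ fun _ => sq_nonneg _)).symm
    _ = ENNReal.ofReal (∑ k ∈ K, ∑ l ∈ K, ∫ x, f k x * f l x ∂μ) := by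
        simp only [pow_two, Finset.sum_mul_sum]
        rw [integral_finsetSum K fun k _ => integrable_finsetSum K fun l _ => hmul k l]
        simp only [integral_finsetSum K fun l _ => hmul _ l]

lemma lintegral_enorm_sum_sq_eq_of_integral_mul_eq {α β ι : Type*} {mα : MeasurableSpace α}
    {mβ : MeasurableSpace β} {μ : Measure α} {ν : Measure β} (K : Finset ι) {f : ι → α → ℝ}
    {g : ι → β → ℝ} (hf : ∀ k, MemLp (f k) 2 μ) (hg : ∀ k, MemLp (g k) 2 ν)
    (h : ∀ k l, ∫ x, f k x * f l x ∂μ = ∫ y, g k y * g l y ∂ν) :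
    ∫⁻ x, ‖∑ k ∈ K, f k x‖ₑ ^ 2 ∂μ = ∫⁻ y, ‖∑ k ∈ K, g k y‖ₑ ^ 2 ∂ν := by
  simp only [lintegral_enorm_sum_sq K hf, lintegral_enorm_sum_sq K hg, h]

namespace IsBrownianFor

variable {Ω : Type*} {mΩ : MeasurableSpace Ω} {P : Measure Ω}
  {𝔽 : Filtration ℝ≥0 mΩ} {Z : ℝ≥0 → Ω → ℝ} {t₀ T : ℝ}

lemma integral_mul_sub_mul_mul_sub (hZ : IsBrownianFor P 𝔽 Z) {a b c d : ℝ≥0} (hab : a ≤ b)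
    (hcd : c ≤ d) {ξ η : Ω → ℝ} (hξ : Measurable[𝔽 a] ξ) (hη : Measurable[𝔽 c] η)
    (hξb : ∃ C : ℝ, ∀ ω, |ξ ω| ≤ C) (hηb : ∃ C : ℝ, ∀ ω, |η ω| ≤ C) :
    ∫ ω, (ξ ω * (Z b ω - Z a ω)) * (η ω * (Z d ω - Z c ω)) ∂P =
      (∫ ω, ξ ω * η ω ∂P) * max (min (b : ℝ) d - max (a : ℝ) c) 0 := by
  wlog hac : a ≤ c generalizing a b c d ξ η
  · have := this hcd hab hη hξ hηb hξb (le_of_not_ge hac)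
    rw [min_comm, max_comm (c : ℝ)] at this
    simpa only [mul_comm] using this
  rw [← hZ.integral_mul_sub_mul_sub hab hcd hac (Y := fun ω => ξ ω * η ω)
    ((hξ.mono (𝔽.mono hac) le_rfl).mul hη) (exists_forall_abs_mul_le hξb hηb)]
  congr 1; ext ω; ring

lemma lintegral_sum_mul_sub_sq [IsProbabilityMeasure P] {ι : Type*} (hZ : IsBrownianFor P 𝔽 Z)
    (K : Finset ι) {a b : ι → ℝ≥0} (hab : ∀ k, a k ≤ b k) {ξ : ι → Ω → ℝ}
    (hξ : ∀ k, Measurable[𝔽 (a k)] (ξ k)) (hξb : ∀ k, ∃ C : ℝ, ∀ ω, |ξ k ω| ≤ C) :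
    ∫⁻ ω, ‖∑ k ∈ K, ξ k ω * (Z (b k) ω - Z (a k) ω)‖ₑ ^ 2 ∂P =
      ∫⁻ ω, (∫⁻ s : ℝ,
        ‖∑ k ∈ K, (Set.Ioc (a k : ℝ) (b k)).indicator (fun _ => ξ k ω) s‖ₑ ^ 2) ∂P := by
  have hξm : ∀ k, Measurable (ξ k) := fun k => (hξ k).mono (𝔽.le _) le_rfl
  set step : ι → ℝ → ℝ := fun k => (Set.Ioc (a k : ℝ) (b k)).indicator 1
  have step_mul : ∀ k l, (fun s => step k s * step l s) =
      (Set.Ioc (max (a k : ℝ) (a l)) (min (b k) (b l))).indicator 1 := fun k l => by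
    rw [← Set.Ioc_inter_Ioc, Set.inter_indicator_one]; rfl
  have hstep : ∀ k, Measurable (step k) := fun k => measurable_one.indicator measurableSet_Ioc
  have hξLp : ∀ k, MemLp (ξ k) 2 P := fun k => by
    obtain ⟨C, hC⟩ := hξb k
    exact MemLp.of_bound (hξm k).aestronglyMeasurable C (ae_of_all _ hC)
  have hf : ∀ k, MemLp (fun ω => ξ k ω * (Z (b k) ω - Z (a k) ω)) 2 P := fun k => by
    obtain ⟨C, hC⟩ := hξb k
    exact (hZ.memLp_sub (hab k)).mul (MemLp.of_bound (hξm k).aestronglyMeasurable C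
      (ae_of_all _ hC)) (p := ∞)
  have hg : ∀ k, MemLp (fun z : Ω × ℝ => ξ k z.1 * step k z.2) 2 (P.prod volume) := fun k => by
    refine (memLp_two_iff_integrable_sq (by fun_prop)).2 ?_
    simp only [mul_pow]
    refine (hξLp k).integrable_sq.mul_prod (g := fun s => step k s ^ 2) ?_
    simp only [pow_two, step_mul]
    exact (integrableOn_const (by simp)).integrable_indicator measurableSet_Ioc
  have gram : ∀ k l, ∫ ω, (ξ k ω * (Z (b k) ω - Z (a k) ω)) * (ξ l ω * (Z (b l) ω - Z (a l) ω)) ∂P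
      = ∫ z : Ω × ℝ, (ξ k z.1 * step k z.2) * (ξ l z.1 * step l z.2) ∂(P.prod volume) := by
    intro k l
    rw [hZ.integral_mul_sub_mul_mul_sub (hab k) (hab l) (hξ k) (hξ l) (hξb k) (hξb l)]
    simp only [mul_mul_mul_comm (ξ k _)]
    rw [integral_prod_mul (fun ω => ξ k ω * ξ l ω) (fun s => step k s * step l s), step_mul,
      integral_indicator_one measurableSet_Ioc, Real.volume_real_Ioc]
  rw [lintegral_enorm_sum_sq_eq_of_integral_mul_eq K hf hg gram, lintegral_prod _ (by fun_prop)]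
  simp only [step, Set.indicator_apply, Pi.one_apply, mul_ite, mul_one, mul_zero]

end IsBrownianFor

namespace SimpleProcess

variable {Ω : Type*} {mΩ : MeasurableSpace Ω} {𝔽 : Filtration ℝ≥0 mΩ} {t₀ T : ℝ}

/-- The right endpoint of the `k`-th interval of constancy of the process stopped at time `t`. An
interval which starts after `t` becomes empty, but its left endpoint, and hence the information on
which the value `ξ k` may depend, does not move. -/
noncomputable def stoppedRight (S : SimpleProcess 𝔽 t₀ T) (t : ℝ) (k : ℕ) : ℝ :=
  max (S.grid k) (min (S.grid (k + 1)) t)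

lemma grid_le_stoppedRight (S : SimpleProcess 𝔽 t₀ T) (t : ℝ) (k : ℕ) :
    S.grid k ≤ S.stoppedRight t k :=
  le_max_left _ _

lemma integral_eq_sum_stoppedRight (S : SimpleProcess 𝔽 t₀ T) (Z : ℝ≥0 → Ω → ℝ) (t : ℝ) (ω : Ω) :
    S.integral Z t ω = ∑ k ∈ Finset.range S.N,
      S.ξ k ω * (Z (S.stoppedRight t k).toNNReal ω - Z (S.grid k).toNNReal ω) := by
  refine Finset.sum_congr rfl fun k _ => ?_
  have hk : S.grid k ≤ S.grid (k + 1) := S.grid_mono (Nat.le_succ k)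
  rcases le_total (S.grid k) t with h | h
  · rw [stoppedRight, max_eq_right (le_min hk h), min_eq_left h]
  · rw [stoppedRight, min_eq_right (h.trans hk), max_eq_left h, min_eq_right h, sub_self, sub_self]

lemma Ioc_stoppedRight (S : SimpleProcess 𝔽 t₀ T) (t : ℝ) (k : ℕ) :
    Set.Ioc (S.grid k) (S.stoppedRight t k) =
      Set.Ioc (S.grid k) (S.grid (k + 1)) ∩ Set.Iic t := by
  ext s
  simp only [stoppedRight, Set.mem_Ioc, Set.mem_inter_iff, Set.mem_Iic, le_max_iff, le_min_iff]
  grind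

lemma sum_indicator_stoppedRight (S : SimpleProcess 𝔽 t₀ T) (t s : ℝ) (ω : Ω) :
    ∑ k ∈ Finset.range S.N,
        (Set.Ioc (S.grid k) (S.stoppedRight t k)).indicator (fun _ => S.ξ k ω) s =
      (Set.Iic t).indicator (fun s => S.value s ω) s := by
  by_cases hs : s ≤ t <;> simp [Ioc_stoppedRight, value, Set.indicator_apply, hs]

lemma value_eq_zero (S : SimpleProcess 𝔽 t₀ T) {s : ℝ} (hs : s ∉ Set.Icc t₀ T) (ω : Ω) :
    S.value s ω = 0 :=
  Finset.sum_eq_zero fun k _ => Set.indicator_of_notMem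
    (fun h => hs ⟨(S.grid_mem k).1.trans h.1.le, h.2.trans (S.grid_mem (k + 1)).2⟩) _

end SimpleProcess

namespace IsBrownianFor

variable {Ω : Type*} {mΩ : MeasurableSpace Ω} {P : Measure Ω} [IsProbabilityMeasure P]
  {𝔽 : Filtration ℝ≥0 mΩ} {Z : ℝ≥0 → Ω → ℝ} {t₀ T : ℝ}

lemma lintegral_integral_sub_integral_sq (hZ : IsBrownianFor P 𝔽 Z) (ht₀ : 0 ≤ t₀)
    (S S' : SimpleProcess 𝔽 t₀ T) (t : ℝ) :
    ∫⁻ ω, ‖S.integral Z t ω - S'.integral Z t ω‖ₑ ^ 2 ∂P =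
      ∫⁻ ω, (∫⁻ s : ℝ,
        ‖(Set.Iic t).indicator (fun s => S.value s ω - S'.value s ω) s‖ₑ ^ 2) ∂P := by
  set left : ℕ ⊕ ℕ → ℝ := Sum.elim S.grid S'.grid
  set right : ℕ ⊕ ℕ → ℝ := Sum.elim (S.stoppedRight t) (S'.stoppedRight t)
  set ξ : ℕ ⊕ ℕ → Ω → ℝ := Sum.elim S.ξ (fun k => -S'.ξ k)
  have left_nonneg : ∀ k, 0 ≤ left k := Sum.rec
    (fun k => ht₀.trans (S.grid_mem k).1) (fun k => ht₀.trans (S'.grid_mem k).1)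
  have left_le_right : ∀ k, left k ≤ right k :=
    Sum.rec (S.grid_le_stoppedRight t) (S'.grid_le_stoppedRight t)
  have isometry := hZ.lintegral_sum_mul_sub_sq
    ((Finset.range S.N).disjSum (Finset.range S'.N))
    (a := fun k => (left k).toNNReal) (b := fun k => (right k).toNNReal) (ξ := ξ)
    (fun k => Real.toNNReal_le_toNNReal (left_le_right k))
    (Sum.rec S.ξ_meas fun k => (S'.ξ_meas k).neg)
    (Sum.rec S.ξ_bdd fun k => by simpa [ξ] using S'.ξ_bdd k)
  simp only [Real.coe_toNNReal _ (left_nonneg _),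
    Real.coe_toNNReal _ ((left_nonneg _).trans (left_le_right _))] at isometry
  have indicator_sub : ∀ s ω, (Set.Iic t).indicator (fun s => S.value s ω - S'.value s ω) s =
      (Set.Iic t).indicator (fun s => S.value s ω) s -
        (Set.Iic t).indicator (fun s => S'.value s ω) s :=
    fun s ω => congrFun (Set.indicator_sub (Set.Iic t) (S.value · ω) (S'.value · ω)) s
  simpa only [indicator_sub, Finset.sum_disjSum, left, right, ξ, Sum.elim_inl, Sum.elim_inr,
    Pi.neg_apply, neg_mul, Set.indicator_neg, Finset.sum_neg_distrib, ← sub_eq_add_neg,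
    ← SimpleProcess.integral_eq_sum_stoppedRight,
    SimpleProcess.sum_indicator_stoppedRight] using isometry

lemma lintegral_integral_sub_integral_sq_le (hZ : IsBrownianFor P 𝔽 Z) (ht₀ : 0 ≤ t₀)
    (S S' : SimpleProcess 𝔽 t₀ T) (t : ℝ) :
    ∫⁻ ω, ‖S.integral Z t ω - S'.integral Z t ω‖ₑ ^ 2 ∂P ≤
      ∫⁻ ω, (∫⁻ s in Set.Icc t₀ T, ‖S.value s ω - S'.value s ω‖ₑ ^ 2) ∂P := by
  rw [hZ.lintegral_integral_sub_integral_sq ht₀ S S' t]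
  refine lintegral_mono fun ω => ?_
  rw [← lintegral_indicator measurableSet_Icc]
  refine lintegral_mono fun s => ?_
  by_cases hs : s ∈ Set.Icc t₀ T
  · rw [Set.indicator_of_mem hs]
    gcongr
    exact enorm_indicator_le_enorm_self _ _
  · simp [Set.indicator_apply, S.value_eq_zero hs, S'.value_eq_zero hs]

end IsBrownianFor

/-! ### Uniqueness of the Itô integral -/

section SquareIntegrals

lemma enorm_sub_sq_le {E : Type*} [SeminormedAddCommGroup E] (x y z : E) :
    ‖x - z‖ₑ ^ 2 ≤ 2 * ‖x - y‖ₑ ^ 2 + 2 * ‖y - z‖ₑ ^ 2 := by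
  have ofReal_sq : ∀ x : E, ‖x‖ₑ ^ 2 = ENNReal.ofReal (‖x‖ ^ 2) := fun x => by
    rw [← ofReal_norm, ENNReal.ofReal_pow (norm_nonneg x)]
  rw [ofReal_sq, ofReal_sq, ofReal_sq, ← ENNReal.ofReal_ofNat 2,
    ← ENNReal.ofReal_mul (by norm_num), ← ENNReal.ofReal_mul (by norm_num),
    ← ENNReal.ofReal_add (by positivity) (by positivity)]
  refine ENNReal.ofReal_le_ofReal ?_
  calc ‖x - z‖ ^ 2 ≤ (‖x - y‖ + ‖y - z‖) ^ 2 := by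
        gcongr; exact norm_sub_le_norm_sub_add_norm_sub ..
    _ ≤ 2 * (‖x - y‖ ^ 2 + ‖y - z‖ ^ 2) := add_sq_le
    _ = 2 * ‖x - y‖ ^ 2 + 2 * ‖y - z‖ ^ 2 := mul_add _ _ _

variable {α : Type*} {mα : MeasurableSpace α} {μ : Measure α}

lemma lintegral_enorm_sub_sq_le {u v w : α → ℝ} (huv : Measurable fun x => u x - v x) :
    ∫⁻ x, ‖u x - w x‖ₑ ^ 2 ∂μ ≤
      2 * ∫⁻ x, ‖u x - v x‖ₑ ^ 2 ∂μ + 2 * ∫⁻ x, ‖v x - w x‖ₑ ^ 2 ∂μ := by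
  rw [← lintegral_const_mul' _ _ ENNReal.ofNat_ne_top,
    ← lintegral_const_mul' _ _ ENNReal.ofNat_ne_top,
    ← lintegral_add_left ((huv.enorm.pow_const 2).const_mul 2)]
  exact lintegral_mono fun x => enorm_sub_sq_le _ _ _

lemma tendsto_zero_of_le_two_mul_add {ι : Type*} {l : Filter ι} {a b c : ι → ℝ≥0∞}
    (h : ∀ m, a m ≤ 2 * b m + 2 * c m) (hb : Tendsto b l (𝓝 0)) (hc : Tendsto c l (𝓝 0)) :
    Tendsto a l (𝓝 0) := by
  have bound := (ENNReal.Tendsto.const_mul (a := 2) hb (Or.inr ENNReal.ofNat_ne_top)).add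
    (ENNReal.Tendsto.const_mul (a := 2) hc (Or.inr ENNReal.ofNat_ne_top))
  rw [mul_zero, add_zero] at bound
  exact tendsto_of_tendsto_of_tendsto_of_le_of_le tendsto_const_nhds bound (fun _ => zero_le) h

lemma ae_eq_of_tendsto_lintegral_enorm_sub_sq {ι : Type*} {l : Filter ι} [l.NeBot]
    {u : ι → α → ℝ} {v w : α → ℝ} (hu : ∀ m, Measurable (u m)) (hv : Measurable v)
    (hw : Measurable w)
    (huv : Tendsto (fun m => ∫⁻ x, ‖u m x - v x‖ₑ ^ 2 ∂μ) l (𝓝 0))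
    (huw : Tendsto (fun m => ∫⁻ x, ‖u m x - w x‖ₑ ^ 2 ∂μ) l (𝓝 0)) : v =ᵐ[μ] w := by
  simp only [enorm_sub_rev (u _ _) (v _)] at huv
  have hvw : ∫⁻ x, ‖v x - w x‖ₑ ^ 2 ∂μ = 0 := tendsto_nhds_unique tendsto_const_nhds
    (tendsto_zero_of_le_two_mul_add
      (fun m => lintegral_enorm_sub_sq_le (hv.sub (hu m))) huv huw)
  have hm : Measurable fun x => ‖v x - w x‖ₑ ^ 2 := (hv.sub hw).enorm.pow_const 2
  rw [lintegral_eq_zero_iff hm] at hvw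
  filter_upwards [hvw] with x hx
  simpa [sub_eq_zero] using hx

end SquareIntegrals

section Measurability

variable {Ω : Type*} {mΩ : MeasurableSpace Ω} {P : Measure Ω} {𝔽 : Filtration ℝ≥0 mΩ}
  {t₀ T : ℝ}

lemma lintegral_setLIntegral_Icc_eq_lintegral_prod [SFinite P] (f : ℝ → Ω → ℝ≥0∞)
    (hf : Measurable fun z : Set.Icc t₀ T × Ω => f z.1 z.2) :
    ∫⁻ ω, (∫⁻ s in Set.Icc t₀ T, f s ω) ∂P =
      ∫⁻ z : Set.Icc t₀ T × Ω,
        f z.1 z.2 ∂(((volume.restrict (Set.Icc t₀ T)).comap Subtype.val).prod P) := by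
  rw [lintegral_prod_symm' _ hf]
  refine lintegral_congr fun ω => ?_
  rw [lintegral_subtype_comap measurableSet_Icc (f · ω),
    Measure.restrict_restrict measurableSet_Icc, Set.inter_self]

lemma lintegral_setLIntegral_enorm_sub_sq_le [SFinite P] {u v w : ℝ → Ω → ℝ}
    (hu : Measurable fun z : Set.Icc t₀ T × Ω => u z.1 z.2)
    (hv : Measurable fun z : Set.Icc t₀ T × Ω => v z.1 z.2)
    (hw : Measurable fun z : Set.Icc t₀ T × Ω => w z.1 z.2) :
    ∫⁻ ω, (∫⁻ s in Set.Icc t₀ T, ‖u s ω - w s ω‖ₑ ^ 2) ∂P ≤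
      2 * ∫⁻ ω, (∫⁻ s in Set.Icc t₀ T, ‖u s ω - v s ω‖ₑ ^ 2) ∂P +
        2 * ∫⁻ ω, (∫⁻ s in Set.Icc t₀ T, ‖v s ω - w s ω‖ₑ ^ 2) ∂P := by
  have eq_prod : ∀ {f g : ℝ → Ω → ℝ}, Measurable (fun z : Set.Icc t₀ T × Ω => f z.1 z.2) →
      Measurable (fun z : Set.Icc t₀ T × Ω => g z.1 z.2) →
      ∫⁻ ω, (∫⁻ s in Set.Icc t₀ T, ‖f s ω - g s ω‖ₑ ^ 2) ∂P =
        ∫⁻ z : Set.Icc t₀ T × Ω, ‖f z.1 z.2 - g z.1 z.2‖ₑ ^ 2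
          ∂(((volume.restrict (Set.Icc t₀ T)).comap Subtype.val).prod P) :=
    fun {f g} hf hg => lintegral_setLIntegral_Icc_eq_lintegral_prod
      (fun s ω => ‖f s ω - g s ω‖ₑ ^ 2) ((hf.sub hg).enorm.pow_const 2)
  rw [eq_prod hu hw, eq_prod hu hv, eq_prod hv hw]
  exact lintegral_enorm_sub_sq_le (hu.sub hv)

lemma IsProgressiveOn.measurable_uncurry {E : Type*} [MeasurableSpace E] {H : ℝ → Ω → E}
    (hH : IsProgressiveOn 𝔽 t₀ T H) (ht₀T : t₀ ≤ T) :
    Measurable fun z : Set.Icc t₀ T × Ω => H z.1 z.2 :=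
  (hH T (Set.right_mem_Icc.2 ht₀T)).mono (sup_le_sup_left (MeasurableSpace.comap_mono (𝔽.le _)) _)
    le_rfl

namespace SimpleProcess

variable {Z : ℝ≥0 → Ω → ℝ}

lemma measurable_integral (S : SimpleProcess 𝔽 t₀ T) (hZ : ∀ t, Measurable (Z t)) (t : ℝ) :
    Measurable (S.integral Z t) :=
  Finset.measurable_fun_sum _ fun k _ =>
    ((S.ξ_meas k).mono (𝔽.le _) le_rfl).mul ((hZ _).sub (hZ _))

lemma measurable_value (S : SimpleProcess 𝔽 t₀ T) :
    Measurable fun z : Set.Icc t₀ T × Ω => S.value z.1 z.2 := by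
  refine Finset.measurable_fun_sum _ fun k _ => ?_
  have : (fun z : Set.Icc t₀ T × Ω =>
      (Set.Ioc (S.grid k) (S.grid (k + 1))).indicator (fun _ => S.ξ k z.2) z.1.1) =
      ((fun z => z.1.1) ⁻¹' Set.Ioc (S.grid k) (S.grid (k + 1))).indicator fun z => S.ξ k z.2 := by
    ext z; rfl
  rw [this]
  exact (((S.ξ_meas k).mono (𝔽.le _) le_rfl).comp measurable_snd).indicator
    (measurable_subtype_coe.comp measurable_fst measurableSet_Ioc)

end SimpleProcess

end Measurability

section Uniqueness

variable {Ω : Type*} {mΩ : MeasurableSpace Ω} {P : Measure Ω}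
  {𝔽 : Filtration ℝ≥0 mΩ} {Z : ℝ≥0 → Ω → ℝ} {t₀ T : ℝ} {H I J : ℝ → Ω → ℝ}

lemma IsItoIntegral.tendsto_integral [IsProbabilityMeasure P] (hZ : IsBrownianFor P 𝔽 Z)
    (ht₀ : 0 ≤ t₀) (hI : IsItoIntegral P 𝔽 t₀ T Z H I) {S : ℕ → SimpleProcess 𝔽 t₀ T}
    (hS : Tendsto (fun m => ∫⁻ ω, (∫⁻ s in Set.Icc t₀ T, ‖(S m).value s ω - H s ω‖ₑ ^ 2) ∂P)
      atTop (𝓝 0)) {t : ℝ} (ht : t ∈ Set.Icc t₀ T) :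
    Tendsto (fun m => ∫⁻ ω, ‖(S m).integral Z t ω - I t ω‖ₑ ^ 2 ∂P) atTop (𝓝 0) := by
  obtain ⟨⟨hH, -⟩, -, S', hS', hS'I⟩ := hI
  replace hH := hH.measurable_uncurry (ht.1.trans ht.2)
  simp only [enorm_sub_rev (SimpleProcess.value (S' _) _ _)] at hS'
  have integrands_close : Tendsto (fun m => ∫⁻ ω, (∫⁻ s in Set.Icc t₀ T,
      ‖(S m).value s ω - (S' m).value s ω‖ₑ ^ 2) ∂P) atTop (𝓝 0) :=
    tendsto_zero_of_le_two_mul_add (fun m => lintegral_setLIntegral_enorm_sub_sq_le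
      (S m).measurable_value hH (S' m).measurable_value) hS hS'
  have integrals_close : Tendsto (fun m => ∫⁻ ω, ‖(S m).integral Z t ω - (S' m).integral Z t ω‖ₑ ^ 2
      ∂P) atTop (𝓝 0) :=
    tendsto_of_tendsto_of_tendsto_of_le_of_le tendsto_const_nhds integrands_close
      (fun _ => zero_le) fun m => hZ.lintegral_integral_sub_integral_sq_le ht₀ (S m) (S' m) t
  exact tendsto_zero_of_le_two_mul_add (fun m => lintegral_enorm_sub_sq_le
    (((S m).measurable_integral hZ.measurable t).sub
      ((S' m).measurable_integral hZ.measurable t))) integrals_close (hS'I t ht)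

lemma IsItoIntegral.ae_eq_at [IsProbabilityMeasure P] (hZ : IsBrownianFor P 𝔽 Z) (ht₀ : 0 ≤ t₀)
    (hI : IsItoIntegral P 𝔽 t₀ T Z H I) (hJ : IsItoIntegral P 𝔽 t₀ T Z H J) {t : ℝ}
    (ht : t ∈ Set.Icc t₀ T) : I t =ᵐ[P] J t := by
  obtain ⟨-, ⟨hIm, -⟩, S, hS, hSI⟩ := hI
  exact ae_eq_of_tendsto_lintegral_enorm_sub_sq
    (fun m => (S m).measurable_integral hZ.measurable t) ((hIm t ht).mono (𝔽.le _) le_rfl)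
    ((hJ.2.1.1 t ht).mono (𝔽.le _) le_rfl) (hSI t ht) (hJ.tendsto_integral hZ ht₀ hS ht)

lemma ae_forall_eq_of_ae_eq {E : Type*} [TopologicalSpace E] [T2Space E] {X Y : ℝ → Ω → E}
    (hX : ∀ ω, ContinuousOn (X · ω) (Set.Icc t₀ T))
    (hY : ∀ ω, ContinuousOn (Y · ω) (Set.Icc t₀ T))
    (h : ∀ t ∈ Set.Icc t₀ T, X t =ᵐ[P] Y t) :
    ∀ᵐ ω ∂P, ∀ t ∈ Set.Icc t₀ T, X t ω = Y t ω := by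
  obtain ⟨D, hDc, hDd⟩ := TopologicalSpace.exists_countable_dense (Set.Icc t₀ T)
  have eq_on_dense : ∀ᵐ ω ∂P, ∀ t ∈ D, X t ω = Y t ω := (ae_ball_iff hDc).2 fun t _ => h t t.2
  filter_upwards [eq_on_dense] with ω hω t ht
  exact congrFun (Continuous.ext_on hDd (continuousOn_iff_continuous_domRestrict.1 (hX ω))
    (continuousOn_iff_continuous_domRestrict.1 (hY ω)) hω) ⟨t, ht⟩

lemma IsItoIntegral.ae_eq [IsProbabilityMeasure P] (hZ : IsBrownianFor P 𝔽 Z) (ht₀ : 0 ≤ t₀)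
    (hI : IsItoIntegral P 𝔽 t₀ T Z H I) (hJ : IsItoIntegral P 𝔽 t₀ T Z H J) :
    ∀ᵐ ω ∂P, ∀ t ∈ Set.Icc t₀ T, I t ω = J t ω :=
  ae_forall_eq_of_ae_eq hI.2.1.2 hJ.2.1.2 fun _ ht => hI.ae_eq_at hZ ht₀ hJ ht

lemma IsItoIntegral.congr {H' : ℝ → Ω → ℝ} (hI : IsItoIntegral P 𝔽 t₀ T Z H I)
    (h : ∀ s ∈ Set.Icc t₀ T, H s = H' s) : IsItoIntegral P 𝔽 t₀ T Z H' I := by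
  obtain ⟨⟨hp, hint⟩, hc, S, hS, hSI⟩ := hI
  refine ⟨⟨fun s hs => ?_, ?_⟩, hc, S, ?_, hSI⟩
  · convert hp s hs using 2 with z
    rw [h z.1 ⟨z.1.2.1, z.1.2.2.trans hs.2⟩]
  · convert hint using 3 with ω
    exact setLIntegral_congr_fun measurableSet_Icc fun s hs => by simp only [h s hs]
  · convert hS using 4 with m ω
    exact setLIntegral_congr_fun measurableSet_Icc fun s hs => by simp only [h s hs]

end Uniqueness

/-! ### Maximal inequalities -/

section Martingales

variable {Ω ι : Type*} {mΩ : MeasurableSpace Ω} {P : Measure Ω}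
  {M : ι → Ω → ℝ}

lemma submartingale_comp_of_convexOn [IsFiniteMeasure P] [Preorder ι] {𝒢 : Filtration ι mΩ}
    (hM : Martingale M 𝒢 P) {φ : ℝ → ℝ} (hφ : ConvexOn ℝ Set.univ φ)
    (hint : ∀ t, Integrable (fun ω => φ (M t ω)) P) :
    Submartingale (fun t ω => φ (M t ω)) 𝒢 P := by
  have φ_cont : Continuous φ := continuousOn_univ.1 (hφ.continuousOn isOpen_univ)
  refine ⟨fun t => φ_cont.comp_stronglyMeasurable (hM.1 t), fun s t hst => ?_, hint⟩
  filter_upwards [hM.2 s t hst,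
    hφ.map_condExp_le_of_finiteDimensional (𝒢.le s) (hM.integrable t) (hint t)] with ω hω hle
  rw [← hω]
  exact hle

lemma martingale_of_tendsto [Preorder ι] {𝒢 : Filtration ι mΩ} {N : ℕ → ι → Ω → ℝ}
    (hN : ∀ m, Martingale (N m) 𝒢 P) (hM : ∀ t, StronglyMeasurable[𝒢 t] (M t))
    (hint : ∀ t, Integrable (M t) P)
    (hlim : ∀ t, Tendsto (fun m => eLpNorm (N m t - M t) 1 P) atTop (𝓝 0)) :
    Martingale M 𝒢 P := by
  refine ⟨hM, fun s t hst => ?_⟩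
  have bound : ∀ m, eLpNorm (P[M t|𝒢 s] - M s) 1 P ≤
      eLpNorm (N m t - M t) 1 P + eLpNorm (N m s - M s) 1 P := fun m => by
    have split : P[M t|𝒢 s] - M s =ᵐ[P] (N m s - M s) - P[N m t - M t|𝒢 s] := by
      filter_upwards [condExp_sub ((hN m).integrable t) (hint t) (𝒢 s), (hN m).2 s t hst]
        with ω hsub hmart
      simp only [Pi.sub_apply, hsub, hmart]
      ring
    rw [eLpNorm_congr_ae split, add_comm]
    refine (eLpNorm_sub_le (((hN m).integrable s).sub (hint s)).1
      integrable_condExp.1 le_rfl).trans ?_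
    gcongr
    exact eLpNorm_condExp_le_eLpNorm _ le_rfl
  have dist_eq_zero : eLpNorm (P[M t|𝒢 s] - M s) 1 P = 0 :=
    le_antisymm (ge_of_tendsto' (by simpa using (hlim t).add (hlim s)) bound) zero_le
  rw [eLpNorm_eq_zero_iff (integrable_condExp.sub (hint s)).1 one_ne_zero] at dist_eq_zero
  filter_upwards [dist_eq_zero] with ω hω
  exact sub_eq_zero.1 hω

lemma measure_exists_finset_lt_le [IsFiniteMeasure P] [LinearOrder ι] {𝒢 : Filtration ι mΩ}
    (hM : Submartingale M 𝒢 P) (hM0 : ∀ t ω, 0 ≤ M t ω) (F : Finset ι) {b : ι}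
    (hb : ∀ t ∈ F, t ≤ b) (ε : ℝ≥0) :
    ε * P {ω | ∃ t ∈ F, (ε : ℝ) < M t ω} ≤ ENNReal.ofReal (∫ ω, M b ω ∂P) := by
  set τ : ℕ → ι := fun k => if h : k < F.card then F.orderEmbOfFin rfl ⟨k, h⟩ else b
  have τ_mono : Monotone τ := fun k l hkl => by
    by_cases hl : l < F.card
    · simpa [τ, hl, hkl.trans_lt hl] using hkl
    · by_cases hk : k < F.card
      · simpa [τ, hl, hk] using hb _ (F.orderEmbOfFin_mem rfl _)
      · simp [τ, hl, hk]
  have maximal := maximal_ineq (f := fun k => M (τ k))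
    (𝒢 := ⟨fun k => 𝒢 (τ k), fun k l h => 𝒢.mono (τ_mono h), fun k => 𝒢.le _⟩)
    ⟨fun k => hM.1 _, fun k l h => hM.2.1 _ _ (τ_mono h), fun k => hM.2.2 _⟩
    (fun k => hM0 _) (ε := ε) F.card
  have last_eq : τ F.card = b := by simp [τ]
  rw [last_eq] at maximal
  refine le_trans ?_ (maximal.trans (ENNReal.ofReal_le_ofReal
    (setIntegral_le_integral (hM.2.2 b) (ae_of_all _ (hM0 b)))))
  gcongr
  rintro ⟨t, ht, hεt⟩
  obtain ⟨k, rfl⟩ : t ∈ Set.range (F.orderEmbOfFin rfl) := by rwa [Finset.range_orderEmbOfFin]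
  have τ_eq : τ k = F.orderEmbOfFin rfl k := by simp [τ]
  refine hεt.le.trans (τ_eq ▸ Finset.le_sup' (fun k => M (τ k) ω) ?_)
  exact Finset.mem_range.2 (k.2.trans (Nat.lt_succ_self _))

lemma measure_exists_lt_le [IsFiniteMeasure P] [LinearOrder ι] [TopologicalSpace ι]
    [TopologicalSpace.SeparableSpace ι] {𝒢 : Filtration ι mΩ} (hM : Submartingale M 𝒢 P)
    (hM0 : ∀ t ω, 0 ≤ M t ω) (hc : ∀ᵐ ω ∂P, Continuous (M · ω)) {b : ι} (hb : ∀ t, t ≤ b)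
    (ε : ℝ≥0) :
    ε * P {ω | ∃ t, (ε : ℝ) < M t ω} ≤ ENNReal.ofReal (∫ ω, M b ω ∂P) := by
  have : Nonempty ι := ⟨b⟩
  set D : ℕ → ι := TopologicalSpace.denseSeq ι
  set exceed : ℕ → Set Ω :=
    fun m => {ω | ∃ t ∈ (Finset.range m).image D, (ε : ℝ) < M t ω}
  have exceed_mono : Monotone exceed := fun k l hkl ω ⟨t, ht, hεt⟩ =>
    ⟨t, Finset.image_subset_image (Finset.range_mono hkl) ht, hεt⟩
  have exceed_of_exists : {ω | ∃ t, (ε : ℝ) < M t ω} ≤ᵐ[P] ⋃ m, exceed m := by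
    filter_upwards [hc] with ω hω ⟨t, ht⟩
    obtain ⟨k, hεt⟩ := (TopologicalSpace.denseRange_denseSeq ι).exists_mem_open
      (isOpen_lt continuous_const hω) ⟨t, ht⟩
    exact Set.mem_iUnion.2 ⟨k + 1, D k, Finset.mem_image_of_mem D (by simp), hεt⟩
  calc ε * P {ω | ∃ t, (ε : ℝ) < M t ω}
      ≤ ε * P (⋃ m, exceed m) := mul_le_mul' le_rfl (measure_mono_ae exceed_of_exists)
    _ = ⨆ m, ε * P (exceed m) := by rw [exceed_mono.measure_iUnion, ENNReal.mul_iSup]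
    _ ≤ ENNReal.ofReal (∫ ω, M b ω ∂P) :=
      iSup_le fun m => measure_exists_finset_lt_le hM hM0 _ (fun t _ => hb t) ε

lemma measure_exists_lt_abs_le [IsFiniteMeasure P] [LinearOrder ι] [TopologicalSpace ι]
    [TopologicalSpace.SeparableSpace ι] {𝒢 : Filtration ι mΩ} (hM : Martingale M 𝒢 P)
    (hM2 : ∀ t, MemLp (M t) 2 P) (hc : ∀ᵐ ω ∂P, Continuous (M · ω)) {b : ι} (hb : ∀ t, t ≤ b)
    (ε : ℝ≥0) :
    (ε : ℝ≥0∞) ^ 2 * P {ω | ∃ t, ε < |M t ω|} ≤ ∫⁻ ω, ‖M b ω‖ₑ ^ 2 ∂P := by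
  have doob := measure_exists_lt_le (submartingale_comp_of_convexOn hM
    (even_two.convexOn_pow) fun t => (hM2 t).integrable_sq) (fun t ω => sq_nonneg _)
    (hc.mono fun ω h => h.pow 2) hb (ε ^ 2)
  have sq_eq : ∀ ω, ENNReal.ofReal (M b ω ^ 2) = ‖M b ω‖ₑ ^ 2 := fun ω => by
    rw [Real.enorm_eq_ofReal_abs, ← ENNReal.ofReal_pow (abs_nonneg _), sq_abs]
  rw [ofReal_integral_eq_lintegral_ofReal (hM2 b).integrable_sq (ae_of_all _ fun ω => sq_nonneg _)]
    at doob
  simpa only [sq_eq, ENNReal.coe_pow, NNReal.coe_pow, sq_lt_sq, NNReal.abs_eq] using doob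

end Martingales

section ItoMartingale

variable {Ω : Type*} {mΩ : MeasurableSpace Ω} {P : Measure Ω}
  {𝔽 : Filtration ℝ≥0 mΩ} {Z : ℝ≥0 → Ω → ℝ} {t₀ T : ℝ} {H I : ℝ → Ω → ℝ}

/-- The filtration `𝔽` restricted to the times in `[t₀, T]`, so that processes which are only
meaningful on `[t₀, T]` can be martingales. -/
def filtrationOn (𝔽 : Filtration ℝ≥0 mΩ) (t₀ T : ℝ) : Filtration (Set.Icc t₀ T) mΩ where
  seq t := 𝔽 (t : ℝ).toNNReal
  mono' _ _ h := 𝔽.mono (Real.toNNReal_le_toNNReal h)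
  le' _ := 𝔽.le _

lemma IsBrownianFor.condExp_mul_sub [IsProbabilityMeasure P] (hZ : IsBrownianFor P 𝔽 Z)
    {s t : ℝ≥0} (hst : s ≤ t) {Y : Ω → ℝ} (hY : Measurable[𝔽 s] Y) (hYb : ∃ C : ℝ, ∀ ω, |Y ω| ≤ C) :
    P[fun ω => Y ω * (Z t ω - Z s ω)|𝔽 s] =ᵐ[P] 0 := by
  obtain ⟨C, hC⟩ := hYb
  have pull_out := condExp_stronglyMeasurable_mul_of_bound (𝔽.le s) hY.stronglyMeasurable
    ((hZ.memLp_sub hst).integrable one_le_two) C (ae_of_all P hC)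
  have incr := condExp_indep_eq
    ((hZ.measurable t).sub (hZ.measurable s)).comap_le (𝔽.le s)
    (comap_measurable fun ω => Z t ω - Z s ω).stronglyMeasurable (hZ.indep s t hst)
  filter_upwards [pull_out, incr] with ω h_pull h_incr
  refine h_pull.trans ?_
  rw [Pi.mul_apply, h_incr, hZ.integral_sub hst, mul_zero, Pi.zero_apply]

namespace SimpleProcess

lemma stoppedRight_mono (S : SimpleProcess 𝔽 t₀ T) (k : ℕ) : Monotone (S.stoppedRight · k) :=
  fun _ _ h => max_le_max le_rfl (min_le_min le_rfl h)

lemma memLp_integral [IsProbabilityMeasure P] (S : SimpleProcess 𝔽 t₀ T)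
    (hZ : IsBrownianFor P 𝔽 Z) (t : ℝ) : MemLp (S.integral Z t) 2 P := by
  refine memLp_finsetSum _ fun k _ => ?_
  obtain ⟨C, hC⟩ := S.ξ_bdd k
  refine (hZ.memLp_sub (Real.toNNReal_le_toNNReal (min_le_min (S.grid_mono k.le_succ) le_rfl))).mul
    (p := ∞) (MemLp.of_bound ((S.ξ_meas k).mono (𝔽.le _) le_rfl).aestronglyMeasurable C
      (ae_of_all _ hC))

lemma measurable_integral_of_mem (S : SimpleProcess 𝔽 t₀ T) (hZ : IsBrownianFor P 𝔽 Z) (t : ℝ) :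
    Measurable[𝔽 t.toNNReal] (S.integral Z t) := by
  refine Finset.measurable_fun_sum _ fun k _ => ?_
  by_cases hk : S.grid k ≤ t
  · exact ((S.ξ_meas k).mono (𝔽.mono (Real.toNNReal_le_toNNReal hk)) le_rfl).mul
      ((hZ.measurable_of_le (Real.toNNReal_le_toNNReal (min_le_right _ _))).sub
        (hZ.measurable_of_le (Real.toNNReal_le_toNNReal (min_le_right _ _))))
  · have hkt : t ≤ S.grid k := le_of_not_ge hk
    simp only [min_eq_right hkt, min_eq_right (hkt.trans (S.grid_mono k.le_succ)), sub_self,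
      mul_zero]
    exact measurable_const

lemma continuous_integral (S : SimpleProcess 𝔽 t₀ T) {ω : Ω} (hω : Continuous (Z · ω)) :
    Continuous (S.integral Z · ω) :=
  continuous_finsetSum _ fun _ _ => continuous_const.mul
    ((hω.comp (continuous_real_toNNReal.comp (continuous_const.min continuous_id))).sub
      (hω.comp (continuous_real_toNNReal.comp (continuous_const.min continuous_id))))

lemma condExp_integral_sub [IsProbabilityMeasure P] (S : SimpleProcess 𝔽 t₀ T)
    (hZ : IsBrownianFor P 𝔽 Z) {s t : ℝ} (hst : s ≤ t) :
    P[fun ω => S.integral Z t ω - S.integral Z s ω|𝔽 s.toNNReal] =ᵐ[P] 0 := by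
  have incr_mono : ∀ k, (S.stoppedRight s k).toNNReal ≤ (S.stoppedRight t k).toNNReal := fun k =>
    Real.toNNReal_le_toNNReal (S.stoppedRight_mono k hst)
  set incr : ℕ → Ω → ℝ := fun k ω =>
    S.ξ k ω * (Z (S.stoppedRight t k).toNNReal ω - Z (S.stoppedRight s k).toNNReal ω)
  have hsum : (fun ω => S.integral Z t ω - S.integral Z s ω) = ∑ k ∈ Finset.range S.N, incr k := by
    ext ω
    simp only [integral_eq_sum_stoppedRight, ← Finset.sum_sub_distrib, Finset.sum_apply, incr]
    exact Finset.sum_congr rfl fun k _ => by ring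
  have incr_int : ∀ k, Integrable (incr k) P := fun k => by
    obtain ⟨C, hC⟩ := S.ξ_bdd k
    exact ((hZ.memLp_sub (incr_mono k)).integrable one_le_two).bdd_mul
      ((S.ξ_meas k).mono (𝔽.le _) le_rfl).aestronglyMeasurable (ae_of_all _ hC)
  have condExp_incr : ∀ k, P[incr k|𝔽 s.toNNReal] =ᵐ[P] 0 := fun k => by
    rcases le_or_gt s (S.stoppedRight s k) with hs | hs
    · have zero_later := hZ.condExp_mul_sub (incr_mono k)
        ((S.ξ_meas k).mono (𝔽.mono (Real.toNNReal_le_toNNReal (S.grid_le_stoppedRight s k))) le_rfl)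
        (S.ξ_bdd k)
      have tower := condExp_condExp_of_le (μ := P) (f := incr k)
        (𝔽.mono (Real.toNNReal_le_toNNReal hs)) (𝔽.le _)
      exact tower.symm.trans ((condExp_congr_ae zero_later).trans (by rw [condExp_zero]))
    · have hts : S.stoppedRight t k = S.stoppedRight s k := by
        simp only [stoppedRight] at hs ⊢; grind
      have : incr k = 0 := by ext ω; simp [incr, hts]
      rw [this, condExp_zero]
  rw [hsum]
  refine (condExp_finsetSum (fun k _ => incr_int k) _).trans ?_
  filter_upwards [ae_all_iff.2 condExp_incr] with ω hω
  simp [hω]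

lemma martingale_integral [IsProbabilityMeasure P] (S : SimpleProcess 𝔽 t₀ T)
    (hZ : IsBrownianFor P 𝔽 Z) :
    Martingale (fun t : Set.Icc t₀ T => S.integral Z t) (filtrationOn 𝔽 t₀ T) P := by
  have hint : ∀ t : ℝ, Integrable (S.integral Z t) P := fun t =>
    (S.memLp_integral hZ t).integrable one_le_two
  refine ⟨fun t => (S.measurable_integral_of_mem hZ t).stronglyMeasurable, fun s t hst => ?_⟩
  have past := condExp_of_stronglyMeasurable (𝔽.le _)
    (S.measurable_integral_of_mem hZ s).stronglyMeasurable (hint s)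
  filter_upwards [condExp_sub (hint t) (hint s) (𝔽 (s : ℝ).toNNReal),
    S.condExp_integral_sub hZ hst] with ω hsub hzero
  rw [Pi.sub_apply, past] at hsub
  exact sub_eq_zero.1 (hsub.symm.trans hzero)

end SimpleProcess

end ItoMartingale

/-! ### Existence of the Itô integral -/

lemma exists_tendstoUniformlyOn_of_norm_sub_le {α E : Type*} [NormedAddCommGroup E]
    [CompleteSpace E] {f : ℕ → α → E} {u : ℕ → ℝ} (hu : Summable u) {s : Set α}
    (hf : ∀ᶠ n in atTop, ∀ x ∈ s, ‖f (n + 1) x - f n x‖ ≤ u n) :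
    ∃ g : α → E, TendstoUniformlyOn f g atTop s := by
  refine ⟨fun x => f 0 x + ∑' n, (f (n + 1) x - f n x), ?_⟩
  have increments := tendstoUniformlyOn_tsum_nat_eventually hu hf
  rw [Metric.tendstoUniformlyOn_iff] at increments ⊢
  intro ε hε
  filter_upwards [increments ε hε] with n hn x hx
  simpa [Finset.sum_range_sub (f · x), dist_eq_norm, add_sub_assoc, sub_sub_eq_add_sub, add_comm]
    using hn x hx

lemma tendsto_lintegral_enorm_sub_sq_of_ae_tendsto {α : Type*} {mα : MeasurableSpace α}
    {μ : Measure α} {u : ℕ → α → ℝ} {v : α → ℝ} (hu : ∀ l, Measurable (u l))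
    (huv : ∀ᵐ x ∂μ, Tendsto (u · x) atTop (𝓝 (v x))) {e : ℕ → ℝ≥0∞}
    (he : Tendsto e atTop (𝓝 0)) (hue : ∀ l m, ∫⁻ x, ‖u l x - u m x‖ₑ ^ 2 ∂μ ≤ e l + e m) :
    Tendsto (fun l => ∫⁻ x, ‖u l x - v x‖ₑ ^ 2 ∂μ) atTop (𝓝 0) := by
  refine tendsto_of_tendsto_of_tendsto_of_le_of_le tendsto_const_nhds he (fun _ => zero_le)
    fun l => ?_
  calc ∫⁻ x, ‖u l x - v x‖ₑ ^ 2 ∂μ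
      = ∫⁻ x, liminf (fun m => ‖u l x - u m x‖ₑ ^ 2) atTop ∂μ := by
        refine lintegral_congr_ae ?_
        filter_upwards [huv] with x hx
        exact (ENNReal.Tendsto.pow (hx.const_sub _).enorm).liminf_eq.symm
    _ ≤ liminf (fun m => ∫⁻ x, ‖u l x - u m x‖ₑ ^ 2 ∂μ) atTop :=
        lintegral_liminf_le fun m => ((hu l).sub (hu m)).enorm.pow_const 2
    _ ≤ liminf (fun m => e l + e m) atTop := liminf_le_liminf (Eventually.of_forall (hue l))
    _ = e l := by simpa using (tendsto_const_nhds.add he).liminf_eq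

section Existence

variable {Ω : Type*} {mΩ : MeasurableSpace Ω} {P : Measure Ω} {𝔽 : Filtration ℝ≥0 mΩ}
  {Z : ℝ≥0 → Ω → ℝ} {t₀ T : ℝ}

lemma IsBrownianFor.exists_isContinuousAdapted_of_tendstoUniformlyOn (hZ : IsBrownianFor P 𝔽 Z)
    {Y : ℕ → ℝ → Ω → ℝ} (hYm : ∀ l, ∀ t ∈ Set.Icc t₀ T, Measurable[𝔽 t.toNNReal] (Y l t))
    (hYc : ∀ᵐ ω ∂P, ∀ l, ContinuousOn (Y l · ω) (Set.Icc t₀ T))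
    (hY : ∀ᵐ ω ∂P, ∃ g : ℝ → ℝ, TendstoUniformlyOn (Y · · ω) g atTop (Set.Icc t₀ T)) :
    ∃ I : ℝ → Ω → ℝ, IsContinuousAdapted 𝔽 t₀ T I ∧
      ∀ᵐ ω ∂P, ∀ t ∈ Set.Icc t₀ T, Tendsto (Y · t ω) atTop (𝓝 (I t ω)) := by
  classical
  obtain ⟨N, N_null, N_meas, hN⟩ := hZ.exists_null_of_ae (hYc.and hY)
  choose! g hg using fun ω hω => (hN ω hω).2
  refine ⟨fun t => Nᶜ.indicator (g · t), ⟨fun t ht => ?_, fun ω => ?_⟩, ?_⟩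
  · refine @measurable_of_tendsto_metrizable Ω ℝ (𝔽 t.toNNReal) _ _ _ _
      (fun l => Nᶜ.indicator (Y l t)) _ (fun l => (hYm l t ht).indicator (N_meas _).compl)
      (tendsto_pi_nhds.2 fun ω => ?_)
    by_cases hω : ω ∈ N
    · simp [hω]
    · simpa [hω] using (hg ω hω).tendsto_at ht
  · by_cases hω : ω ∈ N
    · simpa [hω] using continuousOn_const
    · simpa [hω] using (hg ω hω).continuousOn (Frequently.of_forall (hN ω hω).1)
  · filter_upwards [measure_eq_zero_iff_ae_notMem.1 N_null] with ω hω t ht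
    simpa [hω] using (hg ω hω).tendsto_at ht

variable [IsProbabilityMeasure P]

namespace SimpleProcess

lemma measure_exists_lt_abs_integral_sub_le (hZ : IsBrownianFor P 𝔽 Z) (ht₀ : 0 ≤ t₀)
    (S S' : SimpleProcess 𝔽 t₀ T) (ε : ℝ≥0) :
    (ε : ℝ≥0∞) ^ 2 * P {ω | ∃ t ∈ Set.Icc t₀ T, ε < |S.integral Z t ω - S'.integral Z t ω|} ≤
      ∫⁻ ω, (∫⁻ s in Set.Icc t₀ T, ‖S.value s ω - S'.value s ω‖ₑ ^ 2) ∂P := by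
  have ht₀T : t₀ ≤ T := (S.grid_mem 0).1.trans (S.grid_mem 0).2
  have doob := measure_exists_lt_abs_le ((S.martingale_integral hZ).sub (S'.martingale_integral hZ))
    (fun t => (S.memLp_integral hZ t).sub (S'.memLp_integral hZ t))
    (by filter_upwards [hZ.cont] with ω hω
        exact ((S.continuous_integral hω).sub (S'.continuous_integral hω)).comp
          continuous_subtype_val)
    (b := ⟨T, Set.right_mem_Icc.2 ht₀T⟩) (fun t => t.2.2) ε
  simp only [Subtype.exists, exists_prop, Pi.sub_apply] at doob
  exact doob.trans (hZ.lintegral_integral_sub_integral_sq_le ht₀ S S' T)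

lemma ae_exists_tendstoUniformlyOn_integral (hZ : IsBrownianFor P 𝔽 Z) (ht₀ : 0 ≤ t₀)
    {S : ℕ → SimpleProcess 𝔽 t₀ T}
    (hS : ∑' l, 4 ^ l * ∫⁻ ω, (∫⁻ s in Set.Icc t₀ T,
      ‖(S (l + 1)).value s ω - (S l).value s ω‖ₑ ^ 2) ∂P ≠ ∞) :
    ∀ᵐ ω ∂P, ∃ g : ℝ → ℝ,
      TendstoUniformlyOn (fun l t => (S l).integral Z t ω) g atTop (Set.Icc t₀ T) := by
  set exceed : ℕ → Set Ω := fun l => {ω | ∃ t ∈ Set.Icc t₀ T,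
    (1 / 2 : ℝ) ^ l < |(S (l + 1)).integral Z t ω - (S l).integral Z t ω|}
  have measure_exceed_le : ∀ l, P (exceed l) ≤ 4 ^ l * ∫⁻ ω, (∫⁻ s in Set.Icc t₀ T,
      ‖(S (l + 1)).value s ω - (S l).value s ω‖ₑ ^ 2) ∂P := fun l => by
    have doob := measure_exists_lt_abs_integral_sub_le hZ ht₀ (S (l + 1)) (S l) ((1 / 2) ^ l)
    have four_mul : (4 : ℝ≥0∞) ^ l * (((1 / 2 : ℝ≥0) ^ l : ℝ≥0) : ℝ≥0∞) ^ 2 = 1 := by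
      rw [← ENNReal.coe_ofNat, ← ENNReal.coe_pow, ← ENNReal.coe_pow, ← ENNReal.coe_mul,
        ← pow_mul, mul_comm l, pow_mul, ← mul_pow]
      norm_num
    calc P (exceed l) = 4 ^ l * ((((1 / 2 : ℝ≥0) ^ l : ℝ≥0) : ℝ≥0∞) ^ 2 * P (exceed l)) := by
          rw [← mul_assoc, four_mul, one_mul]
      _ ≤ _ := by gcongr; simpa [exceed] using doob
  filter_upwards [ae_eventually_notMem
    (ne_top_of_le_ne_top hS (ENNReal.tsum_le_tsum measure_exceed_le))] with ω hω
  refine exists_tendstoUniformlyOn_of_norm_sub_le summable_geometric_two ?_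
  filter_upwards [hω] with l hl t ht
  exact not_lt.1 fun h => hl ⟨t, ht, h⟩

end SimpleProcess

lemma exists_subseq_tsum_lintegral_ne_top {H : ℝ → Ω → ℝ}
    (hH : Measurable fun z : Set.Icc t₀ T × Ω => H z.1 z.2) {S : ℕ → SimpleProcess 𝔽 t₀ T}
    (hS : Tendsto (fun m => ∫⁻ ω, (∫⁻ s in Set.Icc t₀ T, ‖(S m).value s ω - H s ω‖ₑ ^ 2) ∂P)
      atTop (𝓝 0)) :
    ∃ φ : ℕ → ℕ, StrictMono φ ∧ ∑' l, 4 ^ l * ∫⁻ ω, (∫⁻ s in Set.Icc t₀ T,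
      ‖(S (φ (l + 1))).value s ω - (S (φ l)).value s ω‖ₑ ^ 2) ∂P ≠ ∞ := by
  obtain ⟨φ, φ_mono, hφ⟩ := extraction_forall_of_eventually fun l =>
    hS.eventually_le_const (u := (8⁻¹ : ℝ≥0∞) ^ l) (ENNReal.pow_pos (by simp) l)
  refine ⟨φ, φ_mono, ne_top_of_le_ne_top (b := ∑' l : ℕ, 4 * 2⁻¹ ^ l) ?_
    (ENNReal.tsum_le_tsum fun l => ?_)⟩
  · rw [ENNReal.tsum_mul_left, ENNReal.tsum_geometric]
    simp [ENNReal.mul_eq_top]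
  · have triangle := lintegral_setLIntegral_enorm_sub_sq_le (P := P)
      (S (φ (l + 1))).measurable_value hH (S (φ l)).measurable_value
    simp only [enorm_sub_rev (H _ _)] at triangle
    have eighth_pow_succ_le : (8⁻¹ : ℝ≥0∞) ^ (l + 1) ≤ 8⁻¹ ^ l :=
      pow_le_pow_right_of_le_one' (by simp) l.le_succ
    calc _ ≤ (4 : ℝ≥0∞) ^ l * (2 * 8⁻¹ ^ l + 2 * 8⁻¹ ^ l) := by
          gcongr
          refine triangle.trans ?_
          gcongr
          exacts [(hφ (l + 1)).trans eighth_pow_succ_le, hφ l]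
      _ = 4 * (4 * 8⁻¹) ^ l := by rw [mul_pow]; ring
      _ = 4 * 2⁻¹ ^ l := by
          rw [show (8 : ℝ≥0∞) = 4 * 2 by norm_num, ENNReal.mul_inv (by simp) (by simp),
            ENNReal.mul_inv_cancel_left (by simp) (by simp)]

theorem IsBrownianFor.exists_isItoIntegral (hZ : IsBrownianFor P 𝔽 Z) (ht₀ : 0 ≤ t₀)
    {H : ℝ → Ω → ℝ} (hH : MemH2 P 𝔽 t₀ T H) {S : ℕ → SimpleProcess 𝔽 t₀ T}
    (hS : Tendsto (fun m => ∫⁻ ω, (∫⁻ s in Set.Icc t₀ T, ‖(S m).value s ω - H s ω‖ₑ ^ 2) ∂P)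
      atTop (𝓝 0)) :
    ∃ I : ℝ → Ω → ℝ, IsItoIntegral P 𝔽 t₀ T Z H I := by
  have H_meas := hH.1.measurable_uncurry (((S 0).grid_mem 0).1.trans ((S 0).grid_mem 0).2)
  obtain ⟨φ, φ_mono, hφ⟩ := exists_subseq_tsum_lintegral_ne_top H_meas hS
  have hSφ := hS.comp φ_mono.tendsto_atTop
  obtain ⟨I, hI, hSI⟩ := hZ.exists_isContinuousAdapted_of_tendstoUniformlyOn
    (Y := fun l => (S (φ l)).integral Z)
    (fun l t _ => (S (φ l)).measurable_integral_of_mem hZ t)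
    (hZ.cont.mono fun ω hω l => ((S (φ l)).continuous_integral hω).continuousOn)
    (SimpleProcess.ae_exists_tendstoUniformlyOn_integral hZ ht₀ hφ)
  refine ⟨I, hH, hI, fun l => S (φ l), hSφ, fun t ht => ?_⟩
  refine tendsto_lintegral_enorm_sub_sq_of_ae_tendsto
    (fun l => (S (φ l)).measurable_integral hZ.measurable t) (hSI.mono fun ω hω => hω t ht)
    (by simpa using ENNReal.Tendsto.const_mul (a := 2) hSφ (Or.inr ENNReal.ofNat_ne_top))
    fun l m => (hZ.lintegral_integral_sub_integral_sq_le ht₀ _ _ t).trans ?_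
  have triangle := lintegral_setLIntegral_enorm_sub_sq_le (P := P)
    (S (φ l)).measurable_value H_meas (S (φ m)).measurable_value
  simpa only [enorm_sub_rev (H _ _)] using triangle

end Existence

/-! ### Deterministic integrands -/

section Deterministic

variable {Ω : Type*} {mΩ : MeasurableSpace Ω} {P : Measure Ω} {𝔽 : Filtration ℝ≥0 mΩ}
  {Z : ℝ≥0 → Ω → ℝ} {t₀ T : ℝ}

namespace SimpleProcess

lemma value_eq (S : SimpleProcess 𝔽 t₀ T) {k : ℕ} (hk : k < S.N) {s : ℝ}
    (hs : s ∈ Set.Ioc (S.grid k) (S.grid (k + 1))) (ω : Ω) : S.value s ω = S.ξ k ω := by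
  rw [value, Finset.sum_eq_single_of_mem k (Finset.mem_range.2 hk) fun l _ hlk => ?_,
    Set.indicator_of_mem hs]
  exact Set.indicator_of_notMem
    (fun hl => Set.disjoint_left.1 (S.grid_mono.pairwise_disjoint_on_Ioc_succ hlk) hl hs) _

variable (𝔽) in
/-- The simple process which samples the deterministic function `f` at the left end points of the
partition of `[t₀, T]` into `n + 1` intervals of equal length. -/
noncomputable def sample (h : t₀ ≤ T) (f : ℝ → ℝ) (n : ℕ) : SimpleProcess 𝔽 t₀ T where
  N := n + 1
  grid k := min (t₀ + k * ((T - t₀) / (n + 1))) T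
  grid_mono k l hkl := by
    have := sub_nonneg.2 h
    dsimp only
    gcongr
  grid_mem k := by
    have := sub_nonneg.2 h
    exact ⟨le_min (le_add_of_nonneg_right (by positivity)) h, min_le_right _ _⟩
  ξ k _ := f (min (t₀ + k * ((T - t₀) / (n + 1))) T)
  ξ_meas _ := measurable_const
  ξ_bdd _ := ⟨_, fun _ => le_rfl⟩

lemma exists_sample_value_eq (h : t₀ ≤ T) (f : ℝ → ℝ) (n : ℕ) {s : ℝ} (hs : s ∈ Set.Ioc t₀ T) :
    ∃ r ∈ Set.Icc t₀ T, |r - s| ≤ (T - t₀) / (n + 1) ∧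
      ∀ ω, (sample 𝔽 h f n).value s ω = f r := by
  set S := sample 𝔽 h f n
  have first : S.grid 0 = t₀ := by simp [S, sample, h]
  have last : S.grid S.N = T := by
    have : (n + 1 : ℝ) ≠ 0 := by positivity
    simp [S, sample, mul_div_cancel₀ _ this]
  have hs' : s ∈ ⋃ k ∈ Set.Ico 0 S.N, Set.Ioc (S.grid k) (S.grid (k + 1)) :=
    (S.grid_mono.biUnion_Ico_Ioc_map_succ 0 S.N).ge ⟨first.trans_lt hs.1, hs.2.trans last.ge⟩
  simp only [Set.mem_iUnion] at hs'
  obtain ⟨k, ⟨-, hk⟩, hsk⟩ := hs'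
  refine ⟨S.grid k, S.grid_mem k, ?_, S.value_eq hk hsk⟩
  have step : S.grid (k + 1) ≤ S.grid k + (T - t₀) / (n + 1) := by
    have width_nonneg : 0 ≤ (T - t₀) / (n + 1) := div_nonneg (sub_nonneg.2 h) (by positivity)
    simp only [S, sample, Nat.cast_add_one, add_one_mul, ← min_add_add_right, ← add_assoc]
    exact min_le_min le_rfl (le_add_of_nonneg_right width_nonneg)
  rw [abs_sub_comm, abs_of_nonneg (sub_nonneg.2 hsk.1.le)]
  linarith [hsk.2]

end SimpleProcess

lemma IsContinuousAdapted.isProgressiveOn {E : Type*} [TopologicalSpace E]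
    [TopologicalSpace.PseudoMetrizableSpace E] [MeasurableSpace E] [BorelSpace E] {Y : ℝ → Ω → E}
    (hY : IsContinuousAdapted 𝔽 t₀ T Y) : IsProgressiveOn 𝔽 t₀ T Y := by
  intro s hs
  refine @measurable_uncurry_of_continuous_of_measurable Ω E (Set.Icc t₀ s) _ _ _ _ _ _ _ _ _
    (𝔽 s.toNNReal) (fun t ω => Y t ω) (fun ω => ?_) (fun t => ?_)
  · exact continuousOn_iff_continuous_domRestrict.1
      ((hY.2 ω).mono (Set.Icc_subset_Icc_right hs.2))
  · exact (hY.1 t ⟨t.2.1, t.2.2.trans hs.2⟩).mono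
      (𝔽.mono (Real.toNNReal_le_toNNReal t.2.2)) le_rfl

variable [IsProbabilityMeasure P]

lemma lintegral_setLIntegral_Icc_enorm_sq_le {H : ℝ → Ω → ℝ} {C : ℝ≥0}
    (hH : ∀ s ∈ Set.Ioc t₀ T, ∀ ω, ‖H s ω‖ₑ ≤ C) :
    ∫⁻ ω, (∫⁻ s in Set.Icc t₀ T, ‖H s ω‖ₑ ^ 2) ∂P ≤ C ^ 2 * ENNReal.ofReal (T - t₀) := by
  have path_le : ∀ ω, ∫⁻ s in Set.Icc t₀ T, ‖H s ω‖ₑ ^ 2 ≤ C ^ 2 * ENNReal.ofReal (T - t₀) := by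
    intro ω
    rw [← restrict_Ioc_eq_restrict_Icc, ← Real.volume_Ioc, ← setLIntegral_const]
    refine setLIntegral_mono measurable_const fun s hs => ?_
    gcongr
    exact hH s hs ω
  simpa using lintegral_mono (μ := P) path_le

lemma memH2_of_continuousOn {f : ℝ → ℝ} (hf : ContinuousOn f (Set.Icc t₀ T)) :
    MemH2 P 𝔽 t₀ T fun t _ => f t := by
  refine ⟨IsContinuousAdapted.isProgressiveOn ⟨fun _ _ => measurable_const, fun _ => hf⟩, ?_⟩
  obtain ⟨C, hC⟩ := isCompact_Icc.exists_bound_of_continuousOn hf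
  refine (lintegral_setLIntegral_Icc_enorm_sq_le (C := C.toNNReal) fun s hs _ => ?_).trans_lt
    (ENNReal.mul_lt_top (by simp) ENNReal.ofReal_lt_top)
  rw [← ofReal_norm]
  exact ENNReal.ofReal_le_ofReal (hC s (Set.Ioc_subset_Icc_self hs))

lemma SimpleProcess.tendsto_sample (h : t₀ ≤ T) {f : ℝ → ℝ}
    (hf : ContinuousOn f (Set.Icc t₀ T)) :
    Tendsto (fun n => ∫⁻ ω, (∫⁻ s in Set.Icc t₀ T, ‖(sample 𝔽 h f n).value s ω - f s‖ₑ ^ 2) ∂P)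
      atTop (𝓝 0) := by
  have uniform : ∀ C : ℝ≥0, 0 < C → ∀ᶠ n in atTop, ∀ s ∈ Set.Ioc t₀ T, ∀ ω,
      ‖(sample 𝔽 h f n).value s ω - f s‖ₑ ≤ C := by
    intro C hC
    obtain ⟨δ, hδ, modulus⟩ := Metric.uniformContinuousOn_iff.1
      (isCompact_Icc.uniformContinuousOn_of_continuous hf) C hC
    have mesh : Tendsto (fun n : ℕ => (T - t₀) / (n + 1)) atTop (𝓝 0) :=
      tendsto_const_nhds.div_atTop
        (tendsto_atTop_add_const_right _ _ tendsto_natCast_atTop_atTop)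
    filter_upwards [mesh.eventually_lt_const hδ] with n hn s hs ω
    obtain ⟨r, hr, hrs, value_eq⟩ := exists_sample_value_eq (𝔽 := 𝔽) h f n hs
    rw [value_eq, ← ofReal_norm, ← ENNReal.ofReal_coe_nnreal]
    exact ENNReal.ofReal_le_ofReal
      (modulus r hr s (Set.Ioc_subset_Icc_self hs) (hrs.trans_lt hn)).le
  have bound_tendsto : Tendsto (fun C : ℝ≥0 => (C : ℝ≥0∞) ^ 2 * ENNReal.ofReal (T - t₀))
      (𝓝[>] 0) (𝓝 0) := by
    refine tendsto_nhdsWithin_of_tendsto_nhds ?_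
    have := ENNReal.Tendsto.mul_const (b := ENNReal.ofReal (T - t₀))
      (ENNReal.Tendsto.pow (n := 2) (ENNReal.tendsto_coe.2 (tendsto_id (x := 𝓝 (0 : ℝ≥0)))))
      (Or.inr ENNReal.ofReal_ne_top)
    simpa using this
  refine ENNReal.tendsto_nhds_zero.2 fun ε hε => ?_
  obtain ⟨C, hCε, hC⟩ := ((bound_tendsto.eventually_le_const hε).and self_mem_nhdsWithin).exists
  filter_upwards [uniform C hC] with n hn
  exact (lintegral_setLIntegral_Icc_enorm_sq_le hn).trans hCε

theorem IsBrownianFor.exists_isItoIntegral_of_continuousOn (hZ : IsBrownianFor P 𝔽 Z)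
    (ht₀ : 0 ≤ t₀) (h : t₀ ≤ T) {f : ℝ → ℝ} (hf : ContinuousOn f (Set.Icc t₀ T)) :
    ∃ I : ℝ → Ω → ℝ, IsItoIntegral P 𝔽 t₀ T Z (fun t _ => f t) I :=
  hZ.exists_isItoIntegral ht₀ (memH2_of_continuousOn hf) (SimpleProcess.tendsto_sample h hf)

/-! ### Gaussian tails of Wiener integrals -/

lemma IsBrownianFor.lintegral_exp_sum_mul_sub (hZ : IsBrownianFor P 𝔽 Z) {a : ℕ → ℝ≥0}
    (ha : Monotone a) (c : ℕ → ℝ) (N : ℕ) :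
    ∫⁻ ω, ENNReal.ofReal
        (Real.exp (∑ k ∈ Finset.range N, c k * (Z (a (k + 1)) ω - Z (a k) ω))) ∂P =
      ENNReal.ofReal
        (Real.exp (∑ k ∈ Finset.range N, ((a (k + 1) - a k : ℝ) * c k ^ 2 / 2))) := by
  induction N with
  | zero => simp
  | succ N ih =>
    simp only [Finset.sum_range_succ, Real.exp_add, ENNReal.ofReal_mul (Real.exp_nonneg _)]
    have past_meas : Measurable[𝔽 (a N)]
        fun ω => ∑ k ∈ Finset.range N, c k * (Z (a (k + 1)) ω - Z (a k) ω) :=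
      Finset.measurable_fun_sum _ fun k hk =>
        ((hZ.measurable_of_le (ha (Finset.mem_range.1 hk))).sub
          (hZ.measurable_of_le (ha (Finset.mem_range.1 hk).le))).const_mul _
    have incr_meas := (hZ.measurable (a (N + 1))).sub (hZ.measurable (a N))
    have indep := (hZ.indepFun (ha N.le_succ) past_meas).comp
      (φ := fun x => ENNReal.ofReal (Real.exp x))
      (ψ := fun x => ENNReal.ofReal (Real.exp (c N * x))) (by fun_prop) (by fun_prop)
    refine (lintegral_mul_eq_lintegral_mul_lintegral_of_indepFun''
      (Real.measurable_exp.comp (past_meas.mono (𝔽.le _) le_rfl)).ennreal_ofReal.aemeasurable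
      (Real.measurable_exp.comp (incr_meas.const_mul _)).ennreal_ofReal.aemeasurable indep).trans ?_
    rw [← ih, ← hZ.integral_exp_mul_sub (ha N.le_succ), ofReal_integral_eq_lintegral_ofReal
      (hZ.integrable_exp_mul_sub (ha N.le_succ) _) (ae_of_all _ fun _ => (Real.exp_pos _).le)]
    rfl

lemma SimpleProcess.lintegral_exp_mul_integral_le (hZ : IsBrownianFor P 𝔽 Z) (ht₀ : 0 ≤ t₀)
    (S : SimpleProcess 𝔽 t₀ T) {c : ℕ → ℝ} (hc : ∀ k ω, S.ξ k ω = c k) {K : ℝ}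
    (hK : ∀ k, |c k| ≤ K) {t : ℝ} (ht : t ∈ Set.Icc t₀ T) (l : ℝ) :
    ∫⁻ ω, ENNReal.ofReal (Real.exp (l * S.integral Z t ω)) ∂P ≤
      ENNReal.ofReal (Real.exp ((T - t₀) * (l * K) ^ 2 / 2)) := by
  set a : ℕ → ℝ := fun k => min (S.grid k) t
  have a_mem : ∀ k, a k ∈ Set.Icc t₀ T := fun k =>
    ⟨le_min (S.grid_mem k).1 ht.1, min_le_of_left_le (S.grid_mem k).2⟩
  have a_mono : Monotone a := fun _ _ hkl => min_le_min (S.grid_mono hkl) le_rfl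
  have coe_a : ∀ k, ((a k).toNNReal : ℝ) = a k := fun k =>
    Real.coe_toNNReal _ (ht₀.trans (a_mem k).1)
  have moment := hZ.lintegral_exp_sum_mul_sub (a := fun k => (a k).toNNReal)
    (fun _ _ hkl => Real.toNNReal_le_toNNReal (a_mono hkl)) (fun k => l * c k) S.N
  simp only [SimpleProcess.integral, hc, Finset.mul_sum, ← mul_assoc]
  refine moment.trans_le (ENNReal.ofReal_le_ofReal (Real.exp_le_exp.2 ?_))
  simp only [coe_a]
  calc ∑ k ∈ Finset.range S.N, (a (k + 1) - a k) * (l * c k) ^ 2 / 2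
      ≤ ∑ k ∈ Finset.range S.N, (a (k + 1) - a k) * ((l * K) ^ 2 / 2) := by
        refine Finset.sum_le_sum fun k _ => ?_
        rw [mul_div_assoc, mul_pow, mul_pow, ← sq_abs (c k)]
        have := sub_nonneg.2 (a_mono k.le_succ)
        gcongr
        exact hK k
    _ = (a S.N - a 0) * ((l * K) ^ 2 / 2) := by
        rw [← Finset.sum_mul, Finset.sum_range_sub]
    _ ≤ (T - t₀) * (l * K) ^ 2 / 2 := by
        rw [← mul_div_assoc]
        gcongr
        exacts [(a_mem _).2, (a_mem 0).1]

lemma tendsto_eLpNorm_two_of_tendsto_lintegral {α ι : Type*} {mα : MeasurableSpace α}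
    {μ : Measure α} {l : Filter ι} {u : ι → α → ℝ}
    (hu : Tendsto (fun m => ∫⁻ x, ‖u m x‖ₑ ^ 2 ∂μ) l (𝓝 0)) :
    Tendsto (fun m => eLpNorm (u m) 2 μ) l (𝓝 0) := by
  have := (ENNReal.continuous_rpow_const (y := 1 / 2)).tendsto 0 |>.comp hu
  simpa [Function.comp_def, eLpNorm_eq_lintegral_rpow_enorm_toReal] using this

lemma lintegral_comp_le_of_tendsto_lintegral_enorm_sub_sq {α : Type*} {mα : MeasurableSpace α}
    {μ : Measure α} {u : ℕ → α → ℝ} {v : α → ℝ} (hu : ∀ m, Measurable (u m)) (hv : Measurable v)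
    (huv : Tendsto (fun m => ∫⁻ x, ‖u m x - v x‖ₑ ^ 2 ∂μ) atTop (𝓝 0)) {g : ℝ → ℝ≥0∞}
    (hg : Continuous g) {B : ℝ≥0∞} (hB : ∀ m, ∫⁻ x, g (u m x) ∂μ ≤ B) :
    ∫⁻ x, g (v x) ∂μ ≤ B := by
  obtain ⟨φ, -, hφ⟩ := (tendstoInMeasure_of_tendsto_eLpNorm two_ne_zero
    (fun m => (hu m).aestronglyMeasurable) hv.aestronglyMeasurable
    (tendsto_eLpNorm_two_of_tendsto_lintegral huv)).exists_seq_tendsto_ae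
  calc ∫⁻ x, g (v x) ∂μ
      = ∫⁻ x, liminf (fun m => g (u (φ m) x)) atTop ∂μ := by
        refine lintegral_congr_ae ?_
        filter_upwards [hφ] with x hx
        exact ((hg.tendsto _).comp hx).liminf_eq.symm
    _ ≤ liminf (fun m => ∫⁻ x, g (u (φ m) x) ∂μ) atTop :=
        lintegral_liminf_le fun m => hg.measurable.comp (hu _)
    _ ≤ B := liminf_le_of_le (by isBoundedDefault) fun b hb =>
        hb.exists.choose_spec.trans (hB _)

namespace IsItoIntegral

variable {f : ℝ → ℝ} {I : ℝ → Ω → ℝ} {K : ℝ}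

lemma lintegral_exp_mul_le (hZ : IsBrownianFor P 𝔽 Z) (ht₀ : 0 ≤ t₀)
    (hI : IsItoIntegral P 𝔽 t₀ T Z (fun t _ => f t) I) (hf : ContinuousOn f (Set.Icc t₀ T))
    (hK : ∀ s ∈ Set.Icc t₀ T, |f s| ≤ K) {t : ℝ} (ht : t ∈ Set.Icc t₀ T) (l : ℝ) :
    ∫⁻ ω, ENNReal.ofReal (Real.exp (l * I t ω)) ∂P ≤
      ENNReal.ofReal (Real.exp ((T - t₀) * (l * K) ^ 2 / 2)) := by
  have h : t₀ ≤ T := ht.1.trans ht.2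
  exact lintegral_comp_le_of_tendsto_lintegral_enorm_sub_sq
    (fun m => (SimpleProcess.sample 𝔽 h f m).measurable_integral hZ.measurable t)
    ((hI.2.1.1 t ht).mono (𝔽.le _) le_rfl)
    (hI.tendsto_integral hZ ht₀ (SimpleProcess.tendsto_sample h hf) ht)
    (ENNReal.continuous_ofReal.comp (Real.continuous_exp.comp (continuous_const_mul l)))
    fun m => (SimpleProcess.sample 𝔽 h f m).lintegral_exp_mul_integral_le hZ ht₀
      (fun _ _ => rfl) (fun k => hK _ ((SimpleProcess.sample 𝔽 h f m).grid_mem k)) ht l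

lemma lintegral_exp_mul_abs_le (hZ : IsBrownianFor P 𝔽 Z) (ht₀ : 0 ≤ t₀)
    (hI : IsItoIntegral P 𝔽 t₀ T Z (fun t _ => f t) I) (hf : ContinuousOn f (Set.Icc t₀ T))
    (hK : ∀ s ∈ Set.Icc t₀ T, |f s| ≤ K) {t : ℝ} (ht : t ∈ Set.Icc t₀ T) (l : ℝ) :
    ∫⁻ ω, ENNReal.ofReal (Real.exp (l * |I t ω|)) ∂P ≤
      ENNReal.ofReal (2 * Real.exp ((T - t₀) * (l * K) ^ 2 / 2)) := by
  have I_meas : Measurable (I t) := (hI.2.1.1 t ht).mono (𝔽.le _) le_rfl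
  have exp_abs_le : ∀ x : ℝ, ENNReal.ofReal (Real.exp (l * |x|)) ≤
      ENNReal.ofReal (Real.exp (l * x)) + ENNReal.ofReal (Real.exp (-l * x)) := fun x => by
    rcases abs_choice x with hx | hx
    · rw [hx]; exact le_self_add
    · rw [hx, mul_neg, ← neg_mul]; exact le_add_self
  have exp_meas : Measurable fun ω => ENNReal.ofReal (Real.exp (l * I t ω)) :=
    (Real.measurable_exp.comp (I_meas.const_mul l)).ennreal_ofReal
  refine (lintegral_mono fun ω => exp_abs_le (I t ω)).trans ?_
  rw [lintegral_add_left exp_meas, two_mul,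
    ENNReal.ofReal_add (Real.exp_nonneg _) (Real.exp_nonneg _)]
  have neg_moment := hI.lintegral_exp_mul_le hZ ht₀ hf hK ht (-l)
  rw [neg_mul l K, neg_sq] at neg_moment
  exact add_le_add (hI.lintegral_exp_mul_le hZ ht₀ hf hK ht l) neg_moment

lemma integrable_exp_mul_abs (hZ : IsBrownianFor P 𝔽 Z) (ht₀ : 0 ≤ t₀)
    (hI : IsItoIntegral P 𝔽 t₀ T Z (fun t _ => f t) I) (hf : ContinuousOn f (Set.Icc t₀ T))
    {t : ℝ} (ht : t ∈ Set.Icc t₀ T) (l : ℝ) : Integrable (fun ω => Real.exp (l * |I t ω|)) P := by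
  obtain ⟨K, hK⟩ := isCompact_Icc.exists_bound_of_continuousOn hf
  have I_meas : Measurable (I t) := (hI.2.1.1 t ht).mono (𝔽.le _) le_rfl
  refine (lintegral_ofReal_ne_top_iff_integrable
    (Real.measurable_exp.comp (I_meas.norm.const_mul l)).aestronglyMeasurable
    (ae_of_all _ fun _ => Real.exp_nonneg _)).1 (ne_top_of_le_ne_top ENNReal.ofReal_ne_top
      (hI.lintegral_exp_mul_abs_le hZ ht₀ hf hK ht l))

lemma memLp {H : ℝ → Ω → ℝ} (hZ : IsBrownianFor P 𝔽 Z) (hI : IsItoIntegral P 𝔽 t₀ T Z H I) {t : ℝ}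
    (ht : t ∈ Set.Icc t₀ T) : MemLp (I t) 2 P := by
  obtain ⟨-, hI, S, -, hS⟩ := hI
  have I_meas : Measurable (I t) := (hI.1 t ht).mono (𝔽.le _) le_rfl
  obtain ⟨m, hm⟩ := ((tendsto_eLpNorm_two_of_tendsto_lintegral (hS t ht)).eventually_lt_const
    ENNReal.zero_lt_top).exists
  have S_memLp := (S m).memLp_integral hZ t
  have diff_memLp : MemLp (fun ω => (S m).integral Z t ω - I t ω) 2 P :=
    ⟨S_memLp.1.sub I_meas.aestronglyMeasurable, hm⟩
  exact (S_memLp.sub diff_memLp).ae_eq (ae_of_all _ fun ω => by simp)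

lemma martingale {H : ℝ → Ω → ℝ} (hZ : IsBrownianFor P 𝔽 Z) (hI : IsItoIntegral P 𝔽 t₀ T Z H I) :
    Martingale (fun t : Set.Icc t₀ T => I t) (filtrationOn 𝔽 t₀ T) P := by
  obtain ⟨S, -, hS⟩ := hI.2.2
  refine martingale_of_tendsto (fun m => (S m).martingale_integral hZ)
    (fun t => (hI.2.1.1 t t.2).stronglyMeasurable)
    (fun t => (hI.memLp hZ t.2).integrable one_le_two) fun t => ?_
  refine tendsto_of_tendsto_of_tendsto_of_le_of_le tendsto_const_nhds
    (tendsto_eLpNorm_two_of_tendsto_lintegral (hS t t.2)) (fun _ => zero_le) fun m => ?_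
  exact eLpNorm_le_eLpNorm_of_exponent_le one_le_two
    (((S m).memLp_integral hZ t).sub (hI.memLp hZ t.2)).1

lemma measure_exists_lt_abs_le (hZ : IsBrownianFor P 𝔽 Z) (ht₀ : 0 ≤ t₀) (h : t₀ ≤ T)
    (hI : IsItoIntegral P 𝔽 t₀ T Z (fun t _ => f t) I) (hf : ContinuousOn f (Set.Icc t₀ T))
    (hK : ∀ s ∈ Set.Icc t₀ T, |f s| ≤ K) {l : ℝ} (hl : 0 < l) (ε : ℝ) :
    P {ω | ∃ t ∈ Set.Icc t₀ T, ε < |I t ω|} ≤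
      ENNReal.ofReal (2 * Real.exp ((T - t₀) * (l * K) ^ 2 / 2) * Real.exp (-(l * ε))) := by
  have exp_mul_abs_convex : ConvexOn ℝ Set.univ fun x : ℝ => Real.exp (l * |x|) := by
    refine ⟨convex_univ, fun x _ y _ a b ha hb hab => ?_⟩
    refine le_trans (Real.exp_le_exp.2 ?_)
      (convexOn_exp.2 (Set.mem_univ (l * |x|)) (Set.mem_univ (l * |y|)) ha hb hab)
    calc l * |a • x + b • y| ≤ l * (a * |x| + b * |y|) := by
          gcongr
          simpa [abs_mul, abs_of_nonneg, ha, hb] using abs_add_le (a * x) (b * y)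
      _ = a • (l * |x|) + b • (l * |y|) := by simp only [smul_eq_mul]; ring
  have doob := CARAGame.measure_exists_lt_le
    (submartingale_comp_of_convexOn (hI.martingale hZ) exp_mul_abs_convex
      fun t => hI.integrable_exp_mul_abs hZ ht₀ hf t.2 l)
    (fun t ω => Real.exp_nonneg _)
    (ae_of_all _ fun ω => Real.continuous_exp.comp (continuous_const.mul
      (continuousOn_iff_continuous_domRestrict.1 (hI.2.1.2 ω)).abs))
    (b := ⟨T, h, le_rfl⟩) (fun t => t.2.2) ⟨Real.exp (l * ε), Real.exp_nonneg _⟩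
  rw [ofReal_integral_eq_lintegral_ofReal
    (hI.integrable_exp_mul_abs hZ ht₀ hf ⟨h, le_rfl⟩ l)
    (ae_of_all _ fun _ => Real.exp_nonneg _)] at doob
  have exceed_eq : {ω | ∃ t ∈ Set.Icc t₀ T, ε < |I t ω|} =
      {ω | ∃ t : Set.Icc t₀ T, Real.exp (l * ε) < Real.exp (l * |I t ω|)} := by
    ext ω
    simp [hl]
  rw [exceed_eq, Real.exp_neg, ← div_eq_mul_inv, ENNReal.ofReal_div_of_pos (Real.exp_pos _),
    ENNReal.le_div_iff_mul_le (.inl (by simp [Real.exp_pos])) (.inl ENNReal.ofReal_ne_top),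
    mul_comm]
  refine le_trans ?_ (doob.trans (hI.lintegral_exp_mul_abs_le hZ ht₀ hf hK ⟨h, le_rfl⟩ l))
  rw [ENNReal.ofReal, Real.toNNReal_of_nonneg (Real.exp_nonneg _)]
  rfl

end IsItoIntegral

end Deterministic

/-! ### Exponential moments -/

section ExpMoments

variable {Ω : Type*} {mΩ : MeasurableSpace Ω} {P : Measure Ω} {M N : Ω → ℝ}

/-- The random variable `M` has exponential moments of all orders. -/
def HasExpMoments (P : Measure Ω) (M : Ω → ℝ) : Prop :=
  ∀ c : ℝ, Integrable (fun ω => Real.exp (c * M ω)) P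

lemma hasExpMoments_const [IsFiniteMeasure P] (a : ℝ) : HasExpMoments P fun _ => a :=
  fun _ => integrable_const _

namespace HasExpMoments

lemma const_mul (hM : HasExpMoments P M) (a : ℝ) : HasExpMoments P fun ω => a * M ω :=
  fun c => by simpa only [mul_assoc] using hM (c * a)

lemma memLp_two_exp_mul (hM : HasExpMoments P M) (c : ℝ) :
    MemLp (fun ω => Real.exp (c * M ω)) 2 P := by
  refine (memLp_two_iff_integrable_sq (hM c).1).2 ((hM (2 * c)).congr (ae_of_all _ fun ω => ?_))
  simp only [sq, ← Real.exp_add, ← two_mul, mul_assoc]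

lemma add (hM : HasExpMoments P M) (hN : HasExpMoments P N) :
    HasExpMoments P fun ω => M ω + N ω := fun c => by
  simp only [mul_add, Real.exp_add]
  exact (hM.memLp_two_exp_mul c).integrable_mul (hN.memLp_two_exp_mul c)

lemma sum [IsFiniteMeasure P] {ι : Type*} (s : Finset ι) {M : ι → Ω → ℝ}
    (hM : ∀ i, HasExpMoments P (M i)) : HasExpMoments P fun ω => ∑ i ∈ s, M i ω := by
  classical
  induction s using Finset.induction_on with
  | empty => simpa using hasExpMoments_const 0
  | insert i s hi ih => simpa only [Finset.sum_insert hi] using (hM i).add ih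

end HasExpMoments

lemma lintegral_Ioi_ofReal_exp_mul_lt_top {a : ℝ} (ha : a < 0) (c : ℝ) :
    ∫⁻ t in Set.Ioi c, ENNReal.ofReal (Real.exp (a * t)) < ∞ :=
  (lintegral_ofReal_ne_top_iff_integrable (by fun_prop)
    (ae_of_all _ fun _ => Real.exp_nonneg _)).2 (integrableOn_exp_mul_Ioi ha c) |>.lt_top

lemma lintegral_exp_mul_lt_top_of_measure_lt_le [IsFiniteMeasure P] (hM : Measurable M)
    (hM0 : ∀ ω, 0 ≤ M ω) {c C : ℝ} (hc : 0 ≤ c)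
    (htail : ∀ ε : ℝ, P {ω | ε < M ω} ≤ ENNReal.ofReal (C * Real.exp (-((c + 1) * ε)))) :
    ∫⁻ ω, ENNReal.ofReal (Real.exp (c * M ω)) ∂P < ∞ := by
  have exp_eq_integral : ∀ x : ℝ, Real.exp (c * x) = 1 + ∫ t in 0..x, c * Real.exp (c * t) :=
    fun x => by
      have deriv_exp : ∀ t ∈ Set.uIcc 0 x,
          HasDerivAt (fun t => Real.exp (c * t)) (c * Real.exp (c * t)) t := fun t _ => by
        simpa [mul_comm] using ((hasDerivAt_id t).const_mul c).exp
      rw [intervalIntegral.integral_eq_sub_of_hasDerivAt deriv_exp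
        (Continuous.intervalIntegrable (by fun_prop) _ _)]
      simp
  have layer_cake := lintegral_comp_eq_lintegral_meas_lt_mul P (g := fun t => c * Real.exp (c * t))
    (ae_of_all _ hM0) hM.aemeasurable
    (fun _ _ => Continuous.intervalIntegrable (by fun_prop) _ _)
    (ae_of_all _ fun t => mul_nonneg hc (Real.exp_nonneg _))
  have tail_mul_le : ∀ t : ℝ, P {ω | t < M ω} * ENNReal.ofReal (c * Real.exp (c * t)) ≤
      ENNReal.ofReal (C * c) * ENNReal.ofReal (Real.exp (-1 * t)) := fun t => by
    refine (mul_le_mul_left (htail t) _).trans_eq ?_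
    rw [← ENNReal.ofReal_mul' (by positivity), ← ENNReal.ofReal_mul' (Real.exp_nonneg _),
      mul_mul_mul_comm, ← Real.exp_add]
    ring_nf
  calc ∫⁻ ω, ENNReal.ofReal (Real.exp (c * M ω)) ∂P
      ≤ ∫⁻ ω, (1 + ENNReal.ofReal (∫ t in 0..M ω, c * Real.exp (c * t))) ∂P := by
        refine lintegral_mono fun ω => ?_
        rw [exp_eq_integral (M ω)]
        exact ENNReal.ofReal_add_le.trans_eq (by rw [ENNReal.ofReal_one])
    _ ≤ P Set.univ + ∫⁻ t in Set.Ioi (0 : ℝ),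
          ENNReal.ofReal (C * c) * ENNReal.ofReal (Real.exp (-1 * t)) := by
        rw [lintegral_add_left measurable_const, layer_cake, lintegral_one]
        exact add_le_add le_rfl (lintegral_mono fun t => tail_mul_le t)
    _ < ∞ := by
        rw [lintegral_const_mul' _ _ ENNReal.ofReal_ne_top]
        exact ENNReal.add_lt_top.2 ⟨measure_lt_top P _, ENNReal.mul_lt_top ENNReal.ofReal_lt_top
          (lintegral_Ioi_ofReal_exp_mul_lt_top (by norm_num) 0)⟩

lemma hasExpMoments_of_measure_lt_le [IsFiniteMeasure P] (hM : Measurable M)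
    (hM0 : ∀ ω, 0 ≤ M ω) (htail : ∀ l > 0, ∃ C : ℝ, ∀ ε : ℝ,
      P {ω | ε < M ω} ≤ ENNReal.ofReal (C * Real.exp (-(l * ε)))) : HasExpMoments P M := by
  intro c
  have integrable_exp_abs : Integrable (fun ω => Real.exp (|c| * M ω)) P := by
    obtain ⟨C, hC⟩ := htail (|c| + 1) (by positivity)
    exact (lintegral_ofReal_ne_top_iff_integrable (by fun_prop)
      (ae_of_all _ fun _ => Real.exp_nonneg _)).1
      (lintegral_exp_mul_lt_top_of_measure_lt_le hM hM0 (abs_nonneg c) hC).ne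
  refine integrable_exp_abs.mono' (by fun_prop) (ae_of_all _ fun ω => ?_)
  rw [Real.norm_eq_abs, Real.abs_exp, Real.exp_le_exp]
  exact mul_le_mul_of_nonneg_right (le_abs_self c) (hM0 ω)

lemma exists_measurable_abs_le {t₀ T : ℝ} (h : t₀ ≤ T) {Y : ℝ → Ω → ℝ}
    (hm : ∀ t ∈ Set.Icc t₀ T, Measurable (Y t))
    (hc : ∀ ω, ContinuousOn (fun t => Y t ω) (Set.Icc t₀ T)) :
    ∃ M : Ω → ℝ, Measurable M ∧ (∀ ω, ∀ t ∈ Set.Icc t₀ T, |Y t ω| ≤ M ω) ∧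
      ∀ ω ε, ε < M ω → ∃ t ∈ Set.Icc t₀ T, ε < |Y t ω| := by
  have : Nonempty (Set.Icc t₀ T) := ⟨⟨t₀, le_rfl, h⟩⟩
  set D : ℕ → Set.Icc t₀ T := TopologicalSpace.denseSeq _
  have path_cont : ∀ ω, Continuous fun t : Set.Icc t₀ T => |Y t ω| := fun ω =>
    (continuousOn_iff_continuous_domRestrict.1 (hc ω)).abs
  have bdd : ∀ ω, BddAbove (Set.range fun m => |Y (D m) ω|) := fun ω =>
    (isCompact_range (path_cont ω)).bddAbove.mono (Set.range_comp_subset_range D fun t => |Y t ω|)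
  refine ⟨fun ω => ⨆ m, |Y (D m) ω|, Measurable.iSup fun m => (hm _ (D m).2).abs,
    fun ω t ht => ?_, fun ω ε hε => ?_⟩
  · have closed : IsClosed {t : Set.Icc t₀ T | |Y t ω| ≤ ⨆ m, |Y (D m) ω|} :=
      isClosed_le (path_cont ω) continuous_const
    exact (TopologicalSpace.denseRange_denseSeq _).induction_on
      (p := fun t : Set.Icc t₀ T => |Y t ω| ≤ ⨆ m, |Y (D m) ω|) ⟨t, ht⟩ closed
      fun m => le_ciSup (bdd ω) m
  · obtain ⟨m, hm⟩ := exists_lt_of_lt_ciSup hε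
    exact ⟨D m, (D m).2, hm⟩

/-- The maximum of `‖Y‖` over `[t₀, T]` has exponential moments of all orders. The maximum itself
need not be measurable, so it is only asked to be dominated by a random variable with these
moments. -/
def HasExpMomentsOn {E : Type*} [NormedAddCommGroup E] (P : Measure Ω) (t₀ T : ℝ)
    (Y : ℝ → Ω → E) : Prop :=
  ∃ M, HasExpMoments P M ∧ ∀ᵐ ω ∂P, ∀ t ∈ Set.Icc t₀ T, ‖Y t ω‖ ≤ M ω

lemma IsItoIntegral.hasExpMomentsOn [IsProbabilityMeasure P] {𝔽 : Filtration ℝ≥0 mΩ}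
    {Z : ℝ≥0 → Ω → ℝ} {t₀ T : ℝ} {f : ℝ → ℝ} {I : ℝ → Ω → ℝ} (hZ : IsBrownianFor P 𝔽 Z)
    (ht₀ : 0 ≤ t₀) (h : t₀ ≤ T) (hI : IsItoIntegral P 𝔽 t₀ T Z (fun t _ => f t) I)
    (hf : ContinuousOn f (Set.Icc t₀ T)) :
    HasExpMomentsOn P t₀ T I := by
  obtain ⟨K, hK⟩ := isCompact_Icc.exists_bound_of_continuousOn hf
  obtain ⟨M, hM, hle, hlt⟩ := exists_measurable_abs_le h
    (fun t ht => (hI.2.1.1 t ht).mono (𝔽.le _) le_rfl) hI.2.1.2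
  refine ⟨M, hasExpMoments_of_measure_lt_le hM
    (fun ω => (abs_nonneg _).trans (hle ω t₀ ⟨le_rfl, h⟩)) fun l hl =>
    ⟨_, fun ε => (measure_mono fun ω hω => hlt ω ε hω).trans
      (hI.measure_exists_lt_abs_le hZ ht₀ h hf hK hl ε)⟩, ae_of_all _ hle⟩

end ExpMoments

/-! ### Integral equations with Lipschitz coefficients -/

section IntegralEquation

variable {t₀ T : ℝ}

lemma exists_continuous_eqOn_Icc {E : Type*} [TopologicalSpace E] (h : t₀ ≤ T) {f : ℝ → E}
    (hf : ContinuousOn f (Set.Icc t₀ T)) :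
    ∃ g : ℝ → E, Continuous g ∧ Set.EqOn f g (Set.Icc t₀ T) :=
  ⟨Set.IccExtend h ((Set.Icc t₀ T).domRestrict f),
    (continuousOn_iff_continuous_domRestrict.1 hf).Icc_extend',
    fun _ ht => (Set.IccExtend_of_mem h ((Set.Icc t₀ T).domRestrict f) ht).symm⟩

lemma add_mul_gronwallBound (K C x : ℝ) :
    C + K * gronwallBound 0 K C x = C * Real.exp (K * x) := by
  rcases eq_or_ne K 0 with rfl | hK
  · simp
  · rw [gronwallBound_of_K_ne_0 hK]
    field_simp
    ring

lemma le_mul_exp_of_le_add_integral {φ : ℝ → ℝ} (hφ : ContinuousOn φ (Set.Icc t₀ T)) {C K : ℝ}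
    (hK : 0 ≤ K) (h : ∀ t ∈ Set.Icc t₀ T, φ t ≤ C + K * ∫ s in t₀..t, φ s) {t : ℝ}
    (ht : t ∈ Set.Icc t₀ T) : φ t ≤ C * Real.exp (K * (t - t₀)) := by
  obtain ⟨ψ, ψ_cont, hψ⟩ := exists_continuous_eqOn_Icc (ht.1.trans ht.2) hφ
  have integral_eq : ∀ s ∈ Set.Icc t₀ T, ∫ r in t₀..s, φ r = ∫ r in t₀..s, ψ r := fun s hs =>
    intervalIntegral.integral_congr fun r hr => by
      rw [Set.uIcc_of_le hs.1] at hr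
      exact hψ ⟨hr.1, hr.2.trans hs.2⟩
  have ψ_le : ∀ s ∈ Set.Icc t₀ T, ψ s ≤ K * (∫ r in t₀..s, ψ r) + C := fun s hs => by
    rw [← hψ hs, ← integral_eq s hs, add_comm]
    exact h s hs
  have deriv_integral : ∀ s, HasDerivAt (fun s => ∫ r in t₀..s, ψ r) (ψ s) s := fun s =>
    ψ_cont.integral_hasStrictDerivAt t₀ s |>.hasDerivAt
  have gronwall := le_gronwallBound_of_liminf_deriv_right_le (δ := 0)
    (fun s _ => (deriv_integral s).continuousAt.continuousWithinAt)
    (fun s _ r hr => (deriv_integral s).hasDerivWithinAt.liminf_right_slope_le hr) (by simp)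
    (fun s hs => ψ_le s (Set.Ico_subset_Icc_self hs)) t ht
  rw [← add_mul_gronwallBound]
  refine (h t ht).trans ?_
  rw [integral_eq t ht]
  gcongr

lemma tendstoUniformlyOn_comp_of_lipschitzWith {ι α E E' : Type*} [PseudoMetricSpace E]
    [PseudoMetricSpace E'] {F : α → E → E'} {l : Filter ι} {y : ι → α → E} {x : α → E} {s : Set α}
    (hy : TendstoUniformlyOn y x l s) {K : ℝ≥0} (hF : ∀ a, LipschitzWith K (F a)) :
    TendstoUniformlyOn (fun i a => F a (y i a)) (fun a => F a (x a)) l s := by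
  rw [Metric.tendstoUniformlyOn_iff] at hy ⊢
  intro ε hε
  filter_upwards [hy (ε / (K + 1)) (by positivity)] with i hi a ha
  calc dist (F a (x a)) (F a (y i a)) ≤ K * dist (x a) (y i a) := (hF a).dist_le_mul _ _
    _ ≤ (K + 1) * dist (x a) (y i a) := by gcongr; simp
    _ < ε := (lt_div_iff₀' (by positivity)).1 (hi a ha)

variable {E : Type*} [NormedAddCommGroup E] [NormedSpace ℝ E]

/-- The Picard iterates for the integral equation `x t = g t + ∫ s in t₀..t, F s (x s)`. -/
noncomputable def picardIterate (t₀ : ℝ) (F : ℝ → E → E) (g : ℝ → E) : ℕ → ℝ → E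
  | 0 => g
  | k + 1 => fun t => g t + ∫ s in t₀..t, F s (picardIterate t₀ F g k s)

variable {F : ℝ → E → E} {g : ℝ → E}

lemma continuous_picardIterate (hF : Continuous fun p : ℝ × E => F p.1 p.2) (hg : Continuous g)
    (k : ℕ) : Continuous (picardIterate t₀ F g k) := by
  induction k with
  | zero => exact hg
  | succ k ih =>
    refine hg.add (intervalIntegral.continuous_primitive (fun a b => ?_) t₀)
    exact (hF.comp (continuous_id.prodMk ih)).intervalIntegrable _ _

lemma integral_mul_exp_two_mul_le (K : ℝ) {D : ℝ} (hD : 0 ≤ D) (t : ℝ) :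
    ∫ s in t₀..t, K * (D * Real.exp (2 * K * (s - t₀))) ≤
      D / 2 * Real.exp (2 * K * (t - t₀)) := by
  have deriv_exp : ∀ s ∈ Set.uIcc t₀ t, HasDerivAt (fun s => D / 2 * Real.exp (2 * K * (s - t₀)))
      (K * (D * Real.exp (2 * K * (s - t₀)))) s := fun s _ => by
    have := (((hasDerivAt_id s).sub_const t₀).const_mul (2 * K)).exp.const_mul (D / 2)
    refine this.congr_deriv ?_
    simp only [id, mul_one]
    ring
  rw [intervalIntegral.integral_eq_sub_of_hasDerivAt deriv_exp
    (Continuous.intervalIntegrable (by fun_prop) _ _)]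
  simpa using div_nonneg hD zero_le_two

lemma norm_picardIterate_succ_sub_le (hF : Continuous fun p : ℝ × E => F p.1 p.2)
    (hg : Continuous g) {K : ℝ≥0} (hL : ∀ s, LipschitzWith K (F s)) {C : ℝ} (hC0 : 0 ≤ C)
    (hC : ∀ t ∈ Set.Icc t₀ T, ‖picardIterate t₀ F g 1 t - picardIterate t₀ F g 0 t‖ ≤ C) (k : ℕ) :
    ∀ t ∈ Set.Icc t₀ T, ‖picardIterate t₀ F g (k + 1) t - picardIterate t₀ F g k t‖ ≤
      C * (1 / 2) ^ k * Real.exp (2 * K * (t - t₀)) := by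
  induction k with
  | zero =>
    intro t ht
    have := sub_nonneg.2 ht.1
    rw [pow_zero, mul_one]
    exact (hC t ht).trans (le_mul_of_one_le_right hC0 (Real.one_le_exp (by positivity)))
  | succ k ih =>
    intro t ht
    have field_integrable : ∀ k,
        IntervalIntegrable (fun s => F s (picardIterate t₀ F g k s)) volume t₀ t := fun k =>
      (hF.comp (continuous_id.prodMk (continuous_picardIterate hF hg k))).intervalIntegrable _ _
    have sub_eq_integral : picardIterate t₀ F g (k + 2) t - picardIterate t₀ F g (k + 1) t =
        ∫ s in t₀..t, (F s (picardIterate t₀ F g (k + 1) s) - F s (picardIterate t₀ F g k s)) := by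
      rw [intervalIntegral.integral_sub (field_integrable _) (field_integrable _)]
      exact add_sub_add_left_eq_sub _ _ _
    calc ‖picardIterate t₀ F g (k + 2) t - picardIterate t₀ F g (k + 1) t‖
        ≤ ∫ s in t₀..t, K * (C * (1 / 2) ^ k * Real.exp (2 * K * (s - t₀))) := by
          rw [sub_eq_integral]
          refine intervalIntegral.norm_integral_le_of_norm_le ht.1 (ae_of_all _ fun s hs => ?_)
            (Continuous.intervalIntegrable (by fun_prop) _ _)
          exact ((hL s).norm_sub_le _ _).trans
            (mul_le_mul_of_nonneg_left (ih s ⟨hs.1.le, hs.2.trans ht.2⟩) K.2)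
      _ ≤ C * (1 / 2) ^ k / 2 * Real.exp (2 * K * (t - t₀)) :=
          integral_mul_exp_two_mul_le K (by positivity) t
      _ = C * (1 / 2) ^ (k + 1) * Real.exp (2 * K * (t - t₀)) := by ring

lemma exists_tendstoUniformlyOn_picardIterate [CompleteSpace E]
    (hF : Continuous fun p : ℝ × E => F p.1 p.2) (hg : Continuous g) {K : ℝ≥0}
    (hL : ∀ s, LipschitzWith K (F s)) :
    ∃ x : ℝ → E, TendstoUniformlyOn (picardIterate t₀ F g) x atTop (Set.Icc t₀ T) := by
  obtain ⟨C, hC⟩ := (isCompact_Icc (a := t₀) (b := T)).exists_bound_of_continuousOn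
    ((continuous_picardIterate (t₀ := t₀) hF hg 1).sub
      (continuous_picardIterate hF hg 0)).continuousOn
  refine exists_tendstoUniformlyOn_of_norm_sub_le
    (u := fun k => |C| * (1 / 2) ^ k * Real.exp (2 * K * (T - t₀)))
    ((summable_geometric_two.mul_left _).mul_right _) (Eventually.of_forall fun k t ht => ?_)
  refine (norm_picardIterate_succ_sub_le hF hg hL (abs_nonneg C)
    (fun s hs => (hC s hs).trans (le_abs_self C)) k t ht).trans ?_
  have := ht.2
  gcongr

lemma eq_add_integral_of_tendstoUniformlyOn_picardIterate
    (hF : Continuous fun p : ℝ × E => F p.1 p.2) (hg : Continuous g) {K : ℝ≥0}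
    (hL : ∀ s, LipschitzWith K (F s)) {x : ℝ → E}
    (hx : TendstoUniformlyOn (picardIterate t₀ F g) x atTop (Set.Icc t₀ T)) {t : ℝ}
    (ht : t ∈ Set.Icc t₀ T) : x t = g t + ∫ s in t₀..t, F s (x s) := by
  refine tendsto_nhds_unique ((hx.tendsto_at ht).comp (tendsto_add_atTop_nat 1))
    (tendsto_const_nhds.add ?_)
  refine TendstoUniformlyOn.tendsto_intervalIntegral_of_continuousOn
    (Eventually.of_forall fun k =>
      (hF.comp (continuous_id.prodMk (continuous_picardIterate hF hg k))).continuousOn)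
    (tendstoUniformlyOn_comp_of_lipschitzWith (hx.mono ?_) hL)
  rw [Set.uIcc_of_le ht.1]
  exact Set.Icc_subset_Icc_right ht.2

variable {Ω : Type*} [MeasurableSpace E] [BorelSpace E] [SecondCountableTopology E]

lemma measurable_intervalIntegral_of_continuousOn {m : MeasurableSpace Ω} {H : ℝ → Ω → E} {t : ℝ}
    (ht : t₀ ≤ t) (hc : ∀ ω, ContinuousOn (fun s => H s ω) (Set.Icc t₀ t))
    (hm : ∀ s ∈ Set.Icc t₀ t, Measurable (H s)) : Measurable fun ω => ∫ s in t₀..t, H s ω := by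
  set H' : ℝ → Ω → E := fun s ω => H (Set.projIcc t₀ t ht s) ω
  have H'_meas : Measurable (Function.uncurry H') :=
    measurable_uncurry_of_continuous_of_measurable
      (fun ω => (continuousOn_iff_continuous_domRestrict.1 (hc ω)).comp continuous_projIcc)
      fun s => hm _ (Set.projIcc t₀ t ht s).2
  have integral_eq : ∀ ω, ∫ s in t₀..t, H s ω = ∫ s in Set.Ioc t₀ t, H' s ω := fun ω => by
    rw [intervalIntegral.integral_of_le ht]
    refine setIntegral_congr_fun measurableSet_Ioc fun s hs => ?_
    simp only [H', Set.projIcc_of_mem ht (Set.Ioc_subset_Icc_self hs)]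
  simp only [integral_eq]
  have swap_meas : StronglyMeasurable fun p : Ω × ℝ => H' p.2 p.1 :=
    (H'_meas.comp measurable_swap).stronglyMeasurable
  exact swap_meas.integral_prod_right.measurable

lemma measurable_picardIterate {mΩ : MeasurableSpace Ω} {𝔽 : Filtration ℝ≥0 mΩ} {g : Ω → ℝ → E}
    (hF : Continuous fun p : ℝ × E => F p.1 p.2) (hg : ∀ ω, Continuous (g ω))
    (hgm : ∀ t ∈ Set.Icc t₀ T, Measurable[𝔽 t.toNNReal] fun ω => g ω t) (k : ℕ) :
    ∀ t ∈ Set.Icc t₀ T, Measurable[𝔽 t.toNNReal] fun ω => picardIterate t₀ F (g ω) k t := by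
  induction k with
  | zero => exact hgm
  | succ k ih =>
    intro t ht
    refine (hgm t ht).add (measurable_intervalIntegral_of_continuousOn ht.1 (fun ω => ?_)
      fun s hs => ?_)
    · exact (hF.comp (continuous_id.prodMk (continuous_picardIterate hF (hg ω) k))).continuousOn
    · exact (hF.comp (.prodMk_right s)).measurable.comp
        ((ih s ⟨hs.1, hs.2.trans ht.2⟩).mono (𝔽.mono (Real.toNNReal_le_toNNReal hs.2)) le_rfl)

end IntegralEquation

section LipschitzField

variable {E : Type*} [NormedAddCommGroup E] {F : ℝ → E → E} {s : Set ℝ} {t₀ T : ℝ}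

/-- The time-dependent vector field `F` is continuous in time on `s` and Lipschitz in space,
uniformly over `s`. -/
structure IsLipschitzField (s : Set ℝ) (F : ℝ → E → E) : Prop where
  continuousOn : ∀ x, ContinuousOn (fun t => F t x) s
  exists_lipschitzWith : ∃ K : ℝ≥0, ∀ t ∈ s, LipschitzWith K (F t)

namespace IsLipschitzField

lemma mono {s' : Set ℝ} (hF : IsLipschitzField s F) (h : s' ⊆ s) : IsLipschitzField s' F :=
  ⟨fun x => (hF.continuousOn x).mono h,
    hF.exists_lipschitzWith.imp fun _ hK t ht => hK t (h ht)⟩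

lemma congr {G : ℝ → E → E} (hF : IsLipschitzField s F) (h : Set.EqOn F G s) :
    IsLipschitzField s G :=
  ⟨fun x => (hF.continuousOn x).congr fun _ ht => congr_fun (h ht).symm x,
    hF.exists_lipschitzWith.imp fun _ hK _ ht => h ht ▸ hK _ ht⟩

lemma continuousOn_comp (hF : IsLipschitzField s F) {x : ℝ → E} (hx : ContinuousOn x s) :
    ContinuousOn (fun t => F t (x t)) s := by
  obtain ⟨K, hK⟩ := hF.exists_lipschitzWith
  exact (continuousOn_prod_of_continuousOn_lipschitzOnWith' (fun p : ℝ × E => F p.1 p.2) K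
    (fun t ht => (hK t ht).lipschitzOnWith (s := Set.univ)) fun x _ => hF.continuousOn x).comp
    (continuousOn_id.prodMk hx) fun _ ht => ⟨ht, trivial⟩

lemma exists_norm_le_add_mul (hF : IsLipschitzField s F) (hs : IsCompact s) :
    ∃ a K : ℝ≥0, ∀ t ∈ s, ∀ x, ‖F t x‖ ≤ a + K * ‖x‖ := by
  obtain ⟨K, hK⟩ := hF.exists_lipschitzWith
  obtain ⟨a, ha⟩ := hs.exists_bound_of_continuousOn (hF.continuousOn 0)
  refine ⟨a.toNNReal, K, fun t ht x => ?_⟩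
  calc ‖F t x‖ ≤ ‖F t 0‖ + ‖F t x - F t 0‖ := norm_le_norm_add_norm_sub' _ _
    _ ≤ a.toNNReal + K * ‖x‖ := by
        gcongr
        · exact (ha t ht).trans (Real.le_coe_toNNReal a)
        · simpa using (hK t ht).norm_sub_le x 0

end IsLipschitzField

lemma isLipschitzField_clm_add [NormedSpace ℝ E] {L : ℝ → E →L[ℝ] E} {v : ℝ → E}
    (hs : IsCompact s) (hL : ContinuousOn L s) (hv : ContinuousOn v s) :
    IsLipschitzField s fun t x => L t x + v t := by
  obtain ⟨K, hK⟩ := hs.exists_bound_of_continuousOn hL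
  refine ⟨fun x => (hL.clm_apply continuousOn_const).add hv, K.toNNReal, fun t ht => ?_⟩
  refine LipschitzWith.of_dist_le_mul fun x y => ?_
  rw [dist_add_right]
  exact ((L t).lipschitz.dist_le_mul x y).trans <|
    mul_le_mul_of_nonneg_right ((hK t ht).trans (Real.le_coe_toNNReal K)) dist_nonneg

lemma isLipschitzField_mulVec_add {n : ℕ} {A : ℝ → Matrix (Fin n) (Fin n) ℝ}
    {b : ℝ → Fin n → ℝ} (hs : IsCompact s) (hA : ContinuousOn A s) (hb : ContinuousOn b s) :
    IsLipschitzField s fun t (x : EuclideanSpace ℝ (Fin n)) =>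
      WithLp.toLp 2 ((A t).mulVec x + b t) :=
  isLipschitzField_clm_add hs
    ((LinearMap.continuous_of_finiteDimensional
      (Matrix.toEuclideanCLM (n := Fin n) (𝕜 := ℝ)).toAlgEquiv.toLinearMap).comp_continuousOn hA)
    ((PiLp.continuous_toLp 2 _).comp_continuousOn hb)

variable [NormedSpace ℝ E]

lemma norm_le_of_eq_add_integral {x y : ℝ → E} (hx : ContinuousOn x (Set.Icc t₀ T))
    (hxy : ∀ t ∈ Set.Icc t₀ T, x t = y t + ∫ s in t₀..t, F s (x s)) {a K : ℝ≥0} {m : ℝ}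
    (hF : ∀ t ∈ Set.Icc t₀ T, ∀ x, ‖F t x‖ ≤ a + K * ‖x‖)
    (hy : ∀ t ∈ Set.Icc t₀ T, ‖y t‖ ≤ m) {t : ℝ} (ht : t ∈ Set.Icc t₀ T) :
    ‖x t‖ ≤ (m + a * (T - t₀)) * Real.exp (K * (T - t₀)) := by
  have integral_bound : ∀ t ∈ Set.Icc t₀ T,
      ‖x t‖ ≤ m + a * (T - t₀) + K * ∫ s in t₀..t, ‖x s‖ := fun t ht => by
    have norm_integrable : IntervalIntegrable (fun s => ‖x s‖) volume t₀ t :=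
      (hx.norm.mono (Set.Icc_subset_Icc_right ht.2)).intervalIntegrable_of_Icc ht.1
    calc ‖x t‖ ≤ ‖y t‖ + ‖∫ s in t₀..t, F s (x s)‖ := hxy t ht ▸ norm_add_le _ _
      _ ≤ m + ∫ s in t₀..t, (a + K * ‖x s‖) := by
          refine add_le_add (hy t ht) (intervalIntegral.norm_integral_le_of_norm_le ht.1
            (ae_of_all _ fun s hs => hF s ⟨hs.1.le, hs.2.trans ht.2⟩ (x s))
            (intervalIntegrable_const.add (norm_integrable.const_mul K)))
      _ = m + a * (t - t₀) + K * ∫ s in t₀..t, ‖x s‖ := by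
          rw [intervalIntegral.integral_add intervalIntegrable_const (norm_integrable.const_mul _),
            intervalIntegral.integral_const, intervalIntegral.integral_const_mul, smul_eq_mul]
          ring
      _ ≤ m + a * (T - t₀) + K * ∫ s in t₀..t, ‖x s‖ := by gcongr; exact ht.2
  have m_nonneg : 0 ≤ m := (norm_nonneg _).trans (hy t ht)
  have length_nonneg : 0 ≤ T - t₀ := sub_nonneg.2 (ht.1.trans ht.2)
  refine (le_mul_exp_of_le_add_integral hx.norm K.coe_nonneg integral_bound ht).trans ?_
  gcongr
  exact ht.2

lemma IsLipschitzField.eqOn_of_eq_add_integral (hF : IsLipschitzField (Set.Icc t₀ T) F)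
    {x x' y : ℝ → E}
    (hx : ContinuousOn x (Set.Icc t₀ T)) (hx' : ContinuousOn x' (Set.Icc t₀ T))
    (hxy : ∀ t ∈ Set.Icc t₀ T, x t = y t + ∫ s in t₀..t, F s (x s))
    (hxy' : ∀ t ∈ Set.Icc t₀ T, x' t = y t + ∫ s in t₀..t, F s (x' s)) :
    Set.EqOn x x' (Set.Icc t₀ T) := by
  obtain ⟨K, hK⟩ := hF.exists_lipschitzWith
  have field_integrable : ∀ {z : ℝ → E} {t : ℝ}, ContinuousOn z (Set.Icc t₀ T) →
      t ∈ Set.Icc t₀ T → IntervalIntegrable (fun s => F s (z s)) volume t₀ t := fun hz ht =>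
    ((hF.continuousOn_comp hz).mono
      (Set.Icc_subset_Icc_right ht.2)).intervalIntegrable_of_Icc ht.1
  have integral_bound : ∀ t ∈ Set.Icc t₀ T,
      ‖x t - x' t‖ ≤ 0 + K * ∫ s in t₀..t, ‖x s - x' s‖ := fun t ht => by
    rw [hxy t ht, hxy' t ht, add_sub_add_left_eq_sub, zero_add,
      ← intervalIntegral.integral_sub (field_integrable hx ht) (field_integrable hx' ht),
      ← intervalIntegral.integral_const_mul]
    exact intervalIntegral.norm_integral_le_of_norm_le ht.1
      (ae_of_all _ fun s hs => (hK s ⟨hs.1.le, hs.2.trans ht.2⟩).norm_sub_le _ _)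
      ((((hx.sub hx').norm.const_mul _).mono
        (Set.Icc_subset_Icc_right ht.2)).intervalIntegrable_of_Icc ht.1)
  intro t ht
  have := le_mul_exp_of_le_add_integral (hx.sub hx').norm K.coe_nonneg integral_bound ht
  rw [zero_mul] at this
  exact sub_eq_zero.1 (norm_le_zero_iff.1 this)

variable {Ω : Type*} {mΩ : MeasurableSpace Ω} {𝔽 : Filtration ℝ≥0 mΩ} [CompleteSpace E]
  [MeasurableSpace E] [BorelSpace E] [SecondCountableTopology E]

lemma IsContinuousAdapted.exists_eq_add_integral {Y : ℝ → Ω → E}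
    (hY : IsContinuousAdapted 𝔽 t₀ T Y) (h : t₀ ≤ T)
    (hF : IsLipschitzField (Set.Icc t₀ T) F) :
    ∃ X : ℝ → Ω → E, IsContinuousAdapted 𝔽 t₀ T X ∧
      ∀ ω, ∀ t ∈ Set.Icc t₀ T, X t ω = Y t ω + ∫ s in t₀..t, F s (X s ω) := by
  obtain ⟨K, hK⟩ := hF.exists_lipschitzWith
  let proj : ℝ → ℝ := fun t => Set.projIcc t₀ T h t
  have proj_mem : ∀ t, proj t ∈ Set.Icc t₀ T := fun t => (Set.projIcc t₀ T h t).2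
  have proj_eq : ∀ t ∈ Set.Icc t₀ T, proj t = t := fun t ht => by
    simp only [proj, Set.projIcc_of_mem h ht]
  have proj_cont : Continuous proj := continuous_subtype_val.comp continuous_projIcc
  have extension_lipschitz : ∀ t, LipschitzWith K (F (proj t)) := fun t => hK _ (proj_mem t)
  have extension_cont : Continuous fun p : ℝ × E => F (proj p.1) p.2 :=
    continuous_prod_of_continuous_lipschitzWith' _ K extension_lipschitz
      fun x => (hF.continuousOn x).comp_continuous proj_cont proj_mem
  have forcing_cont : ∀ ω, Continuous fun t => Y (proj t) ω := fun ω =>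
    (hY.2 ω).comp_continuous proj_cont proj_mem
  have forcing_meas : ∀ t ∈ Set.Icc t₀ T, Measurable[𝔽 t.toNNReal] fun ω => Y (proj t) ω :=
    fun t ht => by simpa only [proj_eq t ht] using hY.1 t ht
  choose x hx using fun ω => exists_tendstoUniformlyOn_picardIterate (t₀ := t₀) (T := T)
    extension_cont (forcing_cont ω) extension_lipschitz
  refine ⟨fun t ω => x ω t, ⟨fun t ht => ?_, fun ω => ?_⟩, fun ω t ht => ?_⟩
  · exact @measurable_of_tendsto_metrizable _ _ (𝔽 t.toNNReal) _ _ _ _ _ _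
      (fun k => measurable_picardIterate extension_cont forcing_cont forcing_meas k t ht)
      (tendsto_pi_nhds.2 fun ω => (hx ω).tendsto_at ht)
  · exact (hx ω).continuousOn (Frequently.of_forall fun k =>
      (continuous_picardIterate extension_cont (forcing_cont ω) k).continuousOn)
  · refine (eq_add_integral_of_tendstoUniformlyOn_picardIterate extension_cont (forcing_cont ω)
      extension_lipschitz (hx ω) ht).trans ?_
    rw [proj_eq t ht]
    congr 1
    refine intervalIntegral.integral_congr fun s hs => ?_
    rw [Set.uIcc_of_le ht.1] at hs
    simp only [proj_eq s ⟨hs.1, hs.2.trans ht.2⟩]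

end LipschitzField

/-! ### Stochastic differential equations with additive noise -/

section AdditiveNoise

variable {Ω ι : Type*} {mΩ : MeasurableSpace Ω} {P : Measure Ω}
  {𝔽 : Filtration ℝ≥0 mΩ} {n : ℕ} {t₀ T : ℝ} {x₀ : EuclideanSpace ℝ (Fin n)}
  {Z : ι → ℝ≥0 → Ω → ℝ} {X Y : ℝ → Ω → EuclideanSpace ℝ (Fin n)}

lemma ae_forall_itoIntegral_eq [IsProbabilityMeasure P] [Finite ι]
    (hZ : ∀ j, IsBrownianFor P 𝔽 (Z j)) (ht₀ : 0 ≤ t₀) {diff I J : Fin n → ι → ℝ → Ω → ℝ}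
    (hI : ∀ i j, IsItoIntegral P 𝔽 t₀ T (Z j) (diff i j) (I i j))
    (hJ : ∀ i j, IsItoIntegral P 𝔽 t₀ T (Z j) (diff i j) (J i j)) :
    ∀ᵐ ω ∂P, ∀ i j, ∀ t ∈ Set.Icc t₀ T, I i j t ω = J i j t ω :=
  ae_all_iff.2 fun i => ae_all_iff.2 fun j => (hI i j).ae_eq (hZ j) ht₀ (hJ i j)

variable [Fintype ι]

lemma IsItoProcess.congr {drift drift' : Fin n → ℝ → Ω → ℝ} {diff diff' : Fin n → ι → ℝ → Ω → ℝ}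
    (hX : IsItoProcess P 𝔽 Z t₀ T x₀ drift diff X)
    (hdrift : ∀ i, ∀ t ∈ Set.Icc t₀ T, drift i t = drift' i t)
    (hdiff : ∀ i j, ∀ t ∈ Set.Icc t₀ T, diff i j t = diff' i j t) :
    IsItoProcess P 𝔽 Z t₀ T x₀ drift' diff' X := by
  obtain ⟨X_mem, drift_integrable, I, hI, X_eq⟩ := hX
  refine ⟨X_mem, fun i => ?_, I, fun i j => (hI i j).congr (hdiff i j), ?_⟩
  · filter_upwards [drift_integrable i] with ω hω
    exact hω.congr_fun (fun s hs => by simp only [hdrift i s hs]) measurableSet_Icc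
  · filter_upwards [X_eq] with ω hω t ht i
    rw [hω t ht i]
    congr 2
    refine intervalIntegral.integral_congr fun s hs => ?_
    rw [Set.uIcc_of_le ht.1] at hs
    simp only [hdrift i s ⟨hs.1, hs.2.trans ht.2⟩]

lemma IsItoProcess.ae_eq [IsProbabilityMeasure P] (hZ : ∀ j, IsBrownianFor P 𝔽 (Z j))
    (ht₀ : 0 ≤ t₀) {drift : Fin n → ℝ → Ω → ℝ} {diff : Fin n → ι → ℝ → Ω → ℝ}
    (hX : IsItoProcess P 𝔽 Z t₀ T x₀ drift diff X)
    (hY : IsItoProcess P 𝔽 Z t₀ T x₀ drift diff Y) :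
    ∀ᵐ ω ∂P, ∀ t ∈ Set.Icc t₀ T, X t ω = Y t ω := by
  obtain ⟨-, -, I, hI, X_eq⟩ := hX
  obtain ⟨-, -, J, hJ, Y_eq⟩ := hY
  filter_upwards [X_eq, Y_eq, ae_forall_itoIntegral_eq hZ ht₀ hI hJ] with ω hXω hYω hIJ t ht
  ext i
  rw [hXω t ht i, hYω t ht i, Finset.sum_congr rfl fun j _ => hIJ i j t ht]

variable {F : ℝ → EuclideanSpace ℝ (Fin n) → EuclideanSpace ℝ (Fin n)}

/-- The term `y` in the integral equation `x t = y t + ∫ s in t₀..t, F s (x s)` to which an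
equation with additive noise reduces along each path: the initial value plus the stochastic
integrals `I i j` of the diffusion coefficients. -/
noncomputable def forcing (x₀ : EuclideanSpace ℝ (Fin n)) (I : Fin n → ι → ℝ → Ω → ℝ) (t : ℝ)
    (ω : Ω) : EuclideanSpace ℝ (Fin n) :=
  x₀ + WithLp.toLp 2 fun i => ∑ j, I i j t ω

lemma isContinuousAdapted_forcing {I : Fin n → ι → ℝ → Ω → ℝ}
    (hI : ∀ i j, IsContinuousAdapted 𝔽 t₀ T (I i j)) :
    IsContinuousAdapted 𝔽 t₀ T (forcing x₀ I) := by
  refine ⟨fun t ht => measurable_const.add ?_, fun ω => continuousOn_const.add ?_⟩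
  · exact (WithLp.measurable_toLp 2 _).comp <|
      @measurable_pi_lambda _ _ _ (𝔽 t.toNNReal) _ _ fun i =>
        Finset.measurable_fun_sum _ fun j _ => (hI i j).1 t ht
  · exact (PiLp.continuous_toLp 2 _).comp_continuousOn <| continuousOn_pi.2 fun i =>
      continuousOn_finsetSum _ fun j _ => (hI i j).2 ω

lemma norm_le_sum_abs (x : EuclideanSpace ℝ (Fin n)) : ‖x‖ ≤ ∑ i, |x i| := by
  rw [EuclideanSpace.norm_eq]
  refine Real.sqrt_le_iff.2 ⟨Finset.sum_nonneg fun _ _ => abs_nonneg _, ?_⟩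
  simpa only [Real.norm_eq_abs] using
    Finset.sum_sq_le_sq_sum_of_nonneg (s := Finset.univ) fun i _ => abs_nonneg (x i)

lemma norm_forcing_le {I : Fin n → ι → ℝ → Ω → ℝ} {t : ℝ} {ω : Ω} {M : Fin n → ι → ℝ}
    (hM : ∀ i j, |I i j t ω| ≤ M i j) : ‖forcing x₀ I t ω‖ ≤ ‖x₀‖ + ∑ i, ∑ j, M i j :=
  (norm_add_le _ _).trans <| add_le_add_right ((norm_le_sum_abs _).trans <|
    Finset.sum_le_sum fun i _ => (Finset.abs_sum_le_sum_abs _ _).trans <|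
      Finset.sum_le_sum fun j _ => hM i j) _

variable {a : Fin n → ι → ℝ → EuclideanSpace ℝ (Fin n) → ℝ}

lemma isSDESolution_iff (hF : IsLipschitzField (Set.Icc t₀ T) F) :
    IsSDESolution P 𝔽 Z t₀ T x₀ (fun i t x => F t x i) a X ↔ IsContinuousAdapted 𝔽 t₀ T X ∧
      ∃ I : Fin n → ι → ℝ → Ω → ℝ,
        (∀ i j, IsItoIntegral P 𝔽 t₀ T (Z j) (fun t ω => a i j t (X t ω)) (I i j)) ∧
        ∀ᵐ ω ∂P, ∀ t ∈ Set.Icc t₀ T,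
          X t ω = forcing x₀ I t ω + ∫ s in t₀..t, F s (X s ω) := by
  refine and_congr_right fun hX => ?_
  have field_cont : ∀ ω, ContinuousOn (fun s => F s (X s ω)) (Set.Icc t₀ T) := fun ω =>
    hF.continuousOn_comp (hX.2 ω)
  have integral_apply : ∀ ω, ∀ t ∈ Set.Icc t₀ T, ∀ i,
      (∫ s in t₀..t, F s (X s ω)) i = ∫ s in t₀..t, F s (X s ω) i := fun ω t ht i =>
    ((EuclideanSpace.proj (𝕜 := ℝ) i).intervalIntegral_comp_comm
      (((field_cont ω).mono (Set.Icc_subset_Icc_right ht.2)).intervalIntegrable_of_Icc ht.1)).symm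
  have drift_integrable : ∀ i, ∀ᵐ ω ∂P, IntegrableOn (fun s => F s (X s ω) i) (Set.Icc t₀ T) :=
    fun i => ae_of_all _ fun ω => ContinuousOn.integrableOn_Icc <|
      (EuclideanSpace.proj (𝕜 := ℝ) i).continuous.comp_continuousOn (field_cont ω)
  rw [and_iff_right drift_integrable]
  refine exists_congr fun I => and_congr_right fun _ => eventually_congr <| ae_of_all _ fun ω =>
    forall₂_congr fun t ht => ?_
  rw [PiLp.ext_iff]
  refine forall_congr' fun i => ?_
  rw [PiLp.add_apply, integral_apply ω t ht, forcing, PiLp.add_apply, add_right_comm]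

variable [IsProbabilityMeasure P] {D : ℝ → Matrix (Fin n) ι ℝ}

theorem exists_isSDESolution (hZ : ∀ j, IsBrownianFor P 𝔽 (Z j)) (ht₀ : 0 ≤ t₀) (h : t₀ ≤ T)
    (hF : IsLipschitzField (Set.Icc t₀ T) F) (hD : ContinuousOn D (Set.Icc t₀ T)) :
    ∃ X, IsSDESolution P 𝔽 Z t₀ T x₀ (fun i t x => F t x i) (fun i j t _ => D t i j) X := by
  choose I hI using fun i j => (hZ j).exists_isItoIntegral_of_continuousOn ht₀ h
    (continuousOn_pi.1 (continuousOn_pi.1 hD i) j)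
  obtain ⟨X, hX, X_eq⟩ := (isContinuousAdapted_forcing (x₀ := x₀)
    fun i j => (hI i j).2.1).exists_eq_add_integral h hF
  exact ⟨X, (isSDESolution_iff hF).2 ⟨hX, I, hI, ae_of_all _ X_eq⟩⟩

theorem IsSDESolution.ae_eq (hZ : ∀ j, IsBrownianFor P 𝔽 (Z j)) (ht₀ : 0 ≤ t₀)
    (hF : IsLipschitzField (Set.Icc t₀ T) F)
    (hX : IsSDESolution P 𝔽 Z t₀ T x₀ (fun i t x => F t x i) (fun i j t _ => D t i j) X)
    (hY : IsSDESolution P 𝔽 Z t₀ T x₀ (fun i t x => F t x i) (fun i j t _ => D t i j) Y) :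
    ∀ᵐ ω ∂P, ∀ t ∈ Set.Icc t₀ T, X t ω = Y t ω := by
  obtain ⟨hX, I, hI, X_eq⟩ := (isSDESolution_iff hF).1 hX
  obtain ⟨hY, J, hJ, Y_eq⟩ := (isSDESolution_iff hF).1 hY
  filter_upwards [X_eq, Y_eq, ae_forall_itoIntegral_eq hZ ht₀ hI hJ] with ω hXω hYω hIJ
  refine hF.eqOn_of_eq_add_integral (hX.2 ω) (hY.2 ω) hXω fun t ht => ?_
  rw [hYω t ht]
  simp only [forcing, hIJ _ _ t ht]

theorem IsSDESolution.hasExpMomentsOn (hZ : ∀ j, IsBrownianFor P 𝔽 (Z j)) (ht₀ : 0 ≤ t₀)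
    (h : t₀ ≤ T) (hF : IsLipschitzField (Set.Icc t₀ T) F) (hD : ContinuousOn D (Set.Icc t₀ T))
    (hX : IsSDESolution P 𝔽 Z t₀ T x₀ (fun i t x => F t x i) (fun i j t _ => D t i j) X) :
    HasExpMomentsOn P t₀ T X := by
  obtain ⟨hX, I, hI, X_eq⟩ := (isSDESolution_iff hF).1 hX
  obtain ⟨a, K, hle⟩ := hF.exists_norm_le_add_mul isCompact_Icc
  choose M hM abs_le using fun i j => (hI i j).hasExpMomentsOn (hZ j) ht₀ h
    (continuousOn_pi.1 (continuousOn_pi.1 hD i) j)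
  refine ⟨fun ω => Real.exp (K * (T - t₀)) * (‖x₀‖ + ∑ i, ∑ j, M i j ω + a * (T - t₀)),
    (((hasExpMoments_const _).add (.sum _ fun i => .sum _ (hM i))).add
      (hasExpMoments_const _)).const_mul _, ?_⟩
  filter_upwards [X_eq, ae_all_iff.2 fun i => ae_all_iff.2 (abs_le i)] with ω hXω hMω t ht
  rw [mul_comm]
  exact norm_le_of_eq_add_integral (hX.2 ω) hXω hle
    (fun s hs => norm_forcing_le fun i j => hMω i j s hs) ht

end AdditiveNoise

/-! ### Integrability of functions of a process with exponential moments -/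

section Domination

lemma uniformIntegrable_of_ae_norm_le {ι α β : Type*} {mα : MeasurableSpace α} {μ : Measure α}
    [NormedAddCommGroup β] {p : ℝ≥0∞} (hp : 1 ≤ p) (hp' : p ≠ ∞) {f : ι → α → β} {g : α → ℝ}
    (hf : ∀ i, AEStronglyMeasurable (f i) μ) (hg : MemLp g p μ)
    (hfg : ∀ i, ∀ᵐ x ∂μ, ‖f i x‖ ≤ g x) : UniformIntegrable f p μ := by
  refine ⟨hf, fun ε hε => ?_, (eLpNorm g p μ).toNNReal, fun i => ?_⟩
  · obtain ⟨δ, hδ, hgδ⟩ := unifIntegrable_const (ι := Unit) hp hp' hg hε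
    refine ⟨δ, hδ, fun i s hs hμs => le_trans (eLpNorm_mono_ae ?_) (hgδ () s hs hμs)⟩
    filter_upwards [hfg i] with x hx
    by_cases hxs : x ∈ s
    · simpa only [Set.indicator_of_mem hxs] using hx.trans (Real.le_norm_self _)
    · simp only [Set.indicator_of_notMem hxs, norm_zero, le_rfl]
  · rw [ENNReal.coe_toNNReal hg.eLpNorm_ne_top]
    exact eLpNorm_mono_ae_real (hfg i)

variable {Ω E : Type*} {mΩ : MeasurableSpace Ω} {P : Measure Ω} {𝔽 : Filtration ℝ≥0 mΩ} {t₀ T : ℝ}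
  [NormedAddCommGroup E] {Y : ℝ → Ω → E}

lemma HasExpMoments.lintegral_lt_top {M : Ω → ℝ} (hM : HasExpMoments P M) (c : ℝ) :
    ∫⁻ ω, ENNReal.ofReal (Real.exp (c * M ω)) ∂P < ∞ :=
  ((lintegral_ofReal_ne_top_iff_integrable (hM c).1
    (ae_of_all _ fun _ => Real.exp_nonneg _)).2 (hM c)).lt_top

namespace HasExpMomentsOn

lemma lintegral_iSup_lt_top (hY : HasExpMomentsOn P t₀ T Y) {c : ℝ} (hc : 0 ≤ c)
    {f : ℝ → Ω → ℝ≥0∞}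
    (hf : ∀ t ∈ Set.Icc t₀ T, ∀ ω, f t ω ≤ ENNReal.ofReal (Real.exp (c * ‖Y t ω‖))) :
    ∫⁻ ω, (⨆ t ∈ Set.Icc t₀ T, f t ω) ∂P < ∞ := by
  obtain ⟨M, hM, hle⟩ := hY
  refine (lintegral_mono_ae ?_).trans_lt (hM.lintegral_lt_top c)
  filter_upwards [hle] with ω hω
  refine iSup₂_le fun t ht => (hf t ht ω).trans ?_
  gcongr
  exact hω t ht

lemma memS2 [MeasurableSpace E] (hY : HasExpMomentsOn P t₀ T Y)
    (hY' : IsContinuousAdapted 𝔽 t₀ T Y) : MemS2 P 𝔽 t₀ T Y := by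
  refine ⟨hY', hY.lintegral_iSup_lt_top zero_le_two fun t _ ω => ?_⟩
  rw [← ofReal_norm, ← ENNReal.ofReal_pow (norm_nonneg _), two_mul, Real.exp_add, ← sq]
  gcongr
  exact (le_add_of_nonneg_right zero_le_one).trans (Real.add_one_le_exp _)

lemma of_norm_le [IsFiniteMeasure P] {G : Type*} [NormedAddCommGroup G] {Y' : ℝ → Ω → G}
    (hY : HasExpMomentsOn P t₀ T Y) {a K : ℝ≥0}
    (h : ∀ t ∈ Set.Icc t₀ T, ∀ ω, ‖Y' t ω‖ ≤ a + K * ‖Y t ω‖) : HasExpMomentsOn P t₀ T Y' := by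
  obtain ⟨M, hM, hle⟩ := hY
  refine ⟨fun ω => a + K * M ω, (hasExpMoments_const _).add (hM.const_mul _), ?_⟩
  filter_upwards [hle] with ω hω t ht
  refine (h t ht ω).trans ?_
  gcongr
  exact hω t ht

lemma uniformIntegrable_exp {β : ℝ → E → ℝ} {K : ℝ≥0} (hY : HasExpMomentsOn P t₀ T Y)
    (hmeas : ∀ t ∈ Set.Icc t₀ T, AEStronglyMeasurable (fun ω => β t (Y t ω)) P)
    (hβ : ∀ t ∈ Set.Icc t₀ T, ∀ y, β t y ≤ K * ‖y‖) :
    UniformIntegrable (fun (t : Set.Icc t₀ T) ω => Real.exp (β t (Y t ω))) 1 P := by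
  obtain ⟨M, hM, hle⟩ := hY
  refine uniformIntegrable_of_ae_norm_le le_rfl ENNReal.one_ne_top
    (fun t => Real.continuous_exp.comp_aestronglyMeasurable (hmeas t t.2))
    (memLp_one_iff_integrable.2 (hM K)) fun t => ?_
  filter_upwards [hle] with ω hω
  rw [Real.norm_eq_abs, Real.abs_exp, Real.exp_le_exp]
  refine (hβ t t.2 _).trans ?_
  gcongr
  exact hω t t.2

end HasExpMomentsOn

namespace MemS2

variable [MeasurableSpace E]

lemma lintegral_setLIntegral_lt_top (hY : MemS2 P 𝔽 t₀ T Y) :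
    ∫⁻ ω, (∫⁻ s in Set.Icc t₀ T, ‖Y s ω‖ₑ ^ 2) ∂P < ∞ := by
  refine (lintegral_mono fun ω =>
    setLIntegral_mono (g := fun _ => ⨆ t ∈ Set.Icc t₀ T, ‖Y t ω‖ₑ ^ 2) measurable_const
      fun s hs => le_iSup₂ (f := fun t _ => ‖Y t ω‖ₑ ^ 2) s hs).trans_lt ?_
  simp only [setLIntegral_const, Real.volume_Icc]
  rw [lintegral_mul_const' _ _ ENNReal.ofReal_ne_top]
  exact ENNReal.mul_lt_top hY.2 ENNReal.ofReal_lt_top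

lemma memH2 [BorelSpace E] (hY : MemS2 P 𝔽 t₀ T Y) : MemH2 P 𝔽 t₀ T Y :=
  ⟨hY.1.isProgressiveOn, hY.lintegral_setLIntegral_lt_top⟩

lemma lintegral_enorm_sq_lt_top (hY : MemS2 P 𝔽 t₀ T Y) {t : ℝ} (ht : t ∈ Set.Icc t₀ T) :
    ∫⁻ ω, ‖Y t ω‖ₑ ^ 2 ∂P < ∞ :=
  (lintegral_mono fun ω => le_iSup₂ (f := fun t _ => ‖Y t ω‖ₑ ^ 2) t ht).trans_lt hY.2

lemma memL2 {Y : ℝ → Ω → ℝ} (hY : MemS2 P 𝔽 t₀ T Y) {t : ℝ} (ht : t ∈ Set.Icc t₀ T) :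
    MemL2 P (𝔽 t.toNNReal) (Y t) := by
  have Y_meas := hY.1.1 t ht
  refine ⟨Y_meas, (Y_meas.mono (𝔽.le _) le_rfl).aestronglyMeasurable, ?_⟩
  rw [eLpNorm_lt_top_iff_lintegral_rpow_enorm_lt_top two_ne_zero ENNReal.ofNat_ne_top]
  simpa using hY.lintegral_enorm_sq_lt_top ht

end MemS2

end Domination

section Composition

variable {Ω E G : Type*} {mΩ : MeasurableSpace Ω} {𝔽 : Filtration ℝ≥0 mΩ} {t₀ T : ℝ}
  {X : ℝ → Ω → E}

lemma IsContinuousAdapted.continuous_comp [TopologicalSpace E] [MeasurableSpace E]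
    [OpensMeasurableSpace E] [TopologicalSpace G] [MeasurableSpace G] [BorelSpace G]
    (hX : IsContinuousAdapted 𝔽 t₀ T X) {g : E → G} (hg : Continuous g) :
    IsContinuousAdapted 𝔽 t₀ T fun t ω => g (X t ω) :=
  ⟨fun t ht => hg.measurable.comp (hX.1 t ht), fun ω => hg.comp_continuousOn (hX.2 ω)⟩

namespace IsLipschitzField

variable [NormedAddCommGroup E] {F : ℝ → E → E}

lemma isContinuousAdapted_comp [MeasurableSpace E] [BorelSpace E]
    (hF : IsLipschitzField (Set.Icc t₀ T) F) (hX : IsContinuousAdapted 𝔽 t₀ T X) :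
    IsContinuousAdapted 𝔽 t₀ T fun t ω => F t (X t ω) := by
  refine ⟨fun t ht => ?_, fun ω => hF.continuousOn_comp (hX.2 ω)⟩
  obtain ⟨K, hK⟩ := hF.exists_lipschitzWith
  exact (hK t ht).continuous.measurable.comp (hX.1 t ht)

lemma hasExpMomentsOn_comp {P : Measure Ω} [IsFiniteMeasure P]
    (hF : IsLipschitzField (Set.Icc t₀ T) F) (hX : HasExpMomentsOn P t₀ T X) :
    HasExpMomentsOn P t₀ T fun t ω => F t (X t ω) := by
  obtain ⟨a, K, hle⟩ := hF.exists_norm_le_add_mul isCompact_Icc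
  exact hX.of_norm_le fun t ht ω => hle t ht (X t ω)

end IsLipschitzField

end Composition

/-! ### Utilities -/

section Utility

variable {n : ℕ} (κ : Params n) (i : Fin n)

lemma abs_othersMean_le (x : EuclideanSpace ℝ (Fin n)) : |othersMean i x| ≤ ‖x‖ := by
  have n_pos : (0 : ℝ) < n := Nat.cast_pos.2 i.pos
  have card_le : ((Finset.univ.erase i).card : ℝ) ≤ n :=
    Nat.cast_le.2 ((Finset.card_le_univ _).trans_eq (Fintype.card_fin n))
  rw [othersMean, abs_mul, abs_of_nonneg (one_div_nonneg.2 n_pos.le), one_div_mul_eq_div,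
    div_le_iff₀' n_pos]
  calc |∑ k ∈ Finset.univ.erase i, x k| ≤ ∑ k ∈ Finset.univ.erase i, |x k| :=
        Finset.abs_sum_le_sum_abs _ _
    _ ≤ (Finset.univ.erase i).card • ‖x‖ :=
        Finset.sum_le_card_nsmul _ _ _ fun k _ => PiLp.norm_apply_le x k
    _ ≤ n * ‖x‖ := by
        rw [nsmul_eq_mul]
        gcongr

lemma continuous_othersMean : Continuous (othersMean i) := by
  unfold othersMean
  fun_prop

namespace Params

lemma continuous_utility :
    Continuous fun x : EuclideanSpace ℝ (Fin n) => κ.utility i (x i) (othersMean i x) := by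
  have := (continuous_othersMean i).comp (PiLp.continuous_ofLp 2 fun _ : Fin n => ℝ)
  simp only [Function.comp_def] at this
  unfold utility
  fun_prop

lemma exists_enorm_utility_sq_le : ∃ c, 0 ≤ c ∧ ∀ x : EuclideanSpace ℝ (Fin n),
    ‖κ.utility i (x i) (othersMean i x)‖ₑ ^ 2 ≤ ENNReal.ofReal (Real.exp (c * ‖x‖)) := by
  set a := -(1 / κ.δ i) * (1 - κ.θ i / n)
  set b := κ.θ i / κ.δ i
  refine ⟨2 * (|a| + |b|), by positivity, fun x => ?_⟩
  have exponent_le : a * x i + b * othersMean i x ≤ (|a| + |b|) * ‖x‖ := by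
    rw [add_mul]
    refine add_le_add ?_ ?_ <;> refine (le_abs_self _).trans ?_ <;> rw [abs_mul] <;> gcongr
    · exact PiLp.norm_apply_le x i
    · exact abs_othersMean_le i x
  rw [utility, enorm_neg, Real.enorm_of_nonneg (Real.exp_nonneg _),
    ← ENNReal.ofReal_pow (Real.exp_nonneg _), ← Real.exp_nat_mul, Nat.cast_ofNat, mul_assoc 2]
  exact ENNReal.ofReal_le_ofReal (Real.exp_le_exp.2 (by gcongr))

variable {Ω : Type*} {mΩ : MeasurableSpace Ω} {P : Measure Ω} {𝔽 : Filtration ℝ≥0 mΩ} {t₀ T : ℝ}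
  {Y : ℝ → Ω → EuclideanSpace ℝ (Fin n)}

lemma memS2_utility (hY : HasExpMomentsOn P t₀ T Y) (hY' : IsContinuousAdapted 𝔽 t₀ T Y) :
    MemS2 P 𝔽 t₀ T fun t ω => κ.utility i (Y t ω i) (othersMean i fun k => Y t ω k) := by
  refine ⟨hY'.continuous_comp (κ.continuous_utility i), ?_⟩
  obtain ⟨c, hc, hle⟩ := κ.exists_enorm_utility_sq_le i
  exact hY.lintegral_iSup_lt_top hc fun t _ ω => hle (Y t ω)

end Params

end Utility

/-! ### The closed-loop system -/

section ClosedLoop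

variable {n : ℕ} (κ : Params n) {t₀ T : ℝ} {Pol : Fin n → ℝ → ℝ}
  {Con : Fin n → ℝ → EuclideanSpace ℝ (Fin n) → ℝ}

lemma Params.continuous_loading (i : Fin n) (j : Option (Fin n)) :
    Continuous fun p => κ.loading i p j := by
  rcases j with _ | k
  · exact continuous_mul_const _
  · simp only [Params.loading]
    split_ifs
    exacts [continuous_mul_const _, continuous_const]

namespace IsDFStrategy

lemma exists_consumption_eq (hDF : IsDFStrategy T Pol Con) :
    ∃ (A : ℝ → Matrix (Fin n) (Fin n) ℝ) (b : ℝ → Fin n → ℝ),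
      ContinuousOn A (Set.Icc 0 T) ∧ ContinuousOn b (Set.Icc 0 T) ∧
      ∀ t ∈ Set.Icc 0 T, ∀ x i, Con i t x = ∑ k, A t i k * x k + b t i := by
  choose _ p q hp hq h using hDF
  exact ⟨fun t i k => p i k t, fun t i => q i t,
    continuousOn_pi.2 fun i => continuousOn_pi.2 fun k => hp i k,
    continuousOn_pi.2 hq, fun t ht x i => h i t ht x⟩

lemma continuousOn_loading (hDF : IsDFStrategy T Pol Con) :
    ContinuousOn (fun t i j => κ.loading i (Pol i t) j) (Set.Icc 0 T) :=
  continuousOn_pi.2 fun i => continuousOn_pi.2 fun j =>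
    (κ.continuous_loading i j).comp_continuousOn (hDF i).1

lemma exists_closedLoop_eq (hDF : IsDFStrategy T Pol Con) :
    ∃ (A : ℝ → Matrix (Fin n) (Fin n) ℝ) (b : ℝ → Fin n → ℝ)
      (D : ℝ → Matrix (Fin n) (Option (Fin n)) ℝ),
      ContinuousOn A (Set.Icc 0 T) ∧ ContinuousOn b (Set.Icc 0 T) ∧
      ContinuousOn D (Set.Icc 0 T) ∧
      ∀ t ∈ Set.Icc 0 T, ∀ (x : EuclideanSpace ℝ (Fin n)) (i : Fin n),
        closedLoopDrift κ Pol Con i t x = ∑ k, A t i k * x k + b t i ∧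
        ∀ j, closedLoopDiff κ Pol i j t x = D t i j := by
  obtain ⟨A, b, hA, hb, Con_eq⟩ := hDF.exists_consumption_eq
  refine ⟨fun t => -A t, fun t i => Pol i t * κ.μ i - b t i, fun t i j => κ.loading i (Pol i t) j,
    hA.neg, continuousOn_pi.2 fun i => ((hDF i).1.mul_const _).sub (continuousOn_pi.1 hb i),
    hDF.continuousOn_loading κ, fun t ht x i => ⟨?_, fun _ => rfl⟩⟩
  simp only [closedLoopDrift, Con_eq t ht x i, Matrix.neg_apply, neg_mul, Finset.sum_neg_distrib]
  ring

lemma isLipschitzField_consumption (hDF : IsDFStrategy T Pol Con) :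
    IsLipschitzField (Set.Icc 0 T) fun t x => WithLp.toLp 2 fun i => Con i t x := by
  obtain ⟨A, b, hA, hb, Con_eq⟩ := hDF.exists_consumption_eq
  refine (isLipschitzField_mulVec_add isCompact_Icc hA hb).congr fun t ht => ?_
  ext x i
  exact (Con_eq t ht x i).symm

lemma isLipschitzField_closedLoopDrift (hDF : IsDFStrategy T Pol Con) :
    IsLipschitzField (Set.Icc 0 T) fun t x =>
      WithLp.toLp 2 fun i => closedLoopDrift κ Pol Con i t x := by
  obtain ⟨A, b, _, hA, hb, -, h⟩ := hDF.exists_closedLoop_eq κ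
  refine (isLipschitzField_mulVec_add isCompact_Icc hA hb).congr fun t ht => ?_
  ext x i
  exact (h t ht x i).1.symm

end IsDFStrategy

end ClosedLoop

section ClosedLoopSolution

variable {Ω : Type*} {mΩ : MeasurableSpace Ω} {P : Measure Ω} {𝔽 : Filtration ℝ≥0 mΩ} {n : ℕ}
  {κ : Params n} {W : Fin n → ℝ≥0 → Ω → ℝ} {B : ℝ≥0 → Ω → ℝ} {t₀ T : ℝ}
  {x₀ : EuclideanSpace ℝ (Fin n)} {Pol : Fin n → ℝ → ℝ}
  {Con : Fin n → ℝ → EuclideanSpace ℝ (Fin n) → ℝ} {X Y : ℝ → Ω → EuclideanSpace ℝ (Fin n)}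

lemma isClosedLoopSolution_iff_isLinearSDESolution {A : ℝ → Matrix (Fin n) (Fin n) ℝ}
    {b : ℝ → Fin n → ℝ} {D : ℝ → Matrix (Fin n) (Option (Fin n)) ℝ}
    (h : ∀ t ∈ Set.Icc t₀ T, ∀ (x : EuclideanSpace ℝ (Fin n)) (i : Fin n),
      closedLoopDrift κ Pol Con i t x = ∑ k, A t i k * x k + b t i ∧
      ∀ j, closedLoopDiff κ Pol i j t x = D t i j) :
    IsClosedLoopSolution κ P 𝔽 W B t₀ T x₀ Pol Con X ↔
      IsLinearSDESolution P 𝔽 W B t₀ T x₀ A b D X :=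
  ⟨fun hX => hX.congr (fun i t ht => funext fun _ => (h t ht _ i).1)
      fun i j t ht => funext fun ω => (h t ht (X t ω) i).2 j,
    fun hX => hX.congr (fun i t ht => funext fun _ => ((h t ht _ i).1).symm)
      fun i j t ht => funext fun ω => ((h t ht (X t ω) i).2 j).symm⟩

lemma MemS2.lintegral_add_terminal_lt_top {u v : ℝ → Ω → ℝ} (h : t₀ ≤ T)
    (hu : MemS2 P 𝔽 t₀ T u) (hv : MemS2 P 𝔽 t₀ T v) :
    ∫⁻ ω, ((∫⁻ t in Set.Icc t₀ T, ‖u t ω‖ₑ ^ 2) + ‖v T ω‖ₑ ^ 2) ∂P < ∞ := by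
  have T_mem : T ∈ Set.Icc t₀ T := ⟨h, le_rfl⟩
  have v_meas : Measurable (v T) := (hv.1.1 T T_mem).mono (𝔽.le _) le_rfl
  rw [lintegral_add_right _ (v_meas.enorm.pow_const 2)]
  exact ENNReal.add_lt_top.2
    ⟨hu.lintegral_setLIntegral_lt_top, hv.lintegral_enorm_sq_lt_top T_mem⟩

lemma exists_sum_mul_le_mul_norm {s : Set ℝ} (hs : IsCompact s) {β : ℝ → Fin n → ℝ}
    (hβ : ContinuousOn β s) :
    ∃ K : ℝ≥0, ∀ t ∈ s, ∀ x : EuclideanSpace ℝ (Fin n), ∑ k, β t k * x k ≤ K * ‖x‖ := by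
  obtain ⟨K, hK⟩ := hs.exists_bound_of_continuousOn
    ((PiLp.continuous_toLp 2 _).comp_continuousOn hβ)
  refine ⟨K.toNNReal, fun t ht x => ?_⟩
  calc ∑ k, β t k * x k = inner ℝ x (WithLp.toLp 2 (β t)) := by
        simp [PiLp.inner_apply]
    _ ≤ ‖WithLp.toLp 2 (β t)‖ * ‖x‖ := by
        rw [mul_comm]; exact real_inner_le_norm _ _
    _ ≤ K.toNNReal * ‖x‖ := by
        gcongr
        exact (hK t ht).trans (Real.le_coe_toNNReal K)

namespace IsDFStrategy

lemma memS2_consumption [IsFiniteMeasure P] (hDF : IsDFStrategy T Pol Con) (ht₀ : 0 ≤ t₀)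
    (hX : HasExpMomentsOn P t₀ T X) (hX' : IsContinuousAdapted 𝔽 t₀ T X) (i : Fin n) :
    MemS2 P 𝔽 t₀ T fun t ω => Con i t (X t ω) := by
  have hC := hDF.isLipschitzField_consumption.mono (Set.Icc_subset_Icc_left ht₀)
  refine HasExpMomentsOn.memS2 ((hC.hasExpMomentsOn_comp hX).of_norm_le (a := 0) (K := 1) ?_)
    ((hC.isContinuousAdapted_comp hX').continuous_comp (EuclideanSpace.proj (𝕜 := ℝ) i).continuous)
  intro t _ ω
  rw [NNReal.coe_zero, NNReal.coe_one, zero_add, one_mul]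
  exact PiLp.norm_apply_le (WithLp.toLp 2 fun i => Con i t (X t ω)) i

lemma memS2_utility_consumption [IsFiniteMeasure P] (hDF : IsDFStrategy T Pol Con)
    (κ : Params n) (ht₀ : 0 ≤ t₀) (hX : HasExpMomentsOn P t₀ T X)
    (hX' : IsContinuousAdapted 𝔽 t₀ T X) (i : Fin n) :
    MemS2 P 𝔽 t₀ T fun t ω =>
      κ.utility i (Con i t (X t ω)) (othersMean i fun k => Con k t (X t ω)) :=
  have hC := hDF.isLipschitzField_consumption.mono (Set.Icc_subset_Icc_left ht₀)
  κ.memS2_utility i (hC.hasExpMomentsOn_comp hX) (hC.isContinuousAdapted_comp hX')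

variable [IsProbabilityMeasure P]

theorem exists_isClosedLoopSolution (hDF : IsDFStrategy T Pol Con)
    (hZ : ∀ j, IsBrownianFor P 𝔽 (noise W B j)) (ht₀ : 0 ≤ t₀) (h : t₀ ≤ T) :
    ∃ X, IsClosedLoopSolution κ P 𝔽 W B t₀ T x₀ Pol Con X :=
  exists_isSDESolution hZ ht₀ h
    ((hDF.isLipschitzField_closedLoopDrift κ).mono (Set.Icc_subset_Icc_left ht₀))
    ((hDF.continuousOn_loading κ).mono (Set.Icc_subset_Icc_left ht₀))

end IsDFStrategy

namespace IsClosedLoopSolution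

variable [IsProbabilityMeasure P]

theorem ae_eq (hX : IsClosedLoopSolution κ P 𝔽 W B t₀ T x₀ Pol Con X)
    (hY : IsClosedLoopSolution κ P 𝔽 W B t₀ T x₀ Pol Con Y) (hDF : IsDFStrategy T Pol Con)
    (hZ : ∀ j, IsBrownianFor P 𝔽 (noise W B j)) (ht₀ : 0 ≤ t₀) :
    ∀ᵐ ω ∂P, ∀ t ∈ Set.Icc t₀ T, X t ω = Y t ω :=
  IsSDESolution.ae_eq hZ ht₀
    ((hDF.isLipschitzField_closedLoopDrift κ).mono (Set.Icc_subset_Icc_left ht₀)) hX hY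

theorem hasExpMomentsOn (hX : IsClosedLoopSolution κ P 𝔽 W B t₀ T x₀ Pol Con X)
    (hDF : IsDFStrategy T Pol Con) (hZ : ∀ j, IsBrownianFor P 𝔽 (noise W B j)) (ht₀ : 0 ≤ t₀)
    (h : t₀ ≤ T) : HasExpMomentsOn P t₀ T X :=
  IsSDESolution.hasExpMomentsOn hZ ht₀ h
    ((hDF.isLipschitzField_closedLoopDrift κ).mono (Set.Icc_subset_Icc_left ht₀))
    ((hDF.continuousOn_loading κ).mono (Set.Icc_subset_Icc_left ht₀)) hX

theorem isAdmissible (hX : IsClosedLoopSolution κ P 𝔽 W B t₀ T x₀ Pol Con X)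
    (hDF : IsDFStrategy T Pol Con) (hZ : ∀ j, IsBrownianFor P 𝔽 (noise W B j)) (ht₀ : 0 ≤ t₀)
    (h : t₀ ≤ T) :
    IsAdmissible P 𝔽 t₀ T (fun i t _ => Pol i t) fun i t ω => Con i t (X t ω) := fun i =>
  ⟨memH2_of_continuousOn ((hDF i).1.mono (Set.Icc_subset_Icc_left ht₀)),
    (hDF.memS2_consumption ht₀ (hX.hasExpMomentsOn hDF hZ ht₀ h) hX.1 i).memH2⟩

theorem integrabilityCondition (hX : IsClosedLoopSolution κ P 𝔽 W B t₀ T x₀ Pol Con X)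
    (hDF : IsDFStrategy T Pol Con) (hZ : ∀ j, IsBrownianFor P 𝔽 (noise W B j)) (ht₀ : 0 ≤ t₀)
    (h : t₀ ≤ T) :
    IntegrabilityCondition κ P 𝔽 W B t₀ T x₀ (fun i t _ => Pol i t)
      fun i t ω => Con i t (X t ω) := by
  refine ⟨hX.isAdmissible hDF hZ ht₀ h, ⟨X, hX⟩, fun Y hY i => ?_⟩
  have hXexp := hX.hasExpMomentsOn hDF hZ ht₀ h
  refine (lintegral_congr_ae ?_).trans_lt
    (MemS2.lintegral_add_terminal_lt_top h (hDF.memS2_utility_consumption κ ht₀ hXexp hX.1 i)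
      (κ.memS2_utility i hXexp hX.1))
  filter_upwards [IsItoProcess.ae_eq hZ ht₀ hY hX] with ω hω
  rw [hω T ⟨h, le_rfl⟩]

end IsClosedLoopSolution

end ClosedLoopSolution

end CARAGame

theorem mainTheorem5_general {Ω : Type*} [MeasurableSpace Ω] (P : MeasureTheory.Measure Ω)
    [MeasureTheory.IsProbabilityMeasure P] (n : ℕ) (κ : CARAGame.Params n)
    (W : Fin n → ℝ≥0 → Ω → ℝ) (B : ℝ≥0 → Ω → ℝ)
    (𝔽 : MeasureTheory.Filtration ℝ≥0 ‹MeasurableSpace Ω›)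
    (hZ : ∀ j, CARAGame.IsBrownianFor P 𝔽 (CARAGame.noise W B j))
    (T : ℝ) (Pol : Fin n → ℝ → ℝ) (Con : Fin n → ℝ → EuclideanSpace ℝ (Fin n) → ℝ)
    (hDF : CARAGame.IsDFStrategy T Pol Con)
    (t₀ : ℝ) (ht₀ : 0 ≤ t₀) (ht₀T : t₀ ≤ T) (x₀ : EuclideanSpace ℝ (Fin n)) :
    (∃ (A : ℝ → Matrix (Fin n) (Fin n) ℝ) (b : ℝ → Fin n → ℝ)
        (D : ℝ → Matrix (Fin n) (Option (Fin n)) ℝ),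
      ContinuousOn A (Set.Icc 0 T) ∧ ContinuousOn b (Set.Icc 0 T) ∧
      ContinuousOn D (Set.Icc 0 T) ∧
      (∀ t ∈ Set.Icc 0 T, ∀ (x : EuclideanSpace ℝ (Fin n)) (i : Fin n),
        CARAGame.closedLoopDrift κ Pol Con i t x = ∑ k, A t i k * x k + b t i ∧
        ∀ j, CARAGame.closedLoopDiff κ Pol i j t x = D t i j) ∧
      ∀ X : ℝ → Ω → EuclideanSpace ℝ (Fin n),
        CARAGame.IsClosedLoopSolution κ P 𝔽 W B t₀ T x₀ Pol Con X ↔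
          CARAGame.IsLinearSDESolution P 𝔽 W B t₀ T x₀ A b D X) ∧
    (∃ X : ℝ → Ω → EuclideanSpace ℝ (Fin n),
      CARAGame.IsClosedLoopSolution κ P 𝔽 W B t₀ T x₀ Pol Con X) ∧
    (∀ X Y : ℝ → Ω → EuclideanSpace ℝ (Fin n),
      CARAGame.IsClosedLoopSolution κ P 𝔽 W B t₀ T x₀ Pol Con X →
      CARAGame.IsClosedLoopSolution κ P 𝔽 W B t₀ T x₀ Pol Con Y →
      ∀ᵐ ω ∂P, ∀ t ∈ Set.Icc t₀ T, X t ω = Y t ω) ∧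
    ∀ X : ℝ → Ω → EuclideanSpace ℝ (Fin n),
      CARAGame.IsClosedLoopSolution κ P 𝔽 W B t₀ T x₀ Pol Con X →
      CARAGame.MemS2 P 𝔽 t₀ T X ∧
      CARAGame.IsAdmissible P 𝔽 t₀ T (fun i t _ => Pol i t) (fun i t ω => Con i t (X t ω)) ∧
      CARAGame.IsWealth κ P 𝔽 W B t₀ T x₀
        (fun i t _ => Pol i t) (fun i t ω => Con i t (X t ω)) X ∧
      (∀ β : ℝ → Fin n → ℝ, ContinuousOn β (Set.Icc t₀ T) →
        MeasureTheory.UniformIntegrable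
          (fun (t : Set.Icc t₀ T) ω => Real.exp (∑ k, β t k * X t ω k)) 1 P) ∧
      (∀ i, CARAGame.MemL2 P (𝔽 T.toNNReal) fun ω =>
        κ.utility i (X T ω i) (CARAGame.othersMean i fun k => X T ω k)) ∧
      CARAGame.IntegrabilityCondition κ P 𝔽 W B t₀ T x₀
        (fun i t _ => Pol i t) (fun i t ω => Con i t (X t ω)) := by
  refine ⟨?_, hDF.exists_isClosedLoopSolution hZ ht₀ ht₀T,
    fun X Y hX hY => hX.ae_eq hY hDF hZ ht₀, fun X hX => ?_⟩
  · obtain ⟨A, b, D, hA, hb, hD, h⟩ := hDF.exists_closedLoop_eq κ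
    exact ⟨A, b, D, hA, hb, hD, h, fun X =>
      CARAGame.isClosedLoopSolution_iff_isLinearSDESolution fun t ht =>
        h t (Set.Icc_subset_Icc_left ht₀ ht)⟩
  have X_exp : CARAGame.HasExpMomentsOn P t₀ T X := hX.hasExpMomentsOn hDF hZ ht₀ ht₀T
  refine ⟨X_exp.memS2 hX.1, hX.isAdmissible hDF hZ ht₀ ht₀T, hX, fun β hβ => ?_,
    fun i => (κ.memS2_utility i X_exp hX.1).memL2 ⟨ht₀T, le_rfl⟩,
    hX.integrabilityCondition hDF hZ ht₀ ht₀T⟩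
  obtain ⟨K, hK⟩ := CARAGame.exists_sum_mul_le_mul_norm isCompact_Icc hβ
  refine X_exp.uniformIntegrable_exp (fun t ht => ?_) hK
  have X_meas : Measurable (X t) := (hX.1.1 t ht).mono (𝔽.le _) le_rfl
  fun_prop

theorem mainTheorem5 {Ω : Type*} [MeasurableSpace Ω] (P : MeasureTheory.Measure Ω)
    [MeasureTheory.IsProbabilityMeasure P] (n : ℕ) (κ : CARAGame.Params n)
    (W : Fin n → ℝ≥0 → Ω → ℝ) (B : ℝ≥0 → Ω → ℝ)
    (hWB : CARAGame.IsBrownianFamily P (CARAGame.noise W B))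
    (𝔽 : MeasureTheory.Filtration ℝ≥0 ‹MeasurableSpace Ω›)
    (h𝔽 : 𝔽 = CARAGame.generatedFiltration P (CARAGame.noise W B) hWB.measurable)
    (T : ℝ) (Pol : Fin n → ℝ → ℝ) (Con : Fin n → ℝ → EuclideanSpace ℝ (Fin n) → ℝ)
    (hDF : CARAGame.IsDFStrategy T Pol Con)
    (t₀ : ℝ) (ht₀ : 0 ≤ t₀) (ht₀T : t₀ < T) (x₀ : EuclideanSpace ℝ (Fin n)) :
    -- the closed-loop system is a linear SDE with continuous deterministic coefficients
    (∃ (A : ℝ → Matrix (Fin n) (Fin n) ℝ) (b : ℝ → Fin n → ℝ)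
        (D : ℝ → Matrix (Fin n) (Option (Fin n)) ℝ),
      ContinuousOn A (Set.Icc 0 T) ∧ ContinuousOn b (Set.Icc 0 T) ∧
      ContinuousOn D (Set.Icc 0 T) ∧
      (∀ t ∈ Set.Icc 0 T, ∀ (x : EuclideanSpace ℝ (Fin n)) (i : Fin n),
        CARAGame.closedLoopDrift κ Pol Con i t x = ∑ k, A t i k * x k + b t i ∧
        ∀ j, CARAGame.closedLoopDiff κ Pol i j t x = D t i j) ∧
      ∀ X : ℝ → Ω → EuclideanSpace ℝ (Fin n),
        CARAGame.IsClosedLoopSolution κ P 𝔽 W B t₀ T x₀ Pol Con X ↔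
          CARAGame.IsLinearSDESolution P 𝔽 W B t₀ T x₀ A b D X) ∧
    -- it has a solution
    (∃ X : ℝ → Ω → EuclideanSpace ℝ (Fin n),
      CARAGame.IsClosedLoopSolution κ P 𝔽 W B t₀ T x₀ Pol Con X) ∧
    -- which is unique up to indistinguishability
    (∀ X Y : ℝ → Ω → EuclideanSpace ℝ (Fin n),
      CARAGame.IsClosedLoopSolution κ P 𝔽 W B t₀ T x₀ Pol Con X →
      CARAGame.IsClosedLoopSolution κ P 𝔽 W B t₀ T x₀ Pol Con Y →
      ∀ᵐ ω ∂P, ∀ t ∈ Set.Icc t₀ T, X t ω = Y t ω) ∧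
    ∀ X : ℝ → Ω → EuclideanSpace ℝ (Fin n),
      CARAGame.IsClosedLoopSolution κ P 𝔽 W B t₀ T x₀ Pol Con X →
      CARAGame.MemS2 P 𝔽 t₀ T X ∧
      -- the outcome is admissible, and `X` is its wealth process
      CARAGame.IsAdmissible P 𝔽 t₀ T (fun i t _ => Pol i t) (fun i t ω => Con i t (X t ω)) ∧
      CARAGame.IsWealth κ P 𝔽 W B t₀ T x₀
        (fun i t _ => Pol i t) (fun i t ω => Con i t (X t ω)) X ∧
      -- exponentials of linear functionals of the state are uniformly integrable
      (∀ β : ℝ → Fin n → ℝ, ContinuousOn β (Set.Icc t₀ T) →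
        MeasureTheory.UniformIntegrable
          (fun (t : Set.Icc t₀ T) ω => Real.exp (∑ k, β t k * X t ω k)) 1 P) ∧
      -- the square-integrability conditions on the utilities
      (∀ i, CARAGame.MemL2 P (𝔽 T.toNNReal) fun ω =>
        κ.utility i (X T ω i) (CARAGame.othersMean i fun k => X T ω k)) ∧
      CARAGame.IntegrabilityCondition κ P 𝔽 W B t₀ T x₀
        (fun i t _ => Pol i t) (fun i t ω => Con i t (X t ω)) := by
  subst h𝔽
  exact mainTheorem5_general P n κ W B _ hWB.isBrownianFor T Pol Con hDF t₀ ht₀ ht₀T.le x₀
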